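/- Let $n\ge 2$ and let $\theta$ be a real antisymmetric $n\times n$ matrix with columns $\theta_1,\dots,\theta_n$. On $L^2(\mathbb T^n)$, $\mathbb T^n=\mathbb R^n/2\pi\mathbb Z^n$, with normalized measure, let $(U_j\xi)(x)=e^{ix_j}\xi(x+\pi\theta_j)$, $(V_s\xi)(x)=\xi(x+s)$, $U^k=U_1^{k_1}\cdots U_n^{k_n}$ $(k\in\mathbb Z^n)$, $\alpha_s(T)=V_sTV_s^{-1}$ and $\tau(T)=\langle T1,1\rangle$. Let $A_\theta$ be the $C^*$-algebra generated by $U_1,\dots,U_n$, and $\mathscr A_\theta=\{u\in A_\theta:\ s\mapsto\alpha_s(u)\text{ is }C^\infty\}$ with the topology of the seminorms $\|\delta^\alpha u\|$, $\alpha\in\mathbb N_0^n$, where $\delta_j(u)=\frac1i\partial_{s_j}\alpha_s(u)|_{s=0}$. Let $\mathscr A_\theta'$ be its topological dual, into which $\mathscr A_\theta$ embeds by $\langle u,v\rangle=\tau(uv)$; let $\mathscr H_\theta$ be the Hilbert space completion of $\mathrm{span}\{U^k\}$ for the inner product $\tau(uv^*)$. Elements of $\mathscr A_\theta'$ and $\mathscr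 H_\theta$ are identified with their Fourier series $\sum u_kU^k$, where $u_k=\langle u,(U^k)^*\rangle$ on $\mathscr A_\theta'$ and $u_k=\langle u,U^k\rangle_{\mathscr H_\theta}$ on $\mathscr H_\theta$. For $s\in\mathbb R$ let $\Lambda^su=\sum(1+|k|^2)^{s/2}u_kU^k$ and let $\mathscr H_\theta^{(s)}=\{u\in\mathscr A_\theta':\Lambda^su\in\mathscr H_\theta\}$ with the norm $\|u\|_s=\|\Lambda^su\|_{\mathscr H_\theta}$. For $m\in\mathbb R$ let $\mathbb S^m(\mathbb R^n;\mathscr A_\theta)$ be the space of all $\rho\in C^\infty(\mathbb R^n;\mathscr A_\theta)$ such that $\sup_\xi(1+|\xi|)^{-m+|\beta|}\|\delta^\alpha\partial_\xi^\beta\rho(\xi)\|<\infty$ for all multi-indices $\alpha,\beta$, with the locally convex topology generated by these seminorms. For $\rho\in\mathbb S^m(\mathbb R^n;\mathscr A_\theta)$ and $u\in\mathscr A_\theta$ let $$P_\rho u=(2\pi)^{-n}\iint e^{is\cdot\xi}\rho(\xi)\alpha_{-s}(u)\,ds\,d\xi ,$$ an $\mathscr A_\theta$-valued oscillating integral: it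 is the element of $\mathscr A_\theta$ such that, for all $\varphi\in\mathscr A_\theta'$ and all $\chi\in C_c^\infty(\mathbb R^n\times\mathbb R^n)$ with $\chi(0,0)=1$, $$\varphi(P_\rho u)=\lim_{\epsilon\to0^+}(2\pi)^{-n}\iint e^{is\cdot\xi}\chi(\epsilon s,\epsilon\xi)\,\varphi\big(\rho(\xi)\alpha_{-s}(u)\big)\,ds\,d\xi .$$ Let $m\in\mathbb R$. The oscillating integral $P_\rho u$ exists for all $\rho\in\mathbb S^m(\mathbb R^n;\mathscr A_\theta)$ and $u\in\mathscr A_\theta$, and the following holds. 1. For every $s\in\mathbb R$ and every $\rho\in\mathbb S^m(\mathbb R^n;\mathscr A_\theta)$, the operator $P_\rho$ extends uniquely from $\mathscr A_\theta$ (which is contained in $\mathscr H_\theta^{(s+m)}$) to a continuous linear map $P_\rho:\mathscr H_\theta^{(s+m)}\to\mathscr H_\theta^{(s)}$. This provides a continuous linear map $\rho\mapsto P_\rho$ from $\mathbb S^m(\mathbb R^n;\mathscr A_\theta)$ to $\mathscr L(\mathscr H_\theta^{(s+m)},\mathscr H_\theta^{(s)})$ with its operator norm topology. 2. If $m<0$,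 then for every $\rho\in\mathbb S^m(\mathbb R^n;\mathscr A_\theta)$ the operator $P_\rho$ extends uniquely to a bounded operator on $\mathscr H_\theta$, and this operator is compact. -/

import Mathlib

noncomputable section

open scoped ContDiff Topology InnerProductSpace ENNReal
open MeasureTheory Filter

namespace NCTorus

/-- `ℝⁿ` with its Euclidean norm. -/
abbrev Eucl (n : ℕ) := EuclideanSpace ℝ (Fin n)

/-- The normalized measure of the torus. The torus `ℝⁿ / 2πℤⁿ` is realized as `(ℝ / ℤ)ⁿ` through
`x = 2πy`; the normalized Lebesgue measure `(2π)⁻ⁿ dx` becomes the Haar probability measure. -/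
abbrev haar (n : ℕ) : Measure (UnitAddTorus (Fin n)) :=
  Measure.pi fun _ => (AddCircle.haarAddCircle : Measure UnitAddCircle)

/-- The Hilbert space `L²(𝕋ⁿ)`. -/
abbrev L2 (n : ℕ) : Type := Lp ℂ 2 (haar n)

/-- The C⋆-algebra of bounded operators on `L²(𝕋ⁿ)` (the star is the adjoint). -/
abbrev Op (n : ℕ) := L2 n →L[ℂ] L2 n

variable {n : ℕ}

/-- The class of `s ∈ ℝⁿ` in `ℝⁿ / 2πℤⁿ`. -/
def toTorus (s : Eucl n) : UnitAddTorus (Fin n) :=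
  fun j => ((s j / (2 * Real.pi) : ℝ) : UnitAddCircle)

theorem toTorus_zero : toTorus (0 : Eucl n) = 0 := by
  ext j; simp [toTorus]

theorem toTorus_add (s t : Eucl n) : toTorus (s + t) = toTorus s + toTorus t := by
  ext j; simp [toTorus, add_div]

theorem measurePreserving_translate (s : Eucl n) :
    MeasurePreserving (fun x => x + toTorus s) (haar n) (haar n) :=
  measurePreserving_add_right (haar n) (toTorus s)

/-- `(V_s ξ)(x) = ξ(x + s)`. -/
def translateₗᵢ (s : Eucl n) : L2 n →ₗᵢ[ℂ] L2 n :=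
  Lp.compMeasurePreservingₗᵢ ℂ (fun x => x + toTorus s) (measurePreserving_translate s)

theorem translateₗᵢ_coeFn (s : Eucl n) (f : L2 n) :
    translateₗᵢ s f =ᵐ[haar n] fun x => f (x + toTorus s) :=
  Lp.coeFn_compMeasurePreserving f (measurePreserving_translate s)

theorem translateₗᵢ_add (s t : Eucl n) (f : L2 n) :
    translateₗᵢ s (translateₗᵢ t f) = translateₗᵢ (s + t) f := by
  apply Lp.ext
  have h1 := translateₗᵢ_coeFn s (translateₗᵢ t f)
  have h2 := (measurePreserving_translate s).quasiMeasurePreserving.ae (translateₗᵢ_coeFn t f)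
  have h3 := translateₗᵢ_coeFn (s + t) f
  filter_upwards [h1, h2, h3] with x h1 h2 h3
  rw [h1, h2, h3, toTorus_add, add_assoc]

theorem translateₗᵢ_zero (f : L2 n) : translateₗᵢ 0 f = f := by
  apply Lp.ext
  filter_upwards [translateₗᵢ_coeFn 0 f] with x h1
  rw [h1, toTorus_zero, add_zero]

/-- `V_s` as a unitary map; its inverse is `V_{-s}`. -/
def translateEquiv (s : Eucl n) : L2 n ≃ₗᵢ[ℂ] L2 n where
  toLinearEquiv := LinearEquiv.ofLinearMap (translateₗᵢ s).toLinearMap (translateₗᵢ (-s)).toLinearMap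
    (by ext1 f; simp [translateₗᵢ_add, translateₗᵢ_zero])
    (by ext1 f; simp [translateₗᵢ_add, translateₗᵢ_zero])
  norm_map' f := (translateₗᵢ s).norm_map f

theorem norm_mFourier_apply (k : Fin n → ℤ) (x : UnitAddTorus (Fin n)) :
    ‖UnitAddTorus.mFourier k x‖ = 1 := by
  simp only [UnitAddTorus.mFourier, ContinuousMap.coe_mk, norm_prod, fourier_apply,
    Circle.norm_coe, Finset.prod_const_one]

theorem memLp_char_mul (k : Fin n → ℤ) (f : L2 n) :
    MemLp (fun x => UnitAddTorus.mFourier k x * f x) 2 (haar n) :=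
  (Lp.memLp f).of_le
    ((UnitAddTorus.mFourier k).continuous.aestronglyMeasurable.mul (Lp.aestronglyMeasurable f))
    (Eventually.of_forall fun x => by simp [norm_mFourier_apply])

/-- Multiplication by the character `x ↦ e^{i k·x}`. -/
def mulCharₗᵢ (k : Fin n → ℤ) : L2 n →ₗᵢ[ℂ] L2 n where
  toFun f := (memLp_char_mul k f).toLp _
  map_add' f g := by
    apply Lp.ext
    filter_upwards [(memLp_char_mul k (f + g)).coeFn_toLp, (memLp_char_mul k f).coeFn_toLp,
      (memLp_char_mul k g).coeFn_toLp, Lp.coeFn_add f g, Lp.coeFn_add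
        ((memLp_char_mul k f).toLp _) ((memLp_char_mul k g).toLp _)] with x h1 h2 h3 h4 h5
    rw [h1, h5, Pi.add_apply, h2, h3, h4, Pi.add_apply, mul_add]
  map_smul' c f := by
    apply Lp.ext
    filter_upwards [(memLp_char_mul k (c • f)).coeFn_toLp, (memLp_char_mul k f).coeFn_toLp,
      Lp.coeFn_smul c f, Lp.coeFn_smul c ((memLp_char_mul k f).toLp _)] with x h1 h2 h3 h4
    rw [h1, RingHom.id_apply, h4, Pi.smul_apply, h2, h3, Pi.smul_apply, smul_eq_mul, smul_eq_mul,
      mul_left_comm]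
  norm_map' f := by
    change ‖(memLp_char_mul k f).toLp _‖ = ‖f‖
    rw [Lp.norm_toLp, Lp.norm_def]
    congr 1
    exact eLpNorm_congr_norm_ae (Eventually.of_forall fun x => by simp [norm_mFourier_apply])

theorem mulCharₗᵢ_coeFn (k : Fin n → ℤ) (f : L2 n) :
    mulCharₗᵢ k f =ᵐ[haar n] fun x => UnitAddTorus.mFourier k x * f x :=
  (memLp_char_mul k f).coeFn_toLp

theorem mulCharₗᵢ_add (k l : Fin n → ℤ) (f : L2 n) :
    mulCharₗᵢ k (mulCharₗᵢ l f) = mulCharₗᵢ (k + l) f := by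
  apply Lp.ext
  filter_upwards [mulCharₗᵢ_coeFn k (mulCharₗᵢ l f), mulCharₗᵢ_coeFn l f,
    mulCharₗᵢ_coeFn (k + l) f] with x h1 h2 h3
  rw [h1, h2, h3, UnitAddTorus.mFourier_add, mul_assoc]

theorem mulCharₗᵢ_zero (f : L2 n) : mulCharₗᵢ 0 f = f := by
  apply Lp.ext
  filter_upwards [mulCharₗᵢ_coeFn 0 f] with x h1
  rw [h1, UnitAddTorus.mFourier_zero, ContinuousMap.one_apply, one_mul]

/-- Multiplication by the character `x ↦ e^{i k·x}` as a unitary map. -/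
def mulCharEquiv (k : Fin n → ℤ) : L2 n ≃ₗᵢ[ℂ] L2 n where
  toLinearEquiv := LinearEquiv.ofLinearMap (mulCharₗᵢ k).toLinearMap (mulCharₗᵢ (-k)).toLinearMap
    (by ext1 f; simp [mulCharₗᵢ_add, mulCharₗᵢ_zero])
    (by ext1 f; simp [mulCharₗᵢ_add, mulCharₗᵢ_zero])
  norm_map' f := (mulCharₗᵢ k).norm_map f

theorem translateₗᵢ_mulCharₗᵢ (s : Eucl n) (j : Fin n) (f : L2 n) :
    translateₗᵢ s (mulCharₗᵢ (Pi.single j 1) f) =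
      Complex.exp (Complex.I * s j) • mulCharₗᵢ (Pi.single j 1) (translateₗᵢ s f) := by
  apply Lp.ext
  filter_upwards [translateₗᵢ_coeFn s (mulCharₗᵢ (Pi.single j 1) f),
    (measurePreserving_translate s).quasiMeasurePreserving.ae (mulCharₗᵢ_coeFn (Pi.single j 1) f),
    Lp.coeFn_smul (Complex.exp (Complex.I * s j)) (mulCharₗᵢ (Pi.single j 1) (translateₗᵢ s f)),
    mulCharₗᵢ_coeFn (Pi.single j 1) (translateₗᵢ s f), translateₗᵢ_coeFn s f] with x h1 h2 h3 h4 h5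
  have h : UnitAddTorus.mFourier (Pi.single j 1) (x + toTorus s) =
      Complex.exp (Complex.I * s j) * UnitAddTorus.mFourier (Pi.single j 1) x := by
    rw [UnitAddTorus.mFourier_single, UnitAddTorus.mFourier_single, Pi.add_apply]
    rw [fourier_one, fourier_one, AddCircle.toCircle_add, Circle.coe_mul, mul_comm]
    congr 1
    rw [toTorus, AddCircle.toCircle_apply_mk, Circle.coe_exp]
    congr 1
    have : (Real.pi : ℂ) ≠ 0 := by exact_mod_cast Real.pi_ne_zero
    push_cast
    field_simp
  rw [h1, h2, h3, Pi.smul_apply, h4, h5, h, smul_eq_mul, mul_assoc]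

/-- The translation `(V_s ξ)(x) = ξ(x + s)` as a unitary operator. -/
def V (s : Eucl n) : unitary (Op n) := Unitary.linearIsometryEquiv.symm (translateEquiv s)

/-- The unitary `(U_j ξ)(x) = e^{i x_j} ξ(x + π θ_j)`, where `θ_j` is the `j`-th column of `θ`. -/
def U (θ : Matrix (Fin n) (Fin n) ℝ) (j : Fin n) : unitary (Op n) :=
  Unitary.linearIsometryEquiv.symm (mulCharEquiv (Pi.single j 1)) *
    V (Real.pi • WithLp.toLp 2 (fun i => θ i j))

/-- `U^k = U_1^{k_1} ⋯ U_n^{k_n}` for `k ∈ ℤⁿ`. -/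
def Upow (θ : Matrix (Fin n) (Fin n) ℝ) (k : Fin n → ℤ) : unitary (Op n) :=
  (List.ofFn fun j => U θ j ^ k j).prod

/-- The action `α_s(T) = V_s T V_s⁻¹` of `ℝⁿ` on bounded operators. -/
def alpha (s : Eucl n) : Op n ≃⋆ₐ[ℂ] Op n := Unitary.conjStarAlgAut ℂ (Op n) (V s)

theorem V_add (s t : Eucl n) : V (s + t) = V s * V t := by
  rw [V, V, V, ← map_mul]
  congr 1
  ext1 f
  exact (translateₗᵢ_add s t f).symm

theorem V_zero : V (0 : Eucl n) = 1 := by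
  rw [V, ← map_one Unitary.linearIsometryEquiv.symm]
  congr 1
  ext1 f
  exact translateₗᵢ_zero f

theorem alpha_add (s t : Eucl n) (T : Op n) : alpha (s + t) T = alpha s (alpha t T) := by
  rw [alpha, V_add, map_mul]; rfl

theorem alpha_zero (T : Op n) : alpha 0 T = T := by
  rw [alpha, V_zero, map_one]; rfl

theorem alpha_U (θ : Matrix (Fin n) (Fin n) ℝ) (s : Eucl n) (j : Fin n) :
    alpha s (U θ j : Op n) = Complex.exp (Complex.I * s j) • (U θ j : Op n) := by
  set t : Eucl n := Real.pi • WithLp.toLp 2 (fun i => θ i j) with ht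
  have h : (V s : Op n) * (U θ j : Op n) =
      Complex.exp (Complex.I * s j) • ((U θ j : Op n) * (V s : Op n)) := by
    ext1 f
    change translateₗᵢ s (mulCharₗᵢ (Pi.single j 1) (translateₗᵢ t f)) =
      Complex.exp (Complex.I * s j) • mulCharₗᵢ (Pi.single j 1) (translateₗᵢ t (translateₗᵢ s f))
    rw [translateₗᵢ_mulCharₗᵢ, translateₗᵢ_add, translateₗᵢ_add, add_comm]
  rw [alpha, Unitary.conjStarAlgAut_apply, h, smul_mul_assoc, mul_assoc]
  simp

/-- The noncommutative torus `A_θ`: the C⋆-algebra generated by `U_1, …, U_n`. -/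
def ncTorus (θ : Matrix (Fin n) (Fin n) ℝ) : StarSubalgebra ℂ (Op n) :=
  (StarAlgebra.adjoin ℂ (Set.range fun j => (U θ j : Op n))).topologicalClosure

theorem U_mem_ncTorus (θ : Matrix (Fin n) (Fin n) ℝ) (j : Fin n) : (U θ j : Op n) ∈ ncTorus θ :=
  StarSubalgebra.le_topologicalClosure _ (StarAlgebra.subset_adjoin ℂ _ ⟨j, rfl⟩)

theorem continuous_alpha (s : Eucl n) : Continuous (alpha s : Op n → Op n) := by
  change Continuous fun T : Op n => (V s : Op n) * T * (star (V s) : Op n)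
  fun_prop

theorem alpha_mem_ncTorus (θ : Matrix (Fin n) (Fin n) ℝ) (s : Eucl n) {T : Op n}
    (hT : T ∈ ncTorus θ) : alpha s T ∈ ncTorus θ := by
  have h1 : StarAlgebra.adjoin ℂ (Set.range fun j => (U θ j : Op n)) ≤
      (ncTorus θ).comap (alpha s : Op n →⋆ₐ[ℂ] Op n) := by
    rw [StarAlgebra.adjoin_le_iff]
    rintro _ ⟨j, rfl⟩
    change alpha s (U θ j : Op n) ∈ ncTorus θ
    rw [alpha_U]
    exact (ncTorus θ).smul_mem (U_mem_ncTorus θ j) _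
  have h2 : IsClosed (((ncTorus θ).comap (alpha s : Op n →⋆ₐ[ℂ] Op n) : StarSubalgebra ℂ (Op n))
      : Set (Op n)) :=
    (StarSubalgebra.isClosed_topologicalClosure _).preimage (continuous_alpha s)
  exact StarSubalgebra.topologicalClosure_minimal h1 h2 hT

theorem contDiff_star_op : ContDiff ℝ ∞ (star : Op n → Op n) := by
  have h : IsBoundedLinearMap ℝ (star : Op n → Op n) :=
    { map_add := star_add
      map_smul := fun c T => by
        have h1 : ∀ S : Op n, c • S = (c : ℂ) • S := fun S => rfl
        rw [h1, h1, star_smul]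
        congr 1
        exact Complex.conj_ofReal c
      bound := ⟨1, one_pos, fun T => by
        rw [one_mul]
        exact (ContinuousLinearMap.adjoint.norm_map T).le⟩ }
  exact h.contDiff

/-- The smooth noncommutative torus: all `u ∈ A_θ` such that `s ↦ α_s(u)` is `C^∞`. -/
def smoothSubalgebra (θ : Matrix (Fin n) (Fin n) ℝ) : StarSubalgebra ℂ (Op n) where
  carrier := {u | u ∈ ncTorus θ ∧ ContDiff ℝ ∞ fun s : Eucl n => alpha s u}
  mul_mem' := fun ⟨h1, h2⟩ ⟨h3, h4⟩ => ⟨mul_mem h1 h3, by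
    simp only [map_mul]
    exact h2.mul h4⟩
  add_mem' := fun ⟨h1, h2⟩ ⟨h3, h4⟩ => ⟨add_mem h1 h3, by
    simp only [map_add]
    exact h2.add h4⟩
  algebraMap_mem' c := ⟨(ncTorus θ).algebraMap_mem c, by
    simp only [AlgHomClass.commutes]
    exact contDiff_const⟩
  star_mem' := fun ⟨h1, h2⟩ => ⟨star_mem h1, by
    simp only [map_star]
    exact contDiff_star_op.comp h2⟩

theorem U_mem_smooth (θ : Matrix (Fin n) (Fin n) ℝ) (j : Fin n) :
    (U θ j : Op n) ∈ smoothSubalgebra θ := by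
  refine ⟨U_mem_ncTorus θ j, ?_⟩
  simp only [alpha_U]
  have h : ContDiff ℝ ∞ fun s : Eucl n => Complex.exp (Complex.I * s j) :=
    ContDiff.cexp (contDiff_const.mul
      (Complex.ofRealCLM.contDiff.comp (EuclideanSpace.proj j : Eucl n →L[ℝ] ℝ).contDiff))
  exact h.smul contDiff_const

theorem Upow_mem_smooth (θ : Matrix (Fin n) (Fin n) ℝ) (k : Fin n → ℤ) :
    (Upow θ k : Op n) ∈ smoothSubalgebra θ := by
  let G : Subgroup (unitary (Op n)) :=
    { carrier := {u | (u : Op n) ∈ smoothSubalgebra θ}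
      mul_mem' := fun {x y} h1 h2 =>
        (mul_mem h1 h2 : (x : Op n) * (y : Op n) ∈ smoothSubalgebra θ)
      one_mem' := (smoothSubalgebra θ).one_mem
      inv_mem' := fun {x} h => (star_mem h : star (x : Op n) ∈ smoothSubalgebra θ) }
  change Upow θ k ∈ G
  refine G.list_prod_mem fun x hx => ?_
  obtain ⟨j, rfl⟩ := List.mem_ofFn.1 hx
  exact G.zpow_mem (U_mem_smooth θ j) _

theorem alpha_mem_smooth (θ : Matrix (Fin n) (Fin n) ℝ) (t : Eucl n) {u : Op n}
    (hu : u ∈ smoothSubalgebra θ) : alpha t u ∈ smoothSubalgebra θ := by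
  refine ⟨alpha_mem_ncTorus θ t hu.1, ?_⟩
  have h : (fun s : Eucl n => alpha s (alpha t u)) = (fun s => alpha s u) ∘ fun s => s + t := by
    ext1 s
    exact (alpha_add s t u).symm
  rw [h]
  exact hu.2.comp (contDiff_id.add contDiff_const)

/-- `δ_j(u) = (1/i) ∂_{s_j} α_s(u)` at `s = 0`. -/
def deltaOp (j : Fin n) (u : Op n) : Op n :=
  -Complex.I • lineDeriv ℝ (fun s : Eucl n => alpha s u) 0 (EuclideanSpace.single j 1)

theorem hasLineDerivAt_alpha {θ : Matrix (Fin n) (Fin n) ℝ} {u : Op n}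
    (hu : u ∈ smoothSubalgebra θ) (s v : Eucl n) :
    HasLineDerivAt ℝ (fun s : Eucl n => alpha s u) (fderiv ℝ (fun s : Eucl n => alpha s u) s v)
      s v :=
  (hu.2.differentiable (by simp) s).hasFDerivAt.hasLineDerivAt v

theorem alpha_deltaOp {θ : Matrix (Fin n) (Fin n) ℝ} {u : Op n}
    (hu : u ∈ smoothSubalgebra θ) (j : Fin n) (s : Eucl n) :
    alpha s (deltaOp j u) = -Complex.I •
      fderiv ℝ (fun s : Eucl n => alpha s u) s (EuclideanSpace.single j 1) := by
  rw [deltaOp, map_smul]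
  congr 1
  rw [(hasLineDerivAt_alpha hu 0 _).lineDeriv]
  set e : Eucl n := EuclideanSpace.single j 1
  have h1 := (hasLineDerivAt_alpha hu 0 e).tendsto_slope_zero
  have h2 := (hasLineDerivAt_alpha hu s e).tendsto_slope_zero
  have h3 := ((continuous_alpha s).tendsto _).comp h1
  refine tendsto_nhds_unique h3 (h2.congr fun t => ?_)
  have h4 : ∀ (c : ℝ) (T : Op n), alpha s (c • T) = c • alpha s T :=
    fun c T => map_smul (alpha s) (c : ℂ) T
  simp only [Function.comp_apply, h4, map_sub, ← alpha_add, zero_add, add_zero]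

theorem deltaOp_mem_smooth {θ : Matrix (Fin n) (Fin n) ℝ} {u : Op n}
    (hu : u ∈ smoothSubalgebra θ) (j : Fin n) : deltaOp j u ∈ smoothSubalgebra θ := by
  constructor
  · refine (ncTorus θ).smul_mem ?_ _
    rw [(hasLineDerivAt_alpha hu 0 _).lineDeriv]
    set e : Eucl n := EuclideanSpace.single j 1
    have h1 := (hasLineDerivAt_alpha hu 0 e).tendsto_slope_zero
    refine (StarSubalgebra.isClosed_topologicalClosure _).mem_of_tendsto h1
      (Eventually.of_forall fun t => ?_)
    exact (ncTorus θ).smul_mem (sub_mem (alpha_mem_ncTorus θ _ hu.1)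
      (alpha_mem_ncTorus θ _ hu.1)) ((t⁻¹ : ℝ) : ℂ)
  · simp only [alpha_deltaOp hu]
    have h : ContDiff ℝ ∞ fun s : Eucl n =>
        fderiv ℝ (fun s : Eucl n => alpha s u) s (EuclideanSpace.single j 1) :=
      (hu.2.fderiv_right (m := ∞) (by simp)).clm_apply contDiff_const
    exact h.const_smul (-Complex.I)

/-- The smooth noncommutative torus as a type of its own; it carries its Fréchet topology (below),
not the topology of the operator norm. -/
def SmoothTorus (θ : Matrix (Fin n) (Fin n) ℝ) : Type := smoothSubalgebra θ

namespace SmoothTorus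

variable {θ : Matrix (Fin n) (Fin n) ℝ}

instance : Ring (SmoothTorus θ) := inferInstanceAs (Ring (smoothSubalgebra θ))
instance : StarRing (SmoothTorus θ) := inferInstanceAs (StarRing (smoothSubalgebra θ))
instance : Algebra ℂ (SmoothTorus θ) := inferInstanceAs (Algebra ℂ (smoothSubalgebra θ))

/-- The inclusion of the smooth noncommutative torus into the bounded operators. -/
def toOp : SmoothTorus θ →ₗ[ℂ] Op n := (smoothSubalgebra θ).toSubalgebra.toSubmodule.subtype

theorem toOp_mem (u : SmoothTorus θ) : toOp u ∈ smoothSubalgebra θ := u.2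

theorem toOp_injective : Function.Injective (toOp (θ := θ)) := Subtype.val_injective

/-- The derivation `δ_j` of the smooth noncommutative torus. -/
def delta (j : Fin n) : SmoothTorus θ →ₗ[ℂ] SmoothTorus θ where
  toFun u := ⟨deltaOp j (toOp u), deltaOp_mem_smooth u.2 j⟩
  map_add' u v := toOp_injective (by
    change deltaOp j (toOp u + toOp v) = deltaOp j (toOp u) + deltaOp j (toOp v)
    rw [deltaOp, deltaOp, deltaOp, ← smul_add]
    congr 1
    rw [(hasLineDerivAt_alpha (toOp_mem u) 0 _).lineDeriv,
      (hasLineDerivAt_alpha (toOp_mem v) 0 _).lineDeriv]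
    simp only [map_add]
    exact HasLineDerivAt.lineDeriv (HasDerivAt.add (hasLineDerivAt_alpha (toOp_mem u) 0 _)
      (hasLineDerivAt_alpha (toOp_mem v) 0 _)))
  map_smul' c u := toOp_injective (by
    change deltaOp j (c • toOp u) = c • deltaOp j (toOp u)
    rw [deltaOp, deltaOp, smul_comm c]
    congr 1
    rw [(hasLineDerivAt_alpha (toOp_mem u) 0 _).lineDeriv]
    simp only [map_smul]
    exact HasLineDerivAt.lineDeriv
      (HasDerivAt.const_smul c (hasLineDerivAt_alpha (toOp_mem u) 0 _)))

/-- The word `1…1 2…2 ⋯ n…n` in which `j` is repeated `β_j` times. -/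
def word (β : Fin n → ℕ) : List (Fin n) :=
  (List.finRange n).flatMap fun j => List.replicate (β j) j

/-- `δ^β = δ_1^{β_1} ⋯ δ_n^{β_n}`. -/
def deltaPow (β : Fin n → ℕ) : SmoothTorus θ →ₗ[ℂ] SmoothTorus θ :=
  ((word β).map delta).prod

/-- The seminorms `u ↦ ‖δ^β(u)‖`, in the operator norm. -/
def seminorms (θ : Matrix (Fin n) (Fin n) ℝ) :
    SeminormFamily ℂ (SmoothTorus θ) (Fin n → ℕ) :=
  fun β => (normSeminorm ℂ (Op n)).comp (toOp ∘ₗ deltaPow β)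

/-- The locally convex topology generated by the seminorms `‖δ^β(u)‖`. -/
instance : TopologicalSpace (SmoothTorus θ) := (seminorms θ).moduleFilterBasis.topology

theorem withSeminorms (θ : Matrix (Fin n) (Fin n) ℝ) : WithSeminorms (seminorms θ) := ⟨rfl⟩

instance : IsTopologicalAddGroup (SmoothTorus θ) := (withSeminorms θ).topologicalAddGroup
instance : ContinuousSMul ℂ (SmoothTorus θ) := (withSeminorms θ).continuousSMul

theorem seminorms_zero_apply (u : SmoothTorus θ) : seminorms θ 0 u = ‖toOp u‖ := by
  have h : word (0 : Fin n → ℕ) = [] := by simp [word]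
  change ‖toOp (deltaPow 0 u)‖ = ‖toOp u‖
  rw [deltaPow, h]
  rfl

instance : T1Space (SmoothTorus θ) :=
  (withSeminorms θ).T1_of_separating fun u hu => ⟨0, by
    rw [seminorms_zero_apply, norm_ne_zero_iff]
    exact fun h => hu (toOp_injective (h.trans (map_zero _).symm))⟩

instance : T2Space (SmoothTorus θ) := inferInstance

theorem continuous_toOp : Continuous (toOp (θ := θ)) := by
  refine WithSeminorms.continuous_of_isBounded (withSeminorms θ) (norm_withSeminorms ℂ (Op n)) _ ?_
  refine fun _ => ⟨{0}, 1, fun u => ?_⟩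
  rw [Finset.sup_singleton, one_smul]
  exact (seminorms_zero_apply u).ge

/-- The action `α_s` on the smooth noncommutative torus. -/
def act (s : Eucl n) (u : SmoothTorus θ) : SmoothTorus θ := ⟨alpha s (toOp u), alpha_mem_smooth θ s u.2⟩

/-- `U^k` as an element of the smooth noncommutative torus. -/
def monomial (θ : Matrix (Fin n) (Fin n) ℝ) (k : Fin n → ℤ) : SmoothTorus θ :=
  ⟨Upow θ k, Upow_mem_smooth θ k⟩

end SmoothTorus

/-- The state `τ(T) = ⟨T 1, 1⟩`. -/
def tau : Op n →L[ℂ] ℂ :=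
  (innerSL ℂ (Lp.const 2 (haar n) (1 : ℂ))).comp
    (ContinuousLinearMap.apply ℂ (L2 n) (Lp.const 2 (haar n) (1 : ℂ)))

theorem tau_apply (T : Op n) :
    tau T = ⟪Lp.const 2 (haar n) (1 : ℂ), T (Lp.const 2 (haar n) (1 : ℂ))⟫_ℂ := rfl

/-- The span `𝒜_θ⁰` of the unitaries `U^k`, to be normed by `⟨u, v⟩ = τ(u v⋆)`. -/
def PolyTorus (θ : Matrix (Fin n) (Fin n) ℝ) : Type :=
  Submodule.span ℂ (Set.range fun k => (Upow θ k : Op n))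

namespace PolyTorus

variable {θ : Matrix (Fin n) (Fin n) ℝ}

instance : AddCommGroup (PolyTorus θ) := inferInstanceAs (AddCommGroup (Submodule.span ℂ _))
instance : Module ℂ (PolyTorus θ) := inferInstanceAs (Module ℂ (Submodule.span ℂ _))

/-- The inclusion of the span into the bounded operators. -/
def toOp : PolyTorus θ →ₗ[ℂ] Op n := (Submodule.span ℂ _).subtype

/-- The pre-inner product `τ(u v⋆)`, linear in `u` and conjugate linear in `v`. Mathlib's inner
products are conjugate linear in the first variable, so it is `inner v u`. -/
@[reducible] def core (θ : Matrix (Fin n) (Fin n) ℝ) : PreInnerProductSpace.Core ℂ (PolyTorus θ) where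
  inner u v := tau (toOp v * star (toOp u))
  conj_inner_symm u v := by
    rw [tau_apply, tau_apply, inner_conj_symm, ← ContinuousLinearMap.adjoint_inner_left,
      ← ContinuousLinearMap.star_eq_adjoint, star_mul, star_star]
  re_inner_nonneg u := by
    rw [tau_apply, mul_apply_eq_comp, ← ContinuousLinearMap.adjoint_inner_left,
      ← ContinuousLinearMap.star_eq_adjoint]
    exact inner_self_nonneg
  add_left u v w := by rw [map_add, star_add, mul_add, map_add]
  smul_left u v c := by rw [map_smul, star_smul, mul_smul_comm, map_smul]; rfl

instance : SeminormedAddCommGroup (PolyTorus θ) :=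
  InnerProductSpace.Core.toSeminormedAddCommGroup (c := core θ)
instance : InnerProductSpace ℂ (PolyTorus θ) := InnerProductSpace.ofCore (core θ)

theorem inner_def (u v : PolyTorus θ) : ⟪u, v⟫_ℂ = tau (toOp v * star (toOp u)) := rfl

/-- Elements of the span. -/
def ofMem {T : Op n} (hT : T ∈ Submodule.span ℂ (Set.range fun k => (Upow θ k : Op n))) :
    PolyTorus θ := ⟨T, hT⟩

/-- `U^k` as an element of the span. -/
def monomial (θ : Matrix (Fin n) (Fin n) ℝ) (k : Fin n → ℤ) : PolyTorus θ :=
  ofMem (Submodule.subset_span ⟨k, rfl⟩)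

end PolyTorus

/-- The Hilbert space `ℋ_θ`: the completion of the span of the `U^k` for `τ(u v⋆)`. -/
abbrev HTheta (θ : Matrix (Fin n) (Fin n) ℝ) : Type := UniformSpace.Completion (PolyTorus θ)

/-- `U^k` as an element of `ℋ_θ`. The Fourier coefficient `h_k` of `h ∈ ℋ_θ` is `inner (U^k) h`. -/
def HTheta.monomial (θ : Matrix (Fin n) (Fin n) ℝ) (k : Fin n → ℤ) : HTheta θ :=
  (PolyTorus.monomial θ k : HTheta θ)

theorem HTheta.ext_coeff {θ : Matrix (Fin n) (Fin n) ℝ} {g h : HTheta θ}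
    (H : ∀ k, ⟪HTheta.monomial θ k, g⟫_ℂ = ⟪HTheta.monomial θ k, h⟫_ℂ) : g = h := by
  have h1 : ∀ (T : Op n) (hT : T ∈ Submodule.span ℂ (Set.range fun k => (Upow θ k : Op n))),
      ⟪(PolyTorus.ofMem hT : HTheta θ), g⟫_ℂ = ⟪(PolyTorus.ofMem hT : HTheta θ), h⟫_ℂ := by
    intro T hT
    induction hT using Submodule.span_induction with
    | mem x hx => obtain ⟨k, rfl⟩ := hx; exact H k
    | zero =>
      have : PolyTorus.ofMem (θ := θ) (Submodule.zero_mem _) = 0 := rfl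
      rw [this, UniformSpace.Completion.coe_zero, inner_zero_left, inner_zero_left]
    | add x y hx hy ihx ihy =>
      have : PolyTorus.ofMem (Submodule.add_mem _ hx hy) =
        PolyTorus.ofMem hx + PolyTorus.ofMem hy := rfl
      rw [this, UniformSpace.Completion.coe_add, inner_add_left, inner_add_left, ihx, ihy]
    | smul c x hx ihx =>
      have : PolyTorus.ofMem (Submodule.smul_mem _ c hx) = c • PolyTorus.ofMem hx := rfl
      rw [this, UniformSpace.Completion.coe_smul, inner_smul_left, inner_smul_left, ihx]
  refine ext_inner_left ℂ fun v => ?_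
  induction v using UniformSpace.Completion.induction_on with
  | hp => exact isClosed_eq (by fun_prop) (by fun_prop)
  | ih u => exact h1 u.1 u.2

/-- The topological dual `𝒜_θ'` of the smooth noncommutative torus. -/
abbrev Dual (θ : Matrix (Fin n) (Fin n) ℝ) : Type := SmoothTorus θ →L[ℂ] ℂ

namespace SmoothTorus

variable {θ : Matrix (Fin n) (Fin n) ℝ}

/-- The embedding of `𝒜_θ` into `𝒜_θ'`: `⟨u, v⟩ = τ(u v)`. -/
def toDual : SmoothTorus θ →ₗ[ℂ] Dual θ where
  toFun u :=
    { toFun := fun v => tau (toOp (u * v))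
      map_add' := fun v w => by rw [mul_add, map_add, map_add]
      map_smul' := fun c v => by rw [mul_smul_comm, map_smul, map_smul]; rfl
      cont := tau.continuous.comp (((ContinuousLinearMap.mul ℂ (Op n)) (toOp u)).continuous.comp continuous_toOp) }
  map_add' u v := by ext w; change tau (toOp ((u + v) * w)) = tau (toOp (u * w)) + tau (toOp (v * w)); rw [add_mul, map_add, map_add]
  map_smul' c u := by ext w; change tau (toOp ((c • u) * w)) = c • tau (toOp (u * w)); rw [smul_mul_assoc, map_smul, map_smul]

end SmoothTorus

/-- The Fourier coefficient `u_k = ⟨u, (U^k)⋆⟩` of `u ∈ 𝒜_θ'`. -/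
def Dual.coeff {θ : Matrix (Fin n) (Fin n) ℝ} (u : Dual θ) (k : Fin n → ℤ) : ℂ :=
  u (star (SmoothTorus.monomial θ k))

/-- `(1 + |k|²)^{s/2}`, the eigenvalue of `Λ^s = (1 + Δ)^{s/2}` on `U^k`. -/
def bracket (s : ℝ) (k : Fin n → ℤ) : ℝ := (1 + ∑ j, (k j : ℝ) ^ 2) ^ (s / 2)

/-- The Sobolev space `ℋ_θ^{(s)}` of all `u ∈ 𝒜_θ'` such that `Λ^s u ∈ ℋ_θ`. Here `Λ^s u` is the
element of `𝒜_θ'` with the Fourier coefficients `(1 + |k|²)^{s/2} u_k`; elements of `ℋ_θ` and of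
`𝒜_θ'` are identified when they have the same Fourier coefficients. -/
def sobolevSubmodule (θ : Matrix (Fin n) (Fin n) ℝ) (s : ℝ) : Submodule ℂ (Dual θ) where
  carrier := {u | ∃ h : HTheta θ, ∀ k, ⟪HTheta.monomial θ k, h⟫_ℂ = bracket s k * u.coeff k}
  zero_mem' := ⟨0, fun k => by simp [Dual.coeff]⟩
  add_mem' := by
    rintro u v ⟨g, hg⟩ ⟨h, hh⟩
    refine ⟨g + h, fun k => ?_⟩
    rw [inner_add_right, hg, hh, Dual.coeff, Dual.coeff, Dual.coeff, add_apply, mul_add]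
  smul_mem' := by
    rintro c u ⟨g, hg⟩
    refine ⟨c • g, fun k => ?_⟩
    rw [inner_smul_right, hg, Dual.coeff, Dual.coeff, smul_apply, smul_eq_mul, mul_left_comm]

/-- The Sobolev space `ℋ_θ^{(s)}` with its own norm (below). -/
def SobolevSpace (θ : Matrix (Fin n) (Fin n) ℝ) (s : ℝ) : Type := sobolevSubmodule θ s

namespace SobolevSpace

variable {θ : Matrix (Fin n) (Fin n) ℝ} {s : ℝ}

instance : AddCommGroup (SobolevSpace θ s) := inferInstanceAs (AddCommGroup (sobolevSubmodule θ s))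
instance : Module ℂ (SobolevSpace θ s) := inferInstanceAs (Module ℂ (sobolevSubmodule θ s))

/-- The inclusion of `ℋ_θ^{(s)}` into `𝒜_θ'`. -/
def toDual : SobolevSpace θ s →ₗ[ℂ] Dual θ := (sobolevSubmodule θ s).subtype

theorem exists_Lambda (u : SobolevSpace θ s) :
    ∃ h : HTheta θ, ∀ k, ⟪HTheta.monomial θ k, h⟫_ℂ = bracket s k * (toDual u).coeff k := u.2

/-- `Λ^s : ℋ_θ^{(s)} → ℋ_θ`. -/
def Lambda (θ : Matrix (Fin n) (Fin n) ℝ) (s : ℝ) : SobolevSpace θ s →ₗ[ℂ] HTheta θ where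
  toFun u := (exists_Lambda u).choose
  map_add' u v := HTheta.ext_coeff fun k => by
    rw [inner_add_right, (exists_Lambda (u + v)).choose_spec, (exists_Lambda u).choose_spec,
      (exists_Lambda v).choose_spec, map_add, ← mul_add]
    rfl
  map_smul' c u := HTheta.ext_coeff fun k => by
    rw [RingHom.id_apply, inner_smul_right, (exists_Lambda (c • u)).choose_spec,
      (exists_Lambda u).choose_spec, map_smul, mul_left_comm]
    rfl

/-- The norm `‖u‖_s = ‖Λ^s u‖` of `ℋ_θ^{(s)}`. (It is a norm, as an element of `𝒜_θ'` is determined by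
its Fourier coefficients; this is not needed to write it down.) -/
instance : SeminormedAddCommGroup (SobolevSpace θ s) :=
  SeminormedAddCommGroup.induced _ _ (Lambda θ s)
instance : NormedSpace ℂ (SobolevSpace θ s) := NormedSpace.induced _ _ _ (Lambda θ s)

theorem norm_def (u : SobolevSpace θ s) : ‖u‖ = ‖Lambda θ s u‖ := rfl

end SobolevSpace

section Symbols

variable {θ : Matrix (Fin n) (Fin n) ℝ}

/-- `y` is the partial derivative `∂_j f(ξ)`: the limit of the difference quotients in the Fréchet
topology. -/
def HasPartialAt (f : Eucl n → SmoothTorus θ) (y : SmoothTorus θ) (j : Fin n) (ξ : Eucl n) : Prop :=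
  Tendsto (fun t : ℝ => ((t⁻¹ : ℝ) : ℂ) • (f (ξ + t • EuclideanSpace.single j 1) - f ξ))
    (𝓝[≠] 0) (𝓝 y)

open Classical in
/-- The partial derivative `∂_j f` (zero where the limit does not exist). -/
def partialDeriv (j : Fin n) (f : Eucl n → SmoothTorus θ) (ξ : Eucl n) : SmoothTorus θ :=
  if h : ∃ y, HasPartialAt f y j ξ then h.choose else 0

theorem HasPartialAt.partialDeriv_eq {f : Eucl n → SmoothTorus θ} {y : SmoothTorus θ} {j : Fin n}
    {ξ : Eucl n} (h : HasPartialAt f y j ξ) : partialDeriv j f ξ = y := by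
  have h' : ∃ y, HasPartialAt f y j ξ := ⟨y, h⟩
  rw [partialDeriv, dif_pos h']
  exact tendsto_nhds_unique h'.choose_spec h

/-- The iterated partial derivative `∂_{j_1} ⋯ ∂_{j_r} f` for the word `j_1 … j_r`. -/
def partialWord (w : List (Fin n)) (f : Eucl n → SmoothTorus θ) : Eucl n → SmoothTorus θ :=
  w.foldr partialDeriv f

/-- `∂^β f = ∂_1^{β_1} ⋯ ∂_n^{β_n} f`. -/
def partialPow (β : Fin n → ℕ) (f : Eucl n → SmoothTorus θ) : Eucl n → SmoothTorus θ :=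
  partialWord (SmoothTorus.word β) f

/-- `f ∈ C^∞(ℝⁿ; 𝒜_θ)`: all iterated partial derivatives exist and are continuous. -/
def IsSmooth (f : Eucl n → SmoothTorus θ) : Prop :=
  ∀ w : List (Fin n), Continuous (partialWord w f) ∧
    ∀ j ξ, ∃ y, HasPartialAt (partialWord w f) y j ξ

theorem IsSmooth.hasPartialAt {f : Eucl n → SmoothTorus θ} (hf : IsSmooth f) (w : List (Fin n))
    (j : Fin n) (ξ : Eucl n) :
    HasPartialAt (partialWord w f) (partialWord (j :: w) f ξ) j ξ := by
  obtain ⟨y, hy⟩ := (hf w).2 j ξ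
  change HasPartialAt _ (partialDeriv j (partialWord w f) ξ) j ξ
  rwa [hy.partialDeriv_eq]

theorem partialWord_zero (w : List (Fin n)) : partialWord w (0 : Eucl n → SmoothTorus θ) = 0 := by
  induction w with
  | nil => rfl
  | cons j w ih =>
    ext1 ξ
    change partialDeriv j (partialWord w 0) ξ = 0
    rw [ih]
    refine HasPartialAt.partialDeriv_eq ?_
    simp [HasPartialAt]

theorem HasPartialAt.add {f g : Eucl n → SmoothTorus θ} {y z : SmoothTorus θ} {j : Fin n}
    {ξ : Eucl n} (hf : HasPartialAt f y j ξ) (hg : HasPartialAt g z j ξ) :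
    HasPartialAt (f + g) (y + z) j ξ := by
  refine (Tendsto.add hf hg).congr fun t => ?_
  rw [← smul_add, Pi.add_apply, Pi.add_apply]
  congr 1
  abel

theorem HasPartialAt.const_smul {f : Eucl n → SmoothTorus θ} {y : SmoothTorus θ} {j : Fin n}
    {ξ : Eucl n} (c : ℂ) (hf : HasPartialAt f y j ξ) : HasPartialAt (c • f) (c • y) j ξ := by
  refine (Tendsto.const_smul hf c).congr fun t => ?_
  rw [smul_comm c, smul_sub]
  rfl

theorem partialWord_add {f g : Eucl n → SmoothTorus θ} (hf : IsSmooth f) (hg : IsSmooth g)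
    (w : List (Fin n)) : partialWord w (f + g) = partialWord w f + partialWord w g := by
  induction w with
  | nil => rfl
  | cons j w ih =>
    ext1 ξ
    change partialDeriv j (partialWord w (f + g)) ξ = _
    rw [ih]
    exact ((hf.hasPartialAt w j ξ).add (hg.hasPartialAt w j ξ)).partialDeriv_eq

theorem partialWord_smul {f : Eucl n → SmoothTorus θ} (c : ℂ) (hf : IsSmooth f)
    (w : List (Fin n)) : partialWord w (c • f) = c • partialWord w f := by
  induction w with
  | nil => rfl
  | cons j w ih =>
    ext1 ξ
    change partialDeriv j (partialWord w (c • f)) ξ = _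
    rw [ih]
    exact ((hf.hasPartialAt w j ξ).const_smul c).partialDeriv_eq

theorem IsSmooth.zero : IsSmooth (0 : Eucl n → SmoothTorus θ) := fun w => by
  rw [partialWord_zero]
  exact ⟨continuous_const, fun j ξ => ⟨0, by simp [HasPartialAt]⟩⟩

theorem IsSmooth.add {f g : Eucl n → SmoothTorus θ} (hf : IsSmooth f) (hg : IsSmooth g) :
    IsSmooth (f + g) := fun w => by
  rw [partialWord_add hf hg]
  exact ⟨(hf w).1.add (hg w).1, fun j ξ =>
    ⟨_, (hf.hasPartialAt w j ξ).add (hg.hasPartialAt w j ξ)⟩⟩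

theorem IsSmooth.const_smul {f : Eucl n → SmoothTorus θ} (c : ℂ) (hf : IsSmooth f) :
    IsSmooth (c • f) := fun w => by
  rw [partialWord_smul c hf]
  exact ⟨(hf w).1.const_smul c, fun j ξ => ⟨_, (hf.hasPartialAt w j ξ).const_smul c⟩⟩

/-- `(1 + |ξ|)^{-m+|β|} ‖δ^α ∂^β ρ(ξ)‖`. -/
def weighted (m : ℝ) (α β : Fin n → ℕ) (ρ : Eucl n → SmoothTorus θ) (ξ : Eucl n) : ℝ :=
  (1 + ‖ξ‖) ^ (-m + ∑ j, (β j : ℝ)) *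
    ‖SmoothTorus.toOp (SmoothTorus.deltaPow α (partialPow β ρ ξ))‖

theorem weighted_nonneg (m : ℝ) (α β : Fin n → ℕ) (ρ : Eucl n → SmoothTorus θ) (ξ : Eucl n) :
    0 ≤ weighted m α β ρ ξ := by
  unfold weighted; positivity

theorem weighted_zero (m : ℝ) (α β : Fin n → ℕ) (ξ : Eucl n) :
    weighted m α β (0 : Eucl n → SmoothTorus θ) ξ = 0 := by
  simp [weighted, partialPow, partialWord_zero]

theorem weighted_add_le (m : ℝ) (α β : Fin n → ℕ) {ρ σ : Eucl n → SmoothTorus θ}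
    (hρ : IsSmooth ρ) (hσ : IsSmooth σ) (ξ : Eucl n) :
    weighted m α β (ρ + σ) ξ ≤ weighted m α β ρ ξ + weighted m α β σ ξ := by
  rw [weighted, weighted, weighted, ← mul_add, partialPow, partialWord_add hρ hσ, Pi.add_apply,
    map_add, map_add]
  exact mul_le_mul_of_nonneg_left (norm_add_le _ _) (by positivity)

theorem weighted_smul (m : ℝ) (α β : Fin n → ℕ) {ρ : Eucl n → SmoothTorus θ} (c : ℂ)
    (hρ : IsSmooth ρ) (ξ : Eucl n) :
    weighted m α β (c • ρ) ξ = ‖c‖ * weighted m α β ρ ξ := by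
  rw [weighted, weighted, partialPow, partialWord_smul c hρ, Pi.smul_apply, map_smul, map_smul,
    norm_smul, mul_left_comm]
  rfl

/-- The standard symbols of order `m`: `‖δ^α ∂^β ρ(ξ)‖ ≤ C_{αβ} (1 + |ξ|)^{m-|β|}`. -/
def symbolSubmodule (θ : Matrix (Fin n) (Fin n) ℝ) (m : ℝ) :
    Submodule ℂ (Eucl n → SmoothTorus θ) where
  carrier := {ρ | IsSmooth ρ ∧ ∀ α β : Fin n → ℕ, ∃ C : ℝ, ∀ ξ : Eucl n,
    ‖SmoothTorus.toOp (SmoothTorus.deltaPow α (partialPow β ρ ξ))‖ ≤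
      C * (1 + ‖ξ‖) ^ (m - ∑ j, (β j : ℝ))}
  zero_mem' := ⟨IsSmooth.zero, fun α β => ⟨0, fun ξ => by simp [partialPow, partialWord_zero]⟩⟩
  add_mem' := by
    rintro ρ σ ⟨hρ, hρ'⟩ ⟨hσ, hσ'⟩
    refine ⟨hρ.add hσ, fun α β => ?_⟩
    obtain ⟨C, hC⟩ := hρ' α β
    obtain ⟨D, hD⟩ := hσ' α β
    refine ⟨C + D, fun ξ => ?_⟩
    rw [partialPow, partialWord_add hρ hσ, Pi.add_apply, map_add, map_add, add_mul]
    exact (norm_add_le _ _).trans (add_le_add (hC ξ) (hD ξ))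
  smul_mem' := by
    rintro c ρ ⟨hρ, hρ'⟩
    refine ⟨hρ.const_smul c, fun α β => ?_⟩
    obtain ⟨C, hC⟩ := hρ' α β
    refine ⟨‖c‖ * C, fun ξ => ?_⟩
    rw [partialPow, partialWord_smul c hρ, Pi.smul_apply, map_smul, map_smul, norm_smul, mul_assoc]
    exact mul_le_mul_of_nonneg_left (hC ξ) (norm_nonneg c)

/-- The space `𝕊^m(ℝⁿ; 𝒜_θ)` of standard symbols, with its own topology (below). -/
def SymbolSpace (θ : Matrix (Fin n) (Fin n) ℝ) (m : ℝ) : Type := symbolSubmodule θ m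

namespace SymbolSpace

variable {m : ℝ}

instance : AddCommGroup (SymbolSpace θ m) := inferInstanceAs (AddCommGroup (symbolSubmodule θ m))
instance : Module ℂ (SymbolSpace θ m) := inferInstanceAs (Module ℂ (symbolSubmodule θ m))

/-- The map `ℝⁿ → 𝒜_θ` underlying a symbol. -/
def toFun : SymbolSpace θ m →ₗ[ℂ] (Eucl n → SmoothTorus θ) := (symbolSubmodule θ m).subtype

theorem isSmooth (ρ : SymbolSpace θ m) : IsSmooth (toFun ρ) := ρ.2.1

theorem bddAbove_weighted (ρ : SymbolSpace θ m) (α β : Fin n → ℕ) :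
    BddAbove (Set.range (weighted m α β (toFun ρ))) := by
  obtain ⟨C, hC⟩ := ρ.2.2 α β
  refine ⟨C, ?_⟩
  rintro _ ⟨ξ, rfl⟩
  have h0 : (0 : ℝ) < 1 + ‖ξ‖ := by positivity
  rw [weighted]
  calc _ ≤ (1 + ‖ξ‖) ^ (-m + ∑ j, (β j : ℝ)) * (C * (1 + ‖ξ‖) ^ (m - ∑ j, (β j : ℝ))) :=
        mul_le_mul_of_nonneg_left (hC ξ) (by positivity)
    _ = C := by
        rw [mul_left_comm, ← Real.rpow_add h0]
        simp

/-- The seminorms `sup_ξ (1 + |ξ|)^{-m+|β|} ‖δ^α ∂^β ρ(ξ)‖` of `𝕊^m`. (Their maxima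
over `|α| + |β| ≤ N`, for `N = 0, 1, 2, …`, generate the same topology.) -/
def seminorms (θ : Matrix (Fin n) (Fin n) ℝ) (m : ℝ) :
    SeminormFamily ℂ (SymbolSpace θ m) ((Fin n → ℕ) × (Fin n → ℕ)) := fun αβ =>
  Seminorm.of (fun ρ => ⨆ ξ, weighted m αβ.1 αβ.2 (toFun ρ) ξ)
    (fun ρ σ => ciSup_le fun ξ => by
      rw [map_add]
      exact (weighted_add_le m _ _ ρ.isSmooth σ.isSmooth ξ).trans
        (add_le_add (le_ciSup (ρ.bddAbove_weighted _ _) ξ) (le_ciSup (σ.bddAbove_weighted _ _) ξ)))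
    (fun c ρ => by
      rw [Real.mul_iSup_of_nonneg (norm_nonneg c)]
      refine iSup_congr fun ξ => ?_
      rw [map_smul]
      exact weighted_smul m _ _ c ρ.isSmooth ξ)

/-- The locally convex topology of `𝕊^m`. -/
instance : TopologicalSpace (SymbolSpace θ m) := (seminorms θ m).moduleFilterBasis.topology

theorem withSeminorms (θ : Matrix (Fin n) (Fin n) ℝ) (m : ℝ) : WithSeminorms (seminorms θ m) :=
  ⟨rfl⟩

end SymbolSpace

end Symbols

section PsiDO

variable {θ : Matrix (Fin n) (Fin n) ℝ}

/-- The oscillating integral `(2π)⁻ⁿ ∬ e^{i s·ξ} a(s, ξ) ds dξ` exists and is equal to `b`. As for any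
integral with values in `𝒜_θ`, this is tested with all `φ ∈ 𝒜_θ'`. The scalar oscillating integral
is the limit, as `ε → 0⁺`, of the integrals regularized by `χ(ε s, ε ξ)`, for every
`χ ∈ C_c^∞(ℝⁿ × ℝⁿ)` with `χ(0, 0) = 1`. -/
def HasOscIntegral (a : Eucl n → Eucl n → SmoothTorus θ) (b : SmoothTorus θ) : Prop :=
  ∀ φ : Dual θ, ∀ χ : Eucl n × Eucl n → ℂ, ContDiff ℝ ∞ χ → HasCompactSupport χ → χ 0 = 1 →
    Tendsto (fun ε : ℝ => (((2 * Real.pi) ^ n : ℝ) : ℂ)⁻¹ * ∫ p : Eucl n × Eucl n,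
      Complex.exp (Complex.I * (inner ℝ p.1 p.2 : ℝ)) * (χ (ε • p) * φ (a p.1 p.2)))
      (𝓝[>] 0) (𝓝 (φ b))

open Classical in
/-- The oscillating integral (zero if it does not exist). -/
def oscIntegral (a : Eucl n → Eucl n → SmoothTorus θ) : SmoothTorus θ :=
  if h : ∃ b, HasOscIntegral a b then h.choose else 0

/-- The amplitude `(s, ξ) ↦ ρ(ξ) α_{-s}(u)`. -/
def amplitude (ρ : Eucl n → SmoothTorus θ) (u : SmoothTorus θ) (s ξ : Eucl n) : SmoothTorus θ :=
  ρ ξ * u.act (-s)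

/-- The pseudodifferential operator `P_ρ u = (2π)⁻ⁿ ∬ e^{i s·ξ} ρ(ξ) α_{-s}(u) ds dξ`. -/
def psiDO (ρ : Eucl n → SmoothTorus θ) (u : SmoothTorus θ) : SmoothTorus θ :=
  oscIntegral (amplitude ρ u)

end PsiDO

section Extensions

variable {θ : Matrix (Fin n) (Fin n) ℝ} {m : ℝ}

/-- `T : ℋ_θ^{(t)} → ℋ_θ^{(s)}` extends `P_ρ : 𝒜_θ → 𝒜_θ`: every `u ∈ 𝒜_θ` is an element `x` of
`ℋ_θ^{(t)}`, and `T x = P_ρ u` (equalities in `𝒜_θ'`). -/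
def ExtendsOnSobolev (ρ : SymbolSpace θ m) {s t : ℝ} (T : SobolevSpace θ t →L[ℂ] SobolevSpace θ s) :
    Prop :=
  ∀ u : SmoothTorus θ, ∃ x : SobolevSpace θ t, SobolevSpace.toDual x = SmoothTorus.toDual u ∧
    SobolevSpace.toDual (T x) = SmoothTorus.toDual (psiDO ρ.toFun u)

/-- `h ∈ ℋ_θ` is the image of `u ∈ 𝒜_θ`, that is, it has the same Fourier coefficients. -/
def IsImage (h : HTheta θ) (u : SmoothTorus θ) : Prop :=
  ∀ k, ⟪HTheta.monomial θ k, h⟫_ℂ = (SmoothTorus.toDual u).coeff k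

/-- `T : ℋ_θ → ℋ_θ` extends `P_ρ : 𝒜_θ → 𝒜_θ`. -/
def ExtendsOnHTheta (ρ : SymbolSpace θ m) (T : HTheta θ →L[ℂ] HTheta θ) : Prop :=
  ∀ u : SmoothTorus θ, ∃ h : HTheta θ, IsImage h u ∧ IsImage (T h) (psiDO ρ.toFun u)

end Extensions

end NCTorus

end

open NCTorus

/-! On Fourier series the operator is explicit. Since `α_{-s}(U^k) = e^{-is·k} U^k`, the oscillating
integral of `e^{is·ξ} ρ(ξ) e^{-is·k}` is an instance of Fourier inversion and produces `ρ(k)`. Hence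
`P_ρ (∑ u_k U^k) = ∑ u_k ρ(k) U^k`, where `ρ(k)` is itself a Fourier series `∑ ρ_l(k) U^l`. Since
`U^l U^k` is a unimodular multiple of `U^{l+k}`, the operator becomes a matrix indexed by `ℤⁿ`,
whose `l`-th diagonal carries the values `ρ_l(k)`.

Three ingredients justify the formula. `𝒜_θ` is identified with the rapidly decreasing Fourier
series, with convergence in the Fréchet topology (`hasSum_fourier`, `hasSum_mul`); injectivity of
the Fourier coefficients (`eq_zero_of_tau`) rests on the antisymmetry of `θ`, which supplies enough
operators commuting with `A_θ`. A continuous functional grows polynomially on the `U^k`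
(`exists_norm_dual_monomial_le`). The regularized scalar integrals tend to `g(k)` with bounds
uniform in `ε` and polynomial in `k` (`tendsto_oscTerm`, `exists_norm_oscTerm_le`). Two dominated
convergence arguments then give `hasOscIntegral_sum`.

For the mapping properties, `Λ^s` identifies `ℋ_θ^{(s)}` with `ℓ²(ℤⁿ)` (`sobolevIsometry`), and `Λ^s
P_ρ Λ^{-s-m}` is a sum over `l` of weighted shifts. By Peetre's inequality and the decay of `ρ_l` in
`l`, the `l`-th shift has norm at most a constant times `(1 + |l|)^{-2n}` (`norm_diagEntry_le`). The
sum converges in operator norm, and its norm is at most a continuous seminorm of `ρ`. Uniqueness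
holds because every basis vector of `ℓ²` comes from a multiple of some `U^k`.

If `m < 0`, then on `ℋ_θ` the operator factors as `(P_ρ Λ^{-m}) Λ^m`: a bounded operator after a
diagonal one whose entries tend to zero, which is compact. -/

noncomputable section

open scoped ContDiff Topology InnerProductSpace ENNReal
open MeasureTheory Filter

namespace NCTorus

variable {n : ℕ}

/-! ### Weyl operators, the cocycle of the `U^k`, and the separating vector `1`. -/

section Weyl

/-- The integer vector `k` as an element of Euclidean space. -/
def latticeVec (k : Fin n → ℤ) : Eucl n := WithLp.toLp 2 fun j => (k j : ℝ)

@[simp] theorem latticeVec_apply (k : Fin n → ℤ) (j : Fin n) : latticeVec k j = k j := rfl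

theorem latticeVec_zero : latticeVec (0 : Fin n → ℤ) = 0 := by ext j; simp

theorem latticeVec_add (k l : Fin n → ℤ) : latticeVec (k + l) = latticeVec k + latticeVec l := by
  ext j; simp

theorem latticeVec_neg (k : Fin n → ℤ) : latticeVec (-k) = -latticeVec k := by
  ext j; simp

/-- The phase `e^{i s·k}`. -/
def phase (s : Eucl n) (k : Fin n → ℤ) : ℂ := Complex.exp (Complex.I * (inner ℝ s (latticeVec k) : ℝ))

theorem norm_phase (s : Eucl n) (k : Fin n → ℤ) : ‖phase s k‖ = 1 := by
  rw [phase, mul_comm, Complex.norm_exp_ofReal_mul_I]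

theorem phase_ne_zero (s : Eucl n) (k : Fin n → ℤ) : phase s k ≠ 0 := Complex.exp_ne_zero _

theorem phase_neg_right (s : Eucl n) (k : Fin n → ℤ) : phase s (-k) = (phase s k)⁻¹ := by
  simp only [phase]
  rw [← Complex.exp_neg, latticeVec_neg, inner_neg_right]; push_cast; ring_nf

theorem phase_zero_right (s : Eucl n) : phase s (0 : Fin n → ℤ) = 1 := by
  simp [phase, latticeVec_zero]

theorem mFourier_add_toTorus (k : Fin n → ℤ) (x : UnitAddTorus (Fin n)) (s : Eucl n) :
    UnitAddTorus.mFourier k (x + toTorus s) = phase s k * UnitAddTorus.mFourier k x := by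
  simp only [UnitAddTorus.mFourier, ContinuousMap.coe_mk, Pi.add_apply]
  have h : ∀ j, fourier (k j) (x j + toTorus s j) =
      Complex.exp (Complex.I * (s j * k j : ℝ)) * fourier (k j) (x j) := by
    intro j
    have h1 : fourier (k j) (x j + toTorus s j) = fourier (k j) (x j) * fourier (k j) (toTorus s j) := by
      simp [fourier_apply, smul_add, AddCircle.toCircle_add]
    rw [h1, mul_comm, toTorus, fourier_coe_apply]
    congr 2
    have : (Real.pi : ℂ) ≠ 0 := by exact_mod_cast Real.pi_ne_zero
    push_cast
    field_simp
  simp_rw [h]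
  rw [Finset.prod_mul_distrib, ← Complex.exp_sum, phase]
  congr 2
  rw [PiLp.inner_apply, ← Finset.mul_sum]
  push_cast
  congr 1
  refine Finset.sum_congr rfl fun j _ => ?_
  simp [mul_comm]

theorem translateₗᵢ_mulCharₗᵢ_eq (s : Eucl n) (k : Fin n → ℤ) (f : L2 n) :
    translateₗᵢ s (mulCharₗᵢ k f) = phase s k • mulCharₗᵢ k (translateₗᵢ s f) := by
  apply Lp.ext
  filter_upwards [translateₗᵢ_coeFn s (mulCharₗᵢ k f),
    (measurePreserving_translate s).quasiMeasurePreserving.ae (mulCharₗᵢ_coeFn k f),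
    Lp.coeFn_smul (phase s k) (mulCharₗᵢ k (translateₗᵢ s f)),
    mulCharₗᵢ_coeFn k (translateₗᵢ s f), translateₗᵢ_coeFn s f] with x h1 h2 h3 h4 h5
  rw [h1, h2, h3, Pi.smul_apply, h4, h5, mFourier_add_toTorus, smul_eq_mul, mul_assoc]

/-- The unitary operator `ξ ↦ e^{i k·x} ξ(x + t)`. -/
def mulTranslate (k : Fin n → ℤ) (t : Eucl n) : unitary (Op n) :=
  Unitary.linearIsometryEquiv.symm (mulCharEquiv k) * V t

theorem mulTranslate_apply (k : Fin n → ℤ) (t : Eucl n) (f : L2 n) :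
    (mulTranslate k t : Op n) f = mulCharₗᵢ k (translateₗᵢ t f) := rfl

theorem V_apply (s : Eucl n) (f : L2 n) : (V s : Op n) f = translateₗᵢ s f := rfl

theorem mulTranslate_mul (k l : Fin n → ℤ) (t r : Eucl n) :
    (mulTranslate k t : Op n) * (mulTranslate l r : Op n) =
      phase t l • (mulTranslate (k + l) (t + r) : Op n) := by
  ext1 f
  change mulCharₗᵢ k (translateₗᵢ t (mulCharₗᵢ l (translateₗᵢ r f))) =
    phase t l • mulCharₗᵢ (k + l) (translateₗᵢ (t + r) f)
  rw [translateₗᵢ_mulCharₗᵢ_eq, map_smul, mulCharₗᵢ_add, translateₗᵢ_add]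

theorem mulTranslate_zero : (mulTranslate 0 0 : unitary (Op n)) = 1 := by
  ext1
  ext1 f
  change mulCharₗᵢ 0 (translateₗᵢ 0 f) = f
  rw [translateₗᵢ_zero, mulCharₗᵢ_zero]

theorem V_eq (s : Eucl n) : V s = mulTranslate 0 s := by
  ext1
  ext1 f
  change translateₗᵢ s f = mulCharₗᵢ 0 (translateₗᵢ s f)
  rw [mulCharₗᵢ_zero]

theorem alpha_mulTranslate (s : Eucl n) (k : Fin n → ℤ) (t : Eucl n) :
    alpha s (mulTranslate k t : Op n) = phase s k • (mulTranslate k t : Op n) := by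
  have h : (V s : Op n) * (mulTranslate k t : Op n) =
      phase s k • ((mulTranslate k t : Op n) * (V s : Op n)) := by
    rw [V_eq, mulTranslate_mul, mulTranslate_mul, phase_zero_right, one_smul, zero_add, add_zero,
      add_comm]
  rw [alpha, Unitary.conjStarAlgAut_apply, h, smul_mul_assoc, mul_assoc]
  simp

variable (θ : Matrix (Fin n) (Fin n) ℝ)

/-- `π θ k`. -/
def twist : (Fin n → ℤ) →+ Eucl n where
  toFun k := Real.pi • WithLp.toLp 2 (θ.mulVec fun j => (k j : ℝ))
  map_zero' := by
    ext i; simp [Matrix.mulVec, dotProduct]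
  map_add' k l := by
    ext i
    simp [Matrix.mulVec, dotProduct, mul_add, Finset.sum_add_distrib]

theorem twist_single (j : Fin n) :
    twist θ (Pi.single j 1) = Real.pi • WithLp.toLp 2 (fun i => θ i j) := by
  ext i
  simp [twist, Matrix.mulVec, dotProduct, Pi.single_apply]

theorem U_eq (j : Fin n) : U θ j = mulTranslate (Pi.single j 1) (twist θ (Pi.single j 1)) := by
  rw [twist_single]; rfl

/-- Antisymmetry of `θ` enters here. The sign makes the phases of `weyl` and `rightWeyl` agree when
the two are interchanged, so that these operators commute. -/
theorem inner_twist (hθ : θ.transpose = -θ) (k l : Fin n → ℤ) :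
    inner ℝ (twist θ k) (latticeVec l) = -inner ℝ (twist θ l) (latticeVec k) := by
  have h : ∀ i j, θ i j = -θ j i := fun i j => by
    have := congrFun (congrFun hθ j) i
    simpa using this
  simp only [twist, AddMonoidHom.coe_mk, ZeroHom.coe_mk, PiLp.inner_apply, PiLp.smul_apply,
    Matrix.mulVec, dotProduct, latticeVec_apply, smul_eq_mul, RCLike.inner_apply, conj_trivial,
    Finset.mul_sum, ← Finset.sum_neg_distrib]
  rw [Finset.sum_comm]
  refine Finset.sum_congr rfl fun i _ => Finset.sum_congr rfl fun j _ => ?_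
  rw [h j i]; ring

/-- The Weyl operators `ξ ↦ e^{i k·x} ξ(x + π θ k)`. -/
def weyl (k : Fin n → ℤ) : unitary (Op n) := mulTranslate k (twist θ k)

theorem weyl_mul (k l : Fin n → ℤ) :
    (weyl θ k : Op n) * (weyl θ l : Op n) = phase (twist θ k) l • (weyl θ (k + l) : Op n) := by
  rw [weyl, weyl, mulTranslate_mul, weyl, map_add]

theorem weyl_zero : weyl θ 0 = 1 := by rw [weyl, map_zero, mulTranslate_zero]

theorem star_weyl (k : Fin n → ℤ) :
    star (weyl θ k : Op n) = phase (twist θ k) k • (weyl θ (-k) : Op n) := by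
  have h : (weyl θ k : Op n) * (phase (twist θ k) k • (weyl θ (-k) : Op n)) = 1 := by
    rw [mul_smul_comm, weyl_mul, smul_smul, phase_neg_right, mul_inv_cancel₀ (phase_ne_zero _ _),
      add_neg_cancel, weyl_zero, one_smul]; rfl
  calc star (weyl θ k : Op n)
      = star (weyl θ k : Op n) * ((weyl θ k : Op n) * (phase (twist θ k) k • (weyl θ (-k) : Op n))) := by
        rw [h, mul_one]
    _ = _ := by rw [← mul_assoc]; simp

theorem exists_Upow_eq (k : Fin n → ℤ) :
    ∃ c : ℂ, ‖c‖ = 1 ∧ (Upow θ k : Op n) = c • (weyl θ k : Op n) := by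
  -- The second component records the total exponent. Once `(U_j, e_j)` is known to lie in this
  -- subgroup, so does the ordered product of its powers, whose components are `U^k` and `k`.
  let G : Subgroup (unitary (Op n) × Multiplicative (Fin n → ℤ)) :=
    { carrier := {p | ∃ c : ℂ, ‖c‖ = 1 ∧ (p.1 : Op n) = c • (weyl θ p.2.toAdd : Op n)}
      mul_mem' := by
        rintro ⟨a, k⟩ ⟨b, l⟩ ⟨c, hc, h⟩ ⟨d, hd, h'⟩
        refine ⟨c * d * phase (twist θ k.toAdd) l.toAdd, by simp [hc, hd, norm_phase], ?_⟩
        change (a : Op n) * (b : Op n) = _ • (weyl θ (k.toAdd + l.toAdd) : Op n)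
        dsimp only at h h'
        rw [h, h', smul_mul_smul_comm, weyl_mul, smul_smul]
      one_mem' := ⟨1, by simp, by
        change (1 : Op n) = (1 : ℂ) • (weyl θ 0 : Op n)
        rw [weyl_zero, one_smul]; rfl⟩
      inv_mem' := by
        rintro ⟨a, k⟩ ⟨c, hc, h⟩
        refine ⟨star c * phase (twist θ k.toAdd) k.toAdd, by simp [hc, norm_phase], ?_⟩
        change star (a : Op n) = _ • (weyl θ (-k.toAdd) : Op n)
        dsimp only at h
        rw [h, star_smul, star_weyl, smul_smul] }
  have hj : ∀ j, (U θ j, Multiplicative.ofAdd (Pi.single j (1 : ℤ) : Fin n → ℤ)) ∈ G := fun j =>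
    ⟨1, by simp, by rw [one_smul]; dsimp only; rw [U_eq]; rfl⟩
  let L : List (unitary (Op n) × Multiplicative (Fin n → ℤ)) := List.ofFn fun j =>
    (U θ j, Multiplicative.ofAdd (Pi.single j (1 : ℤ) : Fin n → ℤ)) ^ k j
  have hL : L.prod ∈ G := G.list_prod_mem fun x hx => by
    obtain ⟨j, rfl⟩ := List.mem_ofFn.1 hx
    exact G.zpow_mem (hj j) _
  have h1 : L.prod.1 = Upow θ k := by
    have := map_list_prod (MonoidHom.fst (unitary (Op n)) (Multiplicative (Fin n → ℤ))) L
    rw [List.map_ofFn] at this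
    exact this
  have h2 : L.prod.2.toAdd = k := by
    have := map_list_prod (MonoidHom.snd (unitary (Op n)) (Multiplicative (Fin n → ℤ))) L
    rw [List.map_ofFn, List.prod_ofFn] at this
    change (MonoidHom.snd (unitary (Op n)) (Multiplicative (Fin n → ℤ)) L.prod).toAdd = k
    rw [this]
    change ∑ j, k j • (Pi.single j (1 : ℤ) : Fin n → ℤ) = k
    ext i
    simp [Finset.sum_apply, Pi.single_apply]
  obtain ⟨c, hc, h⟩ := hL
  refine ⟨c, hc, ?_⟩
  rw [h1, h2] at h
  exact h

theorem alpha_Upow (s : Eucl n) (k : Fin n → ℤ) :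
    alpha s (Upow θ k : Op n) = phase s k • (Upow θ k : Op n) := by
  obtain ⟨c, -, h⟩ := exists_Upow_eq θ k
  rw [h, map_smul, weyl, alpha_mulTranslate, smul_comm]

theorem norm_Upow_le (k : Fin n → ℤ) : ‖(Upow θ k : Op n)‖ ≤ 1 := by
  have h := CStarRing.norm_star_mul_self (x := (Upow θ k : Op n))
  rw [Unitary.coe_star_mul_self] at h
  have h1 : ‖(1 : Op n)‖ ≤ 1 := ContinuousLinearMap.norm_id_le
  nlinarith [norm_nonneg (Upow θ k : Op n)]

theorem exists_Upow_mul (k l : Fin n → ℤ) :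
    ∃ c : ℂ, ‖c‖ = 1 ∧ (Upow θ k : Op n) * (Upow θ l : Op n) = c • (Upow θ (k + l) : Op n) := by
  obtain ⟨a, ha, h⟩ := exists_Upow_eq θ k
  obtain ⟨b, hb, h'⟩ := exists_Upow_eq θ l
  obtain ⟨c, hc, h''⟩ := exists_Upow_eq θ (k + l)
  have hc0 : c ≠ 0 := fun h0 => by simp [h0] at hc
  refine ⟨a * b * phase (twist θ k) l * c⁻¹, by simp [ha, hb, hc, norm_phase], ?_⟩
  rw [h, h', h'', smul_mul_smul_comm, weyl_mul, smul_smul, smul_smul, inv_mul_cancel_right₀ hc0]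

/-- The unit complex number `c` such that `U^k U^l = c U^{k+l}`. -/
def cocycle (k l : Fin n → ℤ) : ℂ := (exists_Upow_mul θ k l).choose

theorem norm_cocycle (k l : Fin n → ℤ) : ‖cocycle θ k l‖ = 1 :=
  (exists_Upow_mul θ k l).choose_spec.1

theorem cocycle_ne_zero (k l : Fin n → ℤ) : cocycle θ k l ≠ 0 :=
  norm_ne_zero_iff.1 (by rw [norm_cocycle]; exact one_ne_zero)

theorem Upow_mul (k l : Fin n → ℤ) :
    (Upow θ k : Op n) * (Upow θ l : Op n) = cocycle θ k l • (Upow θ (k + l) : Op n) :=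
  (exists_Upow_mul θ k l).choose_spec.2

theorem Upow_zero : Upow θ 0 = 1 := by
  simp [Upow]

theorem star_Upow (k : Fin n → ℤ) :
    star (Upow θ k : Op n) = (cocycle θ k (-k))⁻¹ • (Upow θ (-k) : Op n) := by
  have h0 := cocycle_ne_zero θ k (-k)
  have h : (Upow θ k : Op n) * ((cocycle θ k (-k))⁻¹ • (Upow θ (-k) : Op n)) = 1 := by
    rw [mul_smul_comm, Upow_mul, smul_smul, inv_mul_cancel₀ h0, add_neg_cancel, Upow_zero, one_smul]
    rfl
  calc star (Upow θ k : Op n)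
      = star (Upow θ k : Op n) *
          ((Upow θ k : Op n) * ((cocycle θ k (-k))⁻¹ • (Upow θ (-k) : Op n))) := by rw [h, mul_one]
    _ = _ := by rw [← mul_assoc]; simp

/-- The constant function `1`. -/
abbrev oneL2 (n : ℕ) : L2 n := Lp.const 2 (haar n) (1 : ℂ)

theorem translateₗᵢ_one (s : Eucl n) : translateₗᵢ s (oneL2 n) = oneL2 n := by
  apply Lp.ext
  have h := Lp.coeFn_const (p := 2) (μ := haar n) (1 : ℂ)
  filter_upwards [translateₗᵢ_coeFn s (oneL2 n), h,
    (measurePreserving_translate s).quasiMeasurePreserving.ae h] with x h1 h2 h3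
  rw [h1, h2, h3]; rfl

theorem mulCharₗᵢ_one (k : Fin n → ℤ) :
    mulCharₗᵢ k (oneL2 n) = UnitAddTorus.mFourierLp 2 k := by
  apply Lp.ext
  have h3 := UnitAddTorus.coeFn_mFourierLp (d := Fin n) 2 k
  filter_upwards [mulCharₗᵢ_coeFn k (oneL2 n), Lp.coeFn_const (p := 2) (μ := haar n) (1 : ℂ),
    h3] with x h1 h2 h3
  rw [h1, h2]
  refine Eq.trans ?_ h3.symm
  simp

theorem inner_one_mulCharₗᵢ_one (k : Fin n → ℤ) :
    ⟪oneL2 n, mulCharₗᵢ k (oneL2 n)⟫_ℂ = if k = 0 then 1 else 0 := by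
  have h := (orthonormal_iff_ite.1 (UnitAddTorus.orthonormal_mFourier (d := Fin n))) 0 k
  have h0 : oneL2 n = mulCharₗᵢ 0 (oneL2 n) := (mulCharₗᵢ_zero _).symm
  rw [h0, mulCharₗᵢ_add, add_zero, mulCharₗᵢ_one, mulCharₗᵢ_one]
  simp only [eq_comm (a := k)]
  exact h

theorem tau_Upow (k : Fin n → ℤ) : tau (Upow θ k : Op n) = if k = 0 then 1 else 0 := by
  split_ifs with hk
  · rw [hk, Upow_zero, tau_apply]
    have := inner_one_mulCharₗᵢ_one (0 : Fin n → ℤ)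
    rw [mulCharₗᵢ_zero, if_pos rfl] at this
    exact this
  · obtain ⟨c, -, h⟩ := exists_Upow_eq θ k
    rw [h, map_smul, tau_apply, weyl, mulTranslate_apply, translateₗᵢ_one, inner_one_mulCharₗᵢ_one,
      if_neg hk, smul_zero]

theorem tau_Upow_mul_star (k l : Fin n → ℤ) :
    tau ((Upow θ k : Op n) * star (Upow θ l : Op n)) = if k = l then 1 else 0 := by
  split_ifs with hk
  · subst hk
    have h : (Upow θ k : Op n) * star (Upow θ k : Op n) = (Upow θ 0 : unitary (Op n)) := by
      rw [Upow_zero]; simp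
    rw [h, tau_Upow, if_pos rfl]
  · rw [star_Upow, mul_smul_comm, Upow_mul, smul_smul, map_smul, tau_Upow, if_neg, smul_zero]
    rwa [← sub_eq_add_neg, sub_eq_zero]

/-- The operators `ξ ↦ e^{i k·x} ξ(x - π θ k)`, which commute with `A_θ`. -/
def rightWeyl (k : Fin n → ℤ) : unitary (Op n) := mulTranslate k (-twist θ k)

theorem rightWeyl_commute (hθ : θ.transpose = -θ) (k l : Fin n → ℤ) :
    (rightWeyl θ k : Op n) * (weyl θ l : Op n) = (weyl θ l : Op n) * (rightWeyl θ k : Op n) := by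
  rw [rightWeyl, weyl, mulTranslate_mul, mulTranslate_mul, add_comm k, add_comm (-twist θ k)]
  congr 1
  rw [phase, phase, inner_neg_left, inner_twist θ hθ l k]

/-- The operators commuting with a unitary and with its adjoint form a closed star subalgebra, so
the generators `U_j` suffice. -/
theorem commute_rightWeyl (hθ : θ.transpose = -θ) (k : Fin n → ℤ) {T : Op n} (hT : T ∈ ncTorus θ) :
    (rightWeyl θ k : Op n) * T = T * (rightWeyl θ k : Op n) := by
  let C : StarSubalgebra ℂ (Op n) := StarSubalgebra.centralizer ℂ {(rightWeyl θ k : Op n)}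
  have hU : ∀ j, (U θ j : Op n) = (weyl θ (Pi.single j 1) : Op n) := fun j => by rw [U_eq]; rfl
  have h1 : StarAlgebra.adjoin ℂ (Set.range fun j => (U θ j : Op n)) ≤ C := by
    rw [StarAlgebra.adjoin_le_iff]
    rintro _ ⟨j, rfl⟩
    change (U θ j : Op n) ∈ C
    have hc : (rightWeyl θ k : Op n) * (U θ j : Op n) = (U θ j : Op n) * (rightWeyl θ k : Op n) := by
      rw [hU]; exact rightWeyl_commute θ hθ k _
    refine (StarSubalgebra.mem_centralizer_iff ℂ).2 ?_
    rintro _ rfl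
    refine ⟨hc, ?_⟩
    calc star (rightWeyl θ k : Op n) * (U θ j : Op n)
        = star (rightWeyl θ k : Op n) * ((U θ j : Op n) * (rightWeyl θ k : Op n)) *
          star (rightWeyl θ k : Op n) := by simp [mul_assoc]
      _ = _ := by rw [← hc, ← mul_assoc]; simp
  have h2 : IsClosed (C : Set (Op n)) := by
    change IsClosed (Set.centralizer _)
    exact Set.isClosed_centralizer _
  have h3 := StarSubalgebra.topologicalClosure_minimal h1 h2 hT
  exact ((StarSubalgebra.mem_centralizer_iff ℂ).1 h3 _ rfl).1

theorem L2_ext {f g : L2 n} (h : ∀ k, ⟪mulCharₗᵢ k (oneL2 n), f⟫_ℂ = ⟪mulCharₗᵢ k (oneL2 n), g⟫_ℂ) :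
    f = g := by
  have hd := UnitAddTorus.span_mFourierLp_closure_eq_top (d := Fin n) (p := 2) (by simp)
  rw [← sub_eq_zero]
  have h4 : ∀ v : L2 n, ⟪v, f - g⟫_ℂ = 0 := by
    have hcl : IsClosed {v : L2 n | ⟪v, f - g⟫_ℂ = 0} := isClosed_eq (by fun_prop) (by fun_prop)
    intro v
    have hv : v ∈ closure ((Submodule.span ℂ
        (Set.range (UnitAddTorus.mFourierLp (d := Fin n) 2)) : Submodule ℂ (L2 n)) : Set (L2 n)) := by
      have : v ∈ (⊤ : Submodule ℂ (L2 n)) := trivial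
      rw [← Submodule.topologicalClosure_coe]
      exact hd.ge this
    refine closure_minimal ?_ hcl hv
    intro w hw
    induction hw using Submodule.span_induction with
    | mem x hx =>
      obtain ⟨k, rfl⟩ := hx
      have := h k
      rw [mulCharₗᵢ_one, ← sub_eq_zero, ← inner_sub_right] at this
      exact this
    | zero => exact inner_zero_left _
    | add x y _ _ hx hy =>
      change ⟪x + y, _⟫_ℂ = 0
      rw [inner_add_left, hx, hy, add_zero]
    | smul c x _ hx =>
      change ⟪c • x, _⟫_ℂ = 0
      rw [inner_smul_left, hx, mul_zero]
  exact inner_self_eq_zero.1 (h4 _)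

/-- The vector `1` is separating for `A_θ`: the right Weyl operators carry it to all characters and
commute with `T`, so `T` kills every character, and the characters span a dense subspace. -/
theorem eq_zero_of_apply_one (hθ : θ.transpose = -θ) {T : Op n} (hT : T ∈ ncTorus θ)
    (h : T (oneL2 n) = 0) : T = 0 := by
  have h1 : ∀ k, T (mulCharₗᵢ k (oneL2 n)) = 0 := fun k => by
    have h2 := congrArg (fun S : Op n => S (oneL2 n)) (commute_rightWeyl θ hθ k hT)
    change (rightWeyl θ k : Op n) (T (oneL2 n)) = T ((rightWeyl θ k : Op n) (oneL2 n)) at h2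
    rw [h, map_zero, rightWeyl, mulTranslate_apply, translateₗᵢ_one] at h2
    exact h2.symm
  have h2 : ∀ g, star T g = 0 := fun g => L2_ext fun k => by
    rw [ContinuousLinearMap.star_eq_adjoint, ContinuousLinearMap.adjoint_inner_right, h1,
      inner_zero_left, inner_zero_right]
  have h3 : star T = 0 := by ext1 g; exact h2 g
  rwa [star_eq_zero] at h3

/-- An element of `A_θ` is determined by its Fourier coefficients. -/
theorem eq_zero_of_tau (hθ : θ.transpose = -θ) {T : Op n} (hT : T ∈ ncTorus θ)
    (h : ∀ k, tau (T * star (Upow θ k : Op n)) = 0) : T = 0 := by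
  rw [← star_eq_zero]
  -- The coefficients of `T⋆ 1` are the conjugates of `⟨1, T e_k⟩`, and these are what `τ` sees. The
  -- hypothesis is taken at `-k` because `(U^{-k})⋆` is a multiple of `U^k`.
  refine eq_zero_of_apply_one θ hθ (star_mem hT) (L2_ext fun k => ?_)
  rw [inner_zero_right, ContinuousLinearMap.star_eq_adjoint,
    ContinuousLinearMap.adjoint_inner_right, ← inner_conj_symm]
  have h1 := h (-k)
  obtain ⟨c, hc, h2⟩ := exists_Upow_eq θ (-(-k))
  have hc0 : c ≠ 0 := fun h0 => by simp [h0] at hc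
  rw [star_Upow, h2, mul_smul_comm, mul_smul_comm, map_smul, map_smul, smul_eq_zero,
    smul_eq_zero] at h1
  rcases h1 with h1 | h1 | h1
  · exact absurd h1 (inv_ne_zero (cocycle_ne_zero _ _ _))
  · exact absurd h1 hc0
  · rw [tau_apply, neg_neg] at h1
    change ⟪oneL2 n, T ((weyl θ k : Op n) (oneL2 n))⟫_ℂ = 0 at h1
    rw [weyl, mulTranslate_apply, translateₗᵢ_one] at h1
    rw [h1, map_zero]

end Weyl

/-! ### Weights on `ℤⁿ` and invariance of `τ`. -/

/-- The weight `1 + |k|` on `ℤⁿ`, for the sup norm. -/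
def weight (k : Fin n → ℤ) : ℝ := 1 + ‖k‖

theorem one_le_weight (k : Fin n → ℤ) : 1 ≤ weight k := le_add_of_nonneg_right (norm_nonneg k)

theorem weight_pos (k : Fin n → ℤ) : 0 < weight k := one_pos.trans_le (one_le_weight k)

theorem weight_neg (k : Fin n → ℤ) : weight (-k) = weight k := by rw [weight, norm_neg, weight]

theorem weight_add_le (k l : Fin n → ℤ) : weight (k + l) ≤ weight k * weight l := by
  have := norm_add_le k l
  have h : 0 ≤ ‖k‖ * ‖l‖ := by positivity
  simp only [weight]; nlinarith

theorem summable_prod_pi {f : ℤ → ℝ} (hf : Summable f) (h0 : ∀ a, 0 ≤ f a) (n : ℕ) :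
    Summable fun k : Fin n → ℤ => ∏ j, f (k j) := by
  induction n with
  | zero => exact .of_finite
  | succ n ih =>
    have h := hf.mul_of_nonneg ih h0 fun k => Finset.prod_nonneg fun j _ => h0 _
    rw [← (Fin.consEquiv fun _ => ℤ).summable_iff]
    refine h.congr fun p => ?_
    simp [Fin.consEquiv, Fin.prod_univ_succ]

/-- For the sup norm `weight k ^ (2n)` dominates `∏ (1 + |k_j|)²`, and the inverse of that product
sums one coordinate at a time. -/
theorem summable_weight (n : ℕ) : Summable fun k : Fin n → ℤ => (weight k ^ (2 * n))⁻¹ := by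
  have h1 : Summable fun a : ℤ => (((1 + |(a : ℝ)|) ^ 2))⁻¹ := by
    have h2 : Summable fun m : ℕ => (((1 + (m : ℝ)) ^ 2))⁻¹ := by
      have := (summable_nat_add_iff 1).2 (Real.summable_nat_pow_inv.2 (one_lt_two))
      refine this.congr fun m => ?_
      push_cast; rw [add_comm]
    refine Summable.of_nat_of_neg ?_ ?_
    · simpa using h2
    · simpa using h2
  refine (summable_prod_pi h1 (fun a => by positivity) n).of_nonneg_of_le
    (fun k => inv_nonneg.2 (pow_nonneg (weight_pos k).le _)) fun k => ?_
  rw [Finset.prod_inv_distrib]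
  refine inv_anti₀ (Finset.prod_pos fun j _ => by positivity) ?_
  calc ∏ j, (1 + |(k j : ℝ)|) ^ 2 ≤ ∏ _j : Fin n, weight k ^ 2 := by
        refine Finset.prod_le_prod (fun j _ => by positivity) fun j _ => ?_
        refine pow_le_pow_left₀ (by positivity) ?_ 2
        have := norm_le_pi_norm k j
        rw [Int.norm_eq_abs] at this
        exact add_le_add_right this 1
    _ = weight k ^ (2 * n) := by rw [Finset.prod_const, Finset.card_univ, Fintype.card_fin, pow_mul]

theorem norm_latticeVec_le (k : Fin n → ℤ) : ‖latticeVec k‖ ≤ n * ‖k‖ := by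
  have h1 : ‖latticeVec k‖ ^ 2 ≤ (n * ‖k‖) ^ 2 := by
    rw [EuclideanSpace.real_norm_sq_eq]
    calc ∑ j, latticeVec k j ^ 2 ≤ ∑ _j : Fin n, ‖k‖ ^ 2 := by
          refine Finset.sum_le_sum fun j _ => ?_
          rw [latticeVec_apply, ← sq_abs, ← Int.norm_eq_abs]
          exact pow_le_pow_left₀ (norm_nonneg _) (norm_le_pi_norm k j) 2
      _ = n * ‖k‖ ^ 2 := by simp
      _ ≤ (n * ‖k‖) ^ 2 := by
          rw [mul_pow]
          refine mul_le_mul_of_nonneg_right ?_ (by positivity)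
          exact_mod_cast Nat.le_self_pow two_ne_zero n
  exact (pow_le_pow_iff_left₀ (norm_nonneg _) (by positivity) two_ne_zero).1 h1

theorem norm_latticeVec_le_weight (k : Fin n → ℤ) : ‖latticeVec k‖ ≤ (n + 1) * weight k := by
  have := norm_latticeVec_le k
  have h := norm_nonneg k
  have h' : (0 : ℝ) ≤ n := by positivity
  rw [weight]; nlinarith

theorem one_add_norm_latticeVec_le (k : Fin n → ℤ) : 1 + ‖latticeVec k‖ ≤ (n + 1) * weight k := by
  have := norm_latticeVec_le k
  have h := norm_nonneg k
  have h' : (0 : ℝ) ≤ n := by positivity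
  rw [weight]; nlinarith

theorem tau_alpha (s : Eucl n) (T : Op n) : tau (alpha s T) = tau T := by
  have h : (star (V s : Op n)) (oneL2 n) = oneL2 n := by
    have h1 : (star (V s : Op n) * (V s : Op n)) (oneL2 n) = oneL2 n := by
      rw [Unitary.coe_star_mul_self]; rfl
    have h2 : (star (V s : Op n)) ((V s : Op n) (oneL2 n)) = oneL2 n := h1
    rwa [V_apply, translateₗᵢ_one] at h2
  rw [tau_apply, tau_apply, alpha, Unitary.conjStarAlgAut_apply]
  change ⟪oneL2 n, (V s : Op n) (T ((star (V s : Op n)) (oneL2 n)))⟫_ℂ = _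
  rw [← ContinuousLinearMap.adjoint_inner_left, ← ContinuousLinearMap.star_eq_adjoint, h]

theorem norm_tau_le (T : Op n) : ‖tau T‖ ≤ ‖T‖ := by
  have h1 : ‖oneL2 n‖ = 1 := by
    simp [Lp.norm_const]
  rw [tau_apply]
  refine (norm_inner_le_norm _ _).trans ?_
  have := T.le_opNorm (oneL2 n)
  rw [h1, mul_one] at this
  rw [h1, one_mul]; exact this

/-! ### Fourier analysis on `𝒜_θ`: rapidly decreasing coefficients, products and functionals. -/

section Coefficients

variable {θ : Matrix (Fin n) (Fin n) ℝ}

open SmoothTorus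

theorem toOp_monomial (k : Fin n → ℤ) : toOp (monomial θ k) = (Upow θ k : Op n) := rfl

theorem star_monomial (k : Fin n → ℤ) :
    star (monomial θ k) = (cocycle θ k (-k))⁻¹ • monomial θ (-k) :=
  toOp_injective (star_Upow θ k)

variable (θ) in
/-- The functional `u ↦ τ(u (U^k)⋆)`. -/
def opCoeff (k : Fin n → ℤ) : Op n →L[ℂ] ℂ :=
  tau.comp ((ContinuousLinearMap.mul ℂ (Op n)).flip (star (Upow θ k : Op n)))

theorem opCoeff_apply (k : Fin n → ℤ) (T : Op n) :
    opCoeff θ k T = tau (T * star (Upow θ k : Op n)) := rfl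

theorem opCoeff_Upow (k l : Fin n → ℤ) :
    opCoeff θ k (Upow θ l : Op n) = if l = k then 1 else 0 := by
  rw [opCoeff_apply, tau_Upow_mul_star]

theorem norm_opCoeff_le (k : Fin n → ℤ) (T : Op n) : ‖opCoeff θ k T‖ ≤ ‖T‖ := by
  rw [opCoeff_apply]
  refine (norm_tau_le _).trans ((norm_mul_le _ _).trans ?_)
  refine mul_le_of_le_one_right (norm_nonneg _) ?_
  exact (ContinuousLinearMap.adjoint.norm_map _).trans_le (norm_Upow_le θ k)

/-- `τ` is invariant under `α_s`, and `α_s` multiplies `(U^k)⋆` by the conjugate phase. -/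
theorem opCoeff_alpha (s : Eucl n) (k : Fin n → ℤ) (T : Op n) :
    opCoeff θ k (alpha s T) = phase s k * opCoeff θ k T := by
  have h : alpha s (T * star (Upow θ k : Op n)) =
      star (phase s k) • (alpha s T * star (Upow θ k : Op n)) := by
    rw [map_mul, map_star, alpha_Upow, star_smul, mul_smul_comm]
  have h1 : phase s k * star (phase s k) = 1 := by
    have := Complex.mul_conj (phase s k)
    rw [Complex.normSq_eq_norm_sq, norm_phase] at this
    simpa using this
  rw [opCoeff_apply, opCoeff_apply, ← tau_alpha s (T * _), h, map_smul, smul_eq_mul, ← mul_assoc, h1,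
    one_mul]

variable (θ) in
/-- The Fourier coefficient `u ↦ u_k = τ(u (U^k)⋆)`. -/
def fourierCoeff (k : Fin n → ℤ) : Dual θ where
  toLinearMap := (opCoeff θ k).toLinearMap ∘ₗ toOp
  cont := (opCoeff θ k).continuous.comp continuous_toOp

theorem fourierCoeff_apply (k : Fin n → ℤ) (u : SmoothTorus θ) :
    fourierCoeff θ k u = opCoeff θ k (toOp u) := rfl

theorem coeff_toDual (k : Fin n → ℤ) (u : SmoothTorus θ) :
    (toDual u).coeff k = fourierCoeff θ k u := rfl

theorem fourierCoeff_monomial (k l : Fin n → ℤ) :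
    fourierCoeff θ k (monomial θ l) = if l = k then 1 else 0 := opCoeff_Upow k l

theorem fourierCoeff_act (s : Eucl n) (k : Fin n → ℤ) (u : SmoothTorus θ) :
    fourierCoeff θ k (u.act s) = phase s k * fourierCoeff θ k u := opCoeff_alpha s k _

theorem SmoothTorus.ext_fourierCoeff (hθ : θ.transpose = -θ) {u v : SmoothTorus θ}
    (h : ∀ k, fourierCoeff θ k u = fourierCoeff θ k v) : u = v := by
  refine toOp_injective (sub_eq_zero.1 (eq_zero_of_tau θ hθ (sub_mem u.2.1 v.2.1) fun k => ?_))
  have := h k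
  rw [← sub_eq_zero, ← map_sub] at this
  exact this

/-- The derivative at `t = 0` of the `k`-th coefficient of `α_{t e_j}(u)` is computed twice: through
the operator derivative, and from the closed form `e^{i t k_j} u_k`. -/
theorem fourierCoeff_delta (j : Fin n) (k : Fin n → ℤ) (u : SmoothTorus θ) :
    fourierCoeff θ k (delta j u) = k j * fourierCoeff θ k u := by
  set e : Eucl n := EuclideanSpace.single j 1
  have h0 := hasLineDerivAt_alpha (toOp_mem u) 0 e
  have h1 : HasDerivAt (fun t : ℝ => opCoeff θ k (alpha (0 + t • e) (toOp u)))
      (opCoeff θ k (fderiv ℝ (fun s : Eucl n => alpha s (toOp u)) 0 e)) 0 :=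
    ((opCoeff θ k).restrictScalars ℝ).hasFDerivAt.comp_hasDerivAt (0 : ℝ) h0
  have h2 : HasDerivAt (fun t : ℝ => opCoeff θ k (alpha (0 + t • e) (toOp u)))
      (Complex.I * k j * fourierCoeff θ k u) 0 := by
    have h3 : ∀ t : ℝ, opCoeff θ k (alpha (0 + t • e) (toOp u)) =
        Complex.exp (t * (Complex.I * k j)) * fourierCoeff θ k u := fun t => by
      rw [opCoeff_alpha, fourierCoeff_apply, phase]
      congr 2
      simp only [zero_add, inner_smul_left, e, EuclideanSpace.inner_single_left]
      simp
      ring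
    simp_rw [h3]
    have h4 : HasDerivAt (fun t : ℝ => Complex.exp (t * (Complex.I * k j)))
        (Complex.I * k j) 0 := by
      have := ((hasDerivAt_id (0 : ℝ)).ofReal_comp.mul_const (Complex.I * k j)).cexp
      simpa using this
    exact h4.mul_const _
  have h5 := h1.unique h2
  change opCoeff θ k (-Complex.I • lineDeriv ℝ (fun s : Eucl n => alpha s (toOp u)) 0 e) = _
  rw [h0.lineDeriv, map_smul, h5, smul_eq_mul]
  linear_combination (-(k j : ℂ) * fourierCoeff θ k u) * Complex.I_mul_I

/-- `k^β = k_1^{β_1} ⋯ k_n^{β_n}`. -/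
def multiPow (β : Fin n → ℕ) (k : Fin n → ℤ) : ℂ := ∏ j, (k j : ℂ) ^ β j

theorem fourierCoeff_deltaPow (β : Fin n → ℕ) (k : Fin n → ℤ) (u : SmoothTorus θ) :
    fourierCoeff θ k (deltaPow β u) = multiPow β k * fourierCoeff θ k u := by
  have h1 : ∀ w : List (Fin n), fourierCoeff θ k ((w.map delta).prod u) =
      (w.map fun j => (k j : ℂ)).prod * fourierCoeff θ k u := by
    intro w
    induction w with
    | nil => simp
    | cons j w ih =>
      rw [List.map_cons, List.prod_cons, List.map_cons, List.prod_cons]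
      change fourierCoeff θ k (delta j ((w.map delta).prod u)) = _
      rw [fourierCoeff_delta, ih, mul_assoc]
  rw [deltaPow, h1]
  congr 1
  rw [word, List.map_flatMap, List.flatMap_def, List.prod_flatten, List.map_map, multiPow,
    ← List.prod_ofFn, List.ofFn_eq_map]
  congr 2
  ext j
  simp

theorem norm_multiPow_le (β : Fin n → ℕ) (k : Fin n → ℤ) :
    ‖multiPow β k‖ ≤ weight k ^ ∑ j, β j := by
  rw [multiPow, norm_prod, ← Finset.prod_pow_eq_pow_sum]
  refine Finset.prod_le_prod (fun j _ => norm_nonneg _) fun j _ => ?_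
  rw [norm_pow]
  refine pow_le_pow_left₀ (norm_nonneg _) ?_ _
  have := norm_le_pi_norm k j
  rw [Int.norm_eq_abs] at this
  rw [Complex.norm_intCast, weight]
  linarith

theorem seminorms_apply (β : Fin n → ℕ) (u : SmoothTorus θ) :
    SmoothTorus.seminorms θ β u = ‖toOp (deltaPow β u)‖ := rfl

/-- A continuous seminorm that controls the decay of order `N` of the Fourier coefficients. -/
def decayBound (N : ℕ) (u : SmoothTorus θ) : ℝ :=
  2 ^ N * (SmoothTorus.seminorms θ 0 u + ∑ j, SmoothTorus.seminorms θ (Pi.single j N) u)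

theorem weight_pow_mul_norm_fourierCoeff_le (N : ℕ) (k : Fin n → ℤ) (u : SmoothTorus θ) :
    weight k ^ N * ‖fourierCoeff θ k u‖ ≤ decayBound N u := by
  have h0 : ‖fourierCoeff θ k u‖ ≤ SmoothTorus.seminorms θ 0 u := by
    rw [seminorms_zero_apply]; exact norm_opCoeff_le k _
  have hs : 0 ≤ ∑ j, SmoothTorus.seminorms θ (Pi.single j N) u :=
    Finset.sum_nonneg fun j _ => apply_nonneg _ _
  -- If `|k| ≤ 1`, the weight is at most `2` and the operator norm suffices. Otherwise the weight is
  -- at most `2|k|`, and `δ_j^N` is used for a coordinate `j` realizing the sup norm. Both cases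
  -- account for the factor `2 ^ N`.
  rcases le_or_gt ‖k‖ 1 with hk | hk
  · refine mul_le_mul (pow_le_pow_left₀ (weight_pos k).le (by rw [weight]; linarith) N) (by linarith)
      (norm_nonneg _) (by positivity)
  · obtain ⟨j, hj⟩ : ∃ j, ‖k‖ ≤ ‖k j‖ := by
      by_contra! H
      exact lt_irrefl _ ((pi_norm_lt_iff (by linarith)).2 H)
    have h1 : ‖k‖ ^ N * ‖fourierCoeff θ k u‖ ≤ SmoothTorus.seminorms θ (Pi.single j N) u := by
      have h2 : ‖fourierCoeff θ k (deltaPow (Pi.single j N) u)‖ ≤ _ := norm_opCoeff_le k _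
      rw [fourierCoeff_deltaPow, norm_mul] at h2
      refine le_trans (mul_le_mul_of_nonneg_right ?_ (norm_nonneg _)) h2
      have h3 : multiPow (Pi.single j N) k = (k j : ℂ) ^ N := by
        rw [multiPow, Finset.prod_eq_single j]
        · simp
        · intro i _ hi; simp [hi]
        · simp
      rw [h3, norm_pow, Complex.norm_intCast, ← Int.norm_eq_abs]
      exact pow_le_pow_left₀ (norm_nonneg _) hj N
    have h4 : SmoothTorus.seminorms θ (Pi.single j N) u ≤
        ∑ j, SmoothTorus.seminorms θ (Pi.single j N) u :=
      Finset.single_le_sum (f := fun j => SmoothTorus.seminorms θ (Pi.single j N) u)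
        (fun j _ => apply_nonneg _ _) (Finset.mem_univ j)
    calc weight k ^ N * ‖fourierCoeff θ k u‖ ≤ (2 * ‖k‖) ^ N * ‖fourierCoeff θ k u‖ := by
          refine mul_le_mul_of_nonneg_right (pow_le_pow_left₀ (weight_pos k).le ?_ N) (norm_nonneg _)
          rw [weight]; linarith
      _ = 2 ^ N * (‖k‖ ^ N * ‖fourierCoeff θ k u‖) := by rw [mul_pow, mul_assoc]
      _ ≤ decayBound N u := by
          refine mul_le_mul_of_nonneg_left ?_ (by positivity)
          have : 0 ≤ SmoothTorus.seminorms θ 0 u := apply_nonneg _ _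
          linarith

/-- `∑ |a_i| (1 + |κ_i|)^N < ∞` for all `N`. -/
def RapidDecay {I : Type*} (a : I → ℂ) (κ : I → Fin n → ℤ) : Prop :=
  ∀ N : ℕ, Summable fun i => weight (κ i) ^ N * ‖a i‖

/-- A bound of order `N + 2n` leaves the summable factor `weight k ^ (-2n)`. -/
theorem rapidDecay_of_le {a : (Fin n → ℤ) → ℂ}
    (h : ∀ N : ℕ, ∃ C, ∀ k, weight k ^ N * ‖a k‖ ≤ C) : RapidDecay a id := by
  intro N
  obtain ⟨C, hC⟩ := h (N + 2 * n)
  refine ((summable_weight n).mul_left C).of_nonneg_of_le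
    (fun k => mul_nonneg (pow_nonneg (weight_pos _).le _) (norm_nonneg _)) fun k => ?_
  have h0 : 0 < weight k ^ (2 * n) := pow_pos (weight_pos k) _
  rw [← div_eq_mul_inv, le_div_iff₀ h0]
  calc _ = weight k ^ (N + 2 * n) * ‖a k‖ := by rw [pow_add, id]; ring
    _ ≤ C := hC k

theorem rapidDecay_fourierCoeff (u : SmoothTorus θ) :
    RapidDecay (fun k => fourierCoeff θ k u) id :=
  rapidDecay_of_le fun N => ⟨_, fun k => weight_pow_mul_norm_fourierCoeff_le N k u⟩

theorem RapidDecay.summable {I : Type*} {a : I → ℂ} {κ : I → Fin n → ℤ} (h : RapidDecay a κ) :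
    Summable fun i => ‖a i‖ := by simpa using h 0

theorem RapidDecay.summable_Upow {I : Type*} {a : I → ℂ} {κ : I → Fin n → ℤ} (h : RapidDecay a κ) :
    Summable fun i => a i • (Upow θ (κ i) : Op n) := by
  refine Summable.of_norm_bounded h.summable fun i => ?_
  rw [norm_smul]
  exact mul_le_of_le_one_right (norm_nonneg _) (norm_Upow_le θ _)

/-- The map is the one-variable function `x ↦ e^{ix} T` composed with the linear form `s ↦ s·k`,
whose norm is `|k|`; each derivative costs one such factor. -/
theorem norm_iteratedFDeriv_phase_smul_le (m : ℕ) (k : Fin n → ℤ) (T : Op n) (s : Eucl n) :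
    ‖iteratedFDeriv ℝ m (fun s : Eucl n => phase s k • T) s‖ ≤ ‖latticeVec k‖ ^ m * ‖T‖ := by
  let g : ℝ → Op n := fun x => Complex.exp (Complex.I * x) • T
  have hd : ∀ (x : ℝ) (c : ℂ), HasDerivAt (fun x : ℝ => (c * Complex.exp (Complex.I * x)) • T)
      ((c * Complex.I * Complex.exp (Complex.I * x)) • T) x := by
    intro x c
    have := ((((hasDerivAt_id x).ofReal_comp.const_mul Complex.I).cexp).const_mul c).smul_const T
    convert! this using 1
    simp
    ring_nf
  have hg : ∀ m : ℕ, iteratedDeriv m g =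
      fun x : ℝ => (Complex.I ^ m * Complex.exp (Complex.I * x)) • T := by
    intro m
    induction m with
    | zero => simp [g]
    | succ m ih =>
      rw [iteratedDeriv_succ, ih]
      ext1 x
      rw [(hd x _).deriv, pow_succ]
  have hgs : ContDiff ℝ ∞ g := by
    have : ContDiff ℝ ∞ fun x : ℝ => Complex.exp (Complex.I * x) :=
      (contDiff_const.mul Complex.ofRealCLM.contDiff).cexp
    exact this.smul contDiff_const
  let L : Eucl n →L[ℝ] ℝ := innerSL ℝ (latticeVec k)
  have h1 : (fun s : Eucl n => phase s k • T) = g ∘ L := by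
    ext1 s
    simp only [g, L, Function.comp, phase, innerSL_apply_apply]
    rw [real_inner_comm]
  have hL : ‖L‖ = ‖latticeVec k‖ := innerSL_apply_norm ..
  rw [h1, L.iteratedFDeriv_comp_right hgs s (by exact_mod_cast le_top)]
  refine (ContinuousMultilinearMap.norm_compContinuousLinearMap_le _ _).trans ?_
  rw [Finset.prod_const, Finset.card_univ, Fintype.card_fin, hL,
    norm_iteratedFDeriv_eq_norm_iteratedDeriv, hg, norm_smul, norm_mul, norm_pow, Complex.norm_I,
    mul_comm Complex.I, Complex.norm_exp_ofReal_mul_I]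
  simp [mul_comm]

theorem contDiff_phase_smul (k : Fin n → ℤ) (T : Op n) :
    ContDiff ℝ ∞ fun s : Eucl n => phase s k • T := by
  have : ContDiff ℝ ∞ fun s : Eucl n => phase s k :=
    (contDiff_const.mul (Complex.ofRealCLM.contDiff.comp (contDiff_id.inner ℝ contDiff_const))).cexp
  exact this.smul contDiff_const

/-- `α_s` multiplies the `i`-th term by `e^{is·κ_i}`, so derivatives of order `m` cost `|κ_i|^m`.
Rapid decay pays for this, and the series can be differentiated termwise to every order. The index
type is free so that double series need no regrouping. -/
theorem RapidDecay.tsum_mem {I : Type*} {a : I → ℂ} {κ : I → Fin n → ℤ} (h : RapidDecay a κ) :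
    ∑' i, a i • (Upow θ (κ i) : Op n) ∈ smoothSubalgebra θ := by
  have hs := (h.summable_Upow (θ := θ)).hasSum
  constructor
  · refine (StarSubalgebra.isClosed_topologicalClosure _).mem_of_tendsto hs
      (Eventually.of_forall fun F => ?_)
    exact sum_mem fun i _ => (ncTorus θ).smul_mem (Upow_mem_smooth θ (κ i)).1 _
  · have h1 : (fun s : Eucl n => alpha s (∑' i, a i • (Upow θ (κ i) : Op n))) =
        fun s => ∑' i, phase s (κ i) • (a i • (Upow θ (κ i) : Op n)) := by
      ext1 s
      have := hs.map (alpha s) (continuous_alpha s)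
      rw [← this.tsum_eq]
      refine tsum_congr fun i => ?_
      simp only [Function.comp, map_smul, alpha_Upow]
      rw [smul_comm]
    rw [h1]
    refine contDiff_tsum (v := fun m i => (n + 1) ^ m * (weight (κ i) ^ m * ‖a i‖))
      (fun i => contDiff_phase_smul _ _) (fun m _ => (h m).mul_left _) fun m i s _ => ?_
    refine (norm_iteratedFDeriv_phase_smul_le _ _ _ _).trans ?_
    rw [← mul_assoc, ← mul_pow]
    refine mul_le_mul (pow_le_pow_left₀ (norm_nonneg _) (norm_latticeVec_le_weight _) _) ?_
      (norm_nonneg _) (pow_nonneg (mul_nonneg (by positivity) (weight_pos _).le) _)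
    rw [norm_smul]
    exact mul_le_of_le_one_right (norm_nonneg _) (norm_Upow_le θ _)

/-- The sum `∑ a_i U^{κ_i}` of a rapidly decreasing family. -/
def RapidDecay.sum {I : Type*} {a : I → ℂ} {κ : I → Fin n → ℤ} (h : RapidDecay a κ) :
    SmoothTorus θ := ⟨∑' i, a i • (Upow θ (κ i) : Op n), h.tsum_mem⟩

theorem RapidDecay.hasSum_toOp {I : Type*} {a : I → ℂ} {κ : I → Fin n → ℤ} (h : RapidDecay a κ) :
    HasSum (fun i => a i • (Upow θ (κ i) : Op n)) (toOp (h.sum (θ := θ))) :=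
  h.summable_Upow.hasSum

theorem RapidDecay.hasSum_fourierCoeff {I : Type*} {a : I → ℂ} {κ : I → Fin n → ℤ}
    (h : RapidDecay a κ) (k : Fin n → ℤ) :
    HasSum (fun i => a i * if κ i = k then 1 else 0) (fourierCoeff θ k h.sum) := by
  have := (h.hasSum_toOp (θ := θ)).mapL (opCoeff θ k)
  simp only [map_smul, opCoeff_Upow, smul_eq_mul] at this
  exact this

theorem RapidDecay.mul_multiPow {I : Type*} {a : I → ℂ} {κ : I → Fin n → ℤ} (h : RapidDecay a κ)
    (β : Fin n → ℕ) : RapidDecay (fun i => multiPow β (κ i) * a i) κ := by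
  intro N
  refine (h (N + ∑ j, β j)).of_nonneg_of_le
    (fun i => mul_nonneg (pow_nonneg (weight_pos _).le _) (norm_nonneg _)) fun i => ?_
  rw [norm_mul, pow_add, mul_assoc]
  refine mul_le_mul_of_nonneg_left ?_ (pow_nonneg (weight_pos _).le _)
  exact mul_le_mul_of_nonneg_right (norm_multiPow_le β _) (norm_nonneg _)

/-- Both sides have the same Fourier coefficients, so the derivations need not be interchanged with
the sum by hand. -/
theorem RapidDecay.deltaPow_sum (hθ : θ.transpose = -θ) {I : Type*} {a : I → ℂ}
    {κ : I → Fin n → ℤ} (h : RapidDecay a κ) (β : Fin n → ℕ) :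
    deltaPow β (h.sum (θ := θ)) = (h.mul_multiPow β).sum := by
  refine SmoothTorus.ext_fourierCoeff hθ fun k => ?_
  rw [fourierCoeff_deltaPow]
  refine ((h.hasSum_fourierCoeff k).mul_left _).unique ?_
  convert! (h.mul_multiPow β).hasSum_fourierCoeff k using 1
  ext1 i
  split_ifs with hi
  · rw [hi]; ring
  · simp

theorem deltaPow_monomial (hθ : θ.transpose = -θ) (β : Fin n → ℕ) (k : Fin n → ℤ) :
    deltaPow β (monomial θ k) = multiPow β k • monomial θ k := by
  refine SmoothTorus.ext_fourierCoeff hθ fun l => ?_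
  rw [fourierCoeff_deltaPow, map_smul, fourierCoeff_monomial, smul_eq_mul]
  split_ifs with hl
  · rw [hl]
  · simp

/-- In the seminorm with index `β`, the remainder is that of the series with coefficients `κ_i^β
a_i`, which is again rapidly decreasing and converges in operator norm. -/
theorem RapidDecay.hasSum (hθ : θ.transpose = -θ) {I : Type*} {a : I → ℂ} {κ : I → Fin n → ℤ}
    (h : RapidDecay a κ) : HasSum (fun i => a i • monomial θ (κ i)) h.sum := by
  refine ((SmoothTorus.withSeminorms θ).tendsto_nhds _ _).2 fun β ε hε => ?_
  have h1 := (h.mul_multiPow β).hasSum_toOp (θ := θ)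
  have h2 := (Metric.tendsto_nhds.1 h1) ε hε
  filter_upwards [h2] with F hF
  rw [dist_eq_norm, ← h.deltaPow_sum hθ] at hF
  rw [seminorms_apply, map_sub, map_sub, map_sum, map_sum]
  refine lt_of_eq_of_lt ?_ hF
  congr 2
  refine Finset.sum_congr rfl fun i _ => ?_
  rw [map_smul, map_smul, deltaPow_monomial hθ, map_smul, toOp_monomial, smul_smul, mul_comm]

theorem sum_fourierCoeff (hθ : θ.transpose = -θ) (u : SmoothTorus θ) :
    (rapidDecay_fourierCoeff u).sum = u := by
  refine SmoothTorus.ext_fourierCoeff hθ fun k => ?_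
  refine ((rapidDecay_fourierCoeff u).hasSum_fourierCoeff k).unique ?_
  convert! hasSum_ite_eq k (fourierCoeff θ k u) using 1
  ext l
  simp only [id]
  split_ifs with h <;> simp [h]

/-- The Fourier series of `u` converges to `u` in the Fréchet topology. -/
theorem hasSum_fourier (hθ : θ.transpose = -θ) (u : SmoothTorus θ) :
    HasSum (fun k => fourierCoeff θ k u • monomial θ k) u := by
  have := (rapidDecay_fourierCoeff u).hasSum hθ
  rwa [sum_fourierCoeff hθ u] at this

theorem Dual.hasSum (hθ : θ.transpose = -θ) (φ : Dual θ) (u : SmoothTorus θ) :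
    HasSum (fun k => fourierCoeff θ k u * φ (monomial θ k)) (φ u) := by
  have := (hasSum_fourier hθ u).mapL φ
  simpa only [map_smul, smul_eq_mul] using this

theorem rapidDecay_mul (u v : SmoothTorus θ) :
    RapidDecay (fun p : (Fin n → ℤ) × (Fin n → ℤ) =>
      fourierCoeff θ p.1 u * fourierCoeff θ p.2 v * cocycle θ p.1 p.2) fun p => p.1 + p.2 := by
  intro N
  have h1 := rapidDecay_fourierCoeff u N
  have h2 := rapidDecay_fourierCoeff v N
  have h0 : ∀ (k : Fin n → ℤ) (z : ℂ), 0 ≤ weight k ^ N * ‖z‖ := fun k z =>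
    mul_nonneg (pow_nonneg (weight_pos _).le _) (norm_nonneg _)
  refine (h1.mul_of_nonneg h2 (fun k => h0 _ _) fun k => h0 _ _).of_nonneg_of_le
    (fun p => h0 _ _) fun p => ?_
  rw [norm_mul, norm_mul, norm_cocycle, mul_one, mul_mul_mul_comm, ← mul_pow]
  refine mul_le_mul_of_nonneg_right ?_ (by positivity)
  exact pow_le_pow_left₀ (weight_pos _).le (weight_add_le _ _) _

/-- The Cauchy product holds in operator norm by absolute convergence. Rapid decay of the double
family upgrades it to the Fréchet topology. -/
theorem hasSum_mul (hθ : θ.transpose = -θ) (u v : SmoothTorus θ) :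
    HasSum (fun p : (Fin n → ℤ) × (Fin n → ℤ) =>
      (fourierCoeff θ p.1 u * fourierCoeff θ p.2 v * cocycle θ p.1 p.2) • monomial θ (p.1 + p.2))
      (u * v) := by
  have h := (rapidDecay_mul u v).hasSum hθ
  have h1 : (rapidDecay_mul u v).sum = u * v := by
    apply toOp_injective
    refine (rapidDecay_mul u v).hasSum_toOp.unique ?_
    have hn : ∀ w : SmoothTorus θ, Summable fun k => ‖fourierCoeff θ k w • (Upow θ k : Op n)‖ := by
      intro w
      refine (rapidDecay_fourierCoeff w).summable.of_nonneg_of_le (fun _ => norm_nonneg _) fun k => ?_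
      rw [norm_smul]
      exact mul_le_of_le_one_right (norm_nonneg _) (norm_Upow_le θ _)
    have ht : ∀ w : SmoothTorus θ, ∑' k, fourierCoeff θ k w • (Upow θ k : Op n) = toOp w := fun w => by
      have := (rapidDecay_fourierCoeff w).hasSum_toOp (θ := θ)
      rw [sum_fourierCoeff hθ w] at this
      exact this.tsum_eq
    have h2 := (summable_mul_of_summable_norm (hn u) (hn v)).hasSum
    rw [← tsum_mul_tsum_of_summable_norm (hn u) (hn v), ht, ht] at h2
    convert! h2 using 1
    ext1 p
    rw [smul_mul_smul_comm, Upow_mul, smul_smul]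
  rwa [h1] at h

/-- Continuity bounds `φ` by finitely many seminorms, and `δ^β U^k = k^β U^k` makes each of them
polynomially bounded in `k` on the monomials. -/
theorem exists_norm_dual_monomial_le (hθ : θ.transpose = -θ) (φ : Dual θ) :
    ∃ C : ℝ, ∃ N : ℕ, 0 ≤ C ∧ ∀ k, ‖φ (monomial θ k)‖ ≤ C * weight k ^ N := by
  let q : Seminorm ℂ (SmoothTorus θ) := (normSeminorm ℂ ℂ).comp φ.toLinearMap
  have hq : Continuous q := continuous_norm.comp φ.continuous
  obtain ⟨F, C, -, hC⟩ := Seminorm.bound_of_continuous (SmoothTorus.withSeminorms θ) q hq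
  refine ⟨C, F.sup fun β => ∑ j, β j, C.2, fun k => ?_⟩
  refine (hC (monomial θ k)).trans ?_
  change (C : ℝ) * (F.sup (SmoothTorus.seminorms θ)) (monomial θ k) ≤ _
  refine mul_le_mul_of_nonneg_left ?_ C.2
  refine Seminorm.finset_sup_apply_le (pow_nonneg (weight_pos k).le _) fun β hβ => ?_
  rw [seminorms_apply, deltaPow_monomial hθ, map_smul, norm_smul, toOp_monomial]
  refine (mul_le_of_le_one_right (norm_nonneg _) (norm_Upow_le θ _)).trans
    ((norm_multiPow_le β k).trans ?_)
  exact pow_le_pow_right₀ (one_le_weight k) (Finset.le_sup (f := fun β : Fin n → ℕ => ∑ j, β j) hβ)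

theorem Dual.ext_coeff (hθ : θ.transpose = -θ) {φ ψ : Dual θ} (h : ∀ k, φ.coeff k = ψ.coeff k) :
    φ = ψ := by
  have h1 : ∀ k, φ (monomial θ k) = ψ (monomial θ k) := fun k => by
    have h2 := h (-k)
    rw [Dual.coeff, Dual.coeff, star_monomial, map_smul, map_smul, neg_neg] at h2
    exact smul_right_injective ℂ (inv_ne_zero (cocycle_ne_zero θ _ _)) h2
  ext u
  refine (φ.hasSum hθ u).unique ?_
  simp_rw [h1]
  exact ψ.hasSum hθ u

end Coefficients

/-! ### Scalar regularized integrals and their limit. -/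

section CutOff

open scoped FourierTransform

variable {χ : Eucl n × Eucl n → ℂ}

/-- The Fourier transform of `χ` in the first variable. -/
def partialFourier (χ : Eucl n × Eucl n → ℂ) (η ζ : Eucl n) : ℂ := 𝓕 (fun σ => χ (σ, ζ)) η

theorem contDiff_slice (h1 : ContDiff ℝ ∞ χ) (ζ : Eucl n) : ContDiff ℝ ∞ fun σ => χ (σ, ζ) :=
  h1.comp (contDiff_id.prodMk contDiff_const)

theorem isCompact_fst_tsupport (h2 : HasCompactSupport χ) : IsCompact (Prod.fst '' tsupport χ) :=
  IsCompact.image h2 continuous_fst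

theorem slice_eq_zero {σ ζ : Eucl n} (h : σ ∉ Prod.fst '' tsupport χ) : χ (σ, ζ) = 0 :=
  image_eq_zero_of_notMem_tsupport fun h' => h ⟨_, h', rfl⟩

theorem hasCompactSupport_slice (h2 : HasCompactSupport χ) (ζ : Eucl n) :
    HasCompactSupport fun σ => χ (σ, ζ) :=
  HasCompactSupport.intro (isCompact_fst_tsupport h2) fun _ h => slice_eq_zero h

theorem norm_iteratedFDeriv_slice_le (h1 : ContDiff ℝ ∞ χ) (j : ℕ) (ζ σ : Eucl n) :
    ‖iteratedFDeriv ℝ j (fun σ => χ (σ, ζ)) σ‖ ≤ ‖iteratedFDeriv ℝ j χ (σ, ζ)‖ := by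
  let L : Eucl n →L[ℝ] Eucl n × Eucl n := ContinuousLinearMap.inl ℝ _ _
  have h3 : ContDiff ℝ ∞ fun p => χ (p + (0, ζ)) := h1.comp (contDiff_id.add contDiff_const)
  have h4 : (fun σ => χ (σ, ζ)) = (fun p => χ (p + (0, ζ))) ∘ L := by
    ext1 σ; simp [L]
  rw [h4, L.iteratedFDeriv_comp_right h3 σ (by exact_mod_cast le_top)]
  refine (ContinuousMultilinearMap.norm_compContinuousLinearMap_le _ _).trans ?_
  rw [Finset.prod_const, iteratedFDeriv_comp_add_right]
  have : L σ + (0, ζ) = (σ, ζ) := by simp [L]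
  rw [this]
  exact mul_le_of_le_one_right (norm_nonneg _)
    (pow_le_one₀ (norm_nonneg _) (ContinuousLinearMap.norm_inl_le_one _ _ _))

/-- All slices are supported in one compact set and their derivatives are dominated by those of `χ`;
this gives uniformity in `ζ`. -/
theorem exists_integral_iteratedFDeriv_slice_le (h1 : ContDiff ℝ ∞ χ) (h2 : HasCompactSupport χ)
    (j : ℕ) : ∃ C, ∀ ζ : Eucl n, ∫ σ, ‖iteratedFDeriv ℝ j (fun σ => χ (σ, ζ)) σ‖ ≤ C := by
  have hc : Continuous (iteratedFDeriv ℝ j χ) := h1.continuous_iteratedFDeriv (by exact_mod_cast le_top)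
  obtain ⟨B, hB⟩ := (h2.iteratedFDeriv j).exists_bound_of_continuous hc
  set K := Prod.fst '' tsupport χ
  have hK : IsCompact K := isCompact_fst_tsupport h2
  refine ⟨∫ σ, K.indicator (fun _ => B) σ, fun ζ => ?_⟩
  refine integral_mono_of_nonneg (Eventually.of_forall fun σ => norm_nonneg _)
    ((integrable_indicator_iff hK.measurableSet).2
      (integrableOn_const hK.measure_lt_top.ne)) (Eventually.of_forall fun σ => ?_)
  dsimp only
  refine (norm_iteratedFDeriv_slice_le h1 j ζ σ).trans ?_
  by_cases hσ : σ ∈ K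
  · rw [Set.indicator_of_mem hσ]; exact hB _
  · rw [Set.indicator_of_notMem hσ]
    have : iteratedFDeriv ℝ j χ (σ, ζ) = 0 := by
      by_contra h
      exact hσ ⟨_, support_iteratedFDeriv_subset j h, rfl⟩
    rw [this, norm_zero]

/-- Uniformity in `ζ` matters: in `oscTerm_eq` the second argument moves with both `ε` and `η`. -/
theorem exists_norm_partialFourier_le (h1 : ContDiff ℝ ∞ χ) (h2 : HasCompactSupport χ) (N : ℕ) :
    ∃ C, 0 ≤ C ∧ ∀ η ζ : Eucl n, (1 + ‖η‖) ^ N * ‖partialFourier χ η ζ‖ ≤ C := by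
  have hp : ∀ N : ℕ, ∃ C, ∀ η ζ : Eucl n, ‖η‖ ^ N * ‖partialFourier χ η ζ‖ ≤ C := by
    intro N
    choose C hC using exists_integral_iteratedFDeriv_slice_le h1 h2
    refine ⟨2 ^ N * ∑ p ∈ Finset.range 1 ×ˢ Finset.range (N + 1), C p.2, fun η ζ => ?_⟩
    have hf := contDiff_slice h1 ζ
    have := Real.pow_mul_norm_iteratedFDeriv_fourier_le (K := 0) (N := ⊤) (k := 0) (n := N) hf
      (fun k m hk _ => by
        have hk : k = 0 := by simpa using hk
        subst hk
        simp only [pow_zero, one_mul]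
        exact ((hf.continuous_iteratedFDeriv
          (by exact_mod_cast le_top)).integrable_of_hasCompactSupport
            ((hasCompactSupport_slice h2 ζ).iteratedFDeriv m)).norm) le_rfl le_top η
    rw [norm_iteratedFDeriv_zero] at this
    refine this.trans ?_
    simp only [pow_zero, one_mul, Nat.cast_zero, mul_zero, zero_add]
    refine mul_le_mul_of_nonneg_left (Finset.sum_le_sum fun p hp => ?_) (by positivity)
    have : p.1 = 0 := by simpa using (Finset.mem_product.1 hp).1
    simp only [this, pow_zero, one_mul]
    exact hC _ _
  obtain ⟨C, hC⟩ := hp 0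
  obtain ⟨D, hD⟩ := hp N
  have h3 : ∀ η ζ : Eucl n, (1 + ‖η‖) ^ N * ‖partialFourier χ η ζ‖ ≤ 2 ^ (N - 1) * (C + D) := by
    intro η ζ
    calc _ ≤ 2 ^ (N - 1) * (1 ^ N + ‖η‖ ^ N) * ‖partialFourier χ η ζ‖ :=
          mul_le_mul_of_nonneg_right (add_pow_le zero_le_one (norm_nonneg η) N) (norm_nonneg _)
      _ = 2 ^ (N - 1) * (‖η‖ ^ 0 * ‖partialFourier χ η ζ‖ + ‖η‖ ^ N * ‖partialFourier χ η ζ‖) := by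
          ring
      _ ≤ _ := mul_le_mul_of_nonneg_left (add_le_add (hC _ _) (hD _ _)) (by positivity)
  exact ⟨_, (mul_nonneg (by positivity) (norm_nonneg _)).trans (h3 0 0), h3⟩

theorem continuous_partialFourier (h1 : ContDiff ℝ ∞ χ) (h2 : HasCompactSupport χ) :
    Continuous fun p : Eucl n × Eucl n => partialFourier χ p.1 p.2 := by
  obtain ⟨B, hB⟩ := h2.exists_bound_of_continuous h1.continuous
  set K := Prod.fst '' tsupport χ
  have hK : IsCompact K := isCompact_fst_tsupport h2
  simp only [partialFourier, Real.fourier_eq]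
  have hc := h1.continuous
  refine continuous_of_dominated (bound := K.indicator fun _ => B) (fun p => ?_) (fun p => ?_)
    ((integrable_indicator_iff hK.measurableSet).2 (integrableOn_const hK.measure_lt_top.ne))
    (Eventually.of_forall fun σ => ?_)
  · refine Continuous.aestronglyMeasurable ?_
    fun_prop
  · refine Eventually.of_forall fun σ => ?_
    rw [Circle.norm_smul]
    by_cases hσ : σ ∈ K
    · rw [Set.indicator_of_mem hσ]; exact hB _
    · rw [Set.indicator_of_notMem hσ, slice_eq_zero hσ, norm_zero]
  · fun_prop

theorem partialFourier_eq (χ : Eucl n × Eucl n → ℂ) (η ζ : Eucl n) :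
    partialFourier χ η ζ = 𝓕 (fun σ => χ (σ, ζ)) η := rfl

attribute [irreducible] partialFourier

theorem continuous_partialFourier_comp (h1 : ContDiff ℝ ∞ χ) (h2 : HasCompactSupport χ)
    {X : Type*} [TopologicalSpace X] {f g : X → Eucl n} (hf : Continuous f) (hg : Continuous g) :
    Continuous fun x => partialFourier χ (f x) (g x) :=
  Continuous.comp (g := fun p : Eucl n × Eucl n => partialFourier χ p.1 p.2)
    (continuous_partialFourier h1 h2) (hf.prodMk hg)

theorem integrable_one_add_norm_pow (n : ℕ) :
    Integrable fun η : Eucl n => ((1 + ‖η‖) ^ (n + 1))⁻¹ := by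
  have := integrable_one_add_norm (E := Eucl n) (μ := volume) (r := n + 1) (by simp)
  refine this.congr (Eventually.of_forall fun η => ?_)
  dsimp only
  rw [Real.rpow_neg (by positivity)]
  congr 1
  exact_mod_cast Real.rpow_natCast (1 + ‖η‖) (n + 1)

/-- Fourier inversion at the origin. This is how the normalization `χ 0 = 1` enters the limit. -/
theorem integral_partialFourier (h1 : ContDiff ℝ ∞ χ) (h2 : HasCompactSupport χ) :
    ∫ η, partialFourier χ η 0 = χ 0 := by
  have hf := contDiff_slice h1 0
  have hi : Integrable fun η => partialFourier χ η 0 := by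
    obtain ⟨C, -, hC⟩ := exists_norm_partialFourier_le h1 h2 (n + 1)
    have hm : AEStronglyMeasurable (fun η => partialFourier χ η 0) volume :=
      (continuous_partialFourier_comp h1 h2 continuous_id continuous_const).aestronglyMeasurable
    refine ((integrable_one_add_norm_pow n).const_mul C).mono' hm (Eventually.of_forall fun η => ?_)
    rw [← div_eq_mul_inv, le_div_iff₀ (by positivity), mul_comm]
    exact hC η 0
  have := (hf.continuous.integrable_of_hasCompactSupport
    (hasCompactSupport_slice h2 0)).fourierInv_fourier_eq (by simpa only [partialFourier_eq] using hi) (v := 0) hf.continuous.continuousAt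
  rw [Real.fourierInv_eq] at this
  simp only [inner_zero_right, AddChar.map_zero_eq_one, one_smul] at this
  simp only [partialFourier_eq]
  exact this

/-- The regularized oscillating integral of the amplitude `(s, ξ) ↦ e^{-i s·k} g(ξ)`. -/
def oscTerm (χ : Eucl n × Eucl n → ℂ) (g : Eucl n → ℂ) (k : Fin n → ℤ) (ε : ℝ) : ℂ :=
  (((2 * Real.pi) ^ n : ℝ) : ℂ)⁻¹ * ∫ p : Eucl n × Eucl n,
    Complex.exp (Complex.I * (inner ℝ p.1 p.2 : ℝ)) * (χ (ε • p) * (phase (-p.1) k * g p.2))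

theorem continuous_phase (k : Fin n → ℤ) : Continuous fun s : Eucl n => phase s k := by
  unfold phase; fun_prop

theorem hasCompactSupport_comp_smul (h2 : HasCompactSupport χ) {ε : ℝ} (hε : 0 < ε) :
    HasCompactSupport fun p => χ (ε • p) :=
  h2.comp_homeomorph (Homeomorph.smulOfNeZero ε hε.ne')

theorem integrable_oscTerm (h1 : ContDiff ℝ ∞ χ) (h2 : HasCompactSupport χ) {g : Eucl n → ℂ}
    (hg : Continuous g) (k : Fin n → ℤ) {ε : ℝ} (hε : 0 < ε) :
    Integrable fun p : Eucl n × Eucl n =>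
      Complex.exp (Complex.I * (inner ℝ p.1 p.2 : ℝ)) * (χ (ε • p) * (phase (-p.1) k * g p.2)) := by
  have hc := h1.continuous
  have hp := continuous_phase k
  refine Continuous.integrable_of_hasCompactSupport (by fun_prop) ?_
  exact ((hasCompactSupport_comp_smul h2 hε).mul_right).mul_left

/-- Substituting `σ = ε s` turns the inner integral into a Fourier transform of the slice, and `ξ =
k - 2πε η` makes its frequency `η`. The Jacobians `ε^{-n}` and `(2πε)^n` cancel against `(2π)^{-n}`.
No oscillation is left, and `ε` can tend to zero under the integral. -/
theorem oscTerm_eq (h1 : ContDiff ℝ ∞ χ) (h2 : HasCompactSupport χ) {g : Eucl n → ℂ}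
    (hg : Continuous g) (k : Fin n → ℤ) {ε : ℝ} (hε : 0 < ε) :
    oscTerm χ g k ε = ∫ η, partialFourier χ η (ε • (latticeVec k + -(2 * Real.pi * ε) • η)) *
      g (latticeVec k + -(2 * Real.pi * ε) • η) := by
  have hpi := Real.pi_pos
  let H : Eucl n → ℂ := fun ξ =>
    partialFourier χ (-(2 * Real.pi * ε)⁻¹ • (ξ - latticeVec k)) (ε • ξ) * g ξ
  have e1 : ∀ ξ : Eucl n, ∫ s : Eucl n, Complex.exp (Complex.I * (inner ℝ s ξ : ℝ)) *
      (χ (ε • (s, ξ)) * (phase (-s) k * g ξ)) = (((ε ^ n)⁻¹ : ℝ) : ℂ) * H ξ := by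
    intro ξ
    have h3 := Measure.integral_comp_smul (volume : Measure (Eucl n)) (fun σ =>
      (Real.fourierChar (-inner ℝ σ (-(2 * Real.pi * ε)⁻¹ • (ξ - latticeVec k))) • χ (σ, ε • ξ)) * g ξ) ε
    have h4 : |(ε ^ Module.finrank ℝ (Eucl n))⁻¹| = (ε ^ n)⁻¹ := by
      rw [finrank_euclideanSpace_fin, abs_of_pos (by positivity)]
    rw [h4, integral_mul_const (g ξ) (fun σ => (Real.fourierChar (-inner ℝ σ (-(2 * Real.pi * ε)⁻¹ • (ξ - latticeVec k))) •
      χ (σ, ε • ξ))), Complex.real_smul, ← Real.fourier_eq,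
      ← partialFourier_eq] at h3
    refine Eq.trans (integral_congr_ae (Eventually.of_forall fun s => ?_)) h3
    dsimp only
    rw [Circle.smul_def, Real.fourierChar_apply, phase, smul_eq_mul, Prod.smul_mk]
    have h5 : Complex.exp (2 * Real.pi *
        (-inner ℝ (ε • s) (-(2 * Real.pi * ε)⁻¹ • (ξ - latticeVec k)) : ℝ) * Complex.I) =
        Complex.exp (Complex.I * (inner ℝ s ξ : ℝ)) *
          Complex.exp (Complex.I * (inner ℝ (-s) (latticeVec k) : ℝ)) := by
      rw [← Complex.exp_add]
      congr 1
      rw [inner_smul_left, inner_smul_right, inner_sub_right, inner_neg_left]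
      have : (Real.pi : ℂ) ≠ 0 := by exact_mod_cast hpi.ne'
      have h6 : (ε : ℂ) ≠ 0 := by exact_mod_cast hε.ne'
      simp only [conj_trivial]
      push_cast
      field_simp
      ring
    push_cast at h5 ⊢
    rw [h5]; ring
  have e2 : ∫ η, H (latticeVec k + -(2 * Real.pi * ε) • η) =
      ((((2 * Real.pi * ε) ^ n)⁻¹ : ℝ) : ℂ) * ∫ ξ, H ξ := by
    have h3 := Measure.integral_comp_smul (volume : Measure (Eucl n))
      (fun η => H (latticeVec k + η)) (-(2 * Real.pi * ε))
    rw [h3, integral_add_left_eq_self, finrank_euclideanSpace_fin, abs_inv, abs_pow, abs_neg,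
      abs_of_pos (by positivity), Complex.real_smul]
  have e3 : ∀ η : Eucl n, H (latticeVec k + -(2 * Real.pi * ε) • η) =
      partialFourier χ η (ε • (latticeVec k + -(2 * Real.pi * ε) • η)) *
      g (latticeVec k + -(2 * Real.pi * ε) • η) := by
    intro η
    simp only [H]
    congr 2
    rw [add_sub_cancel_left, smul_smul, neg_mul_neg, inv_mul_cancel₀ (by positivity), one_smul]
  simp_rw [← e3]
  rw [e2, oscTerm, Measure.volume_eq_prod, integral_prod_symm _ (integrable_oscTerm h1 h2 hg k hε)]
  simp_rw [e1]
  rw [integral_const_mul, ← mul_assoc]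
  congr 1
  push_cast
  rw [mul_pow _ (ε : ℂ), mul_inv]

/-- Of the `M + (n + 1)` powers of decay, `M` absorb the growth of `g` and `n + 1` leave an
integrable majorant. The `8` bounds `2πε`, from `π ≤ 4` and `ε ≤ 1`. -/
theorem norm_partialFourier_mul_le {M : ℕ} {C A : ℝ} (hA : 0 ≤ A)
    (hC : ∀ η ζ : Eucl n, (1 + ‖η‖) ^ (M + (n + 1)) * ‖partialFourier χ η ζ‖ ≤ C)
    {g : Eucl n → ℂ} (hb : ∀ ξ, ‖g ξ‖ ≤ A * (1 + ‖ξ‖) ^ M) (k : Fin n → ℤ)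
    {ε : ℝ} (hε : 0 < ε) (hε1 : ε ≤ 1) (η ζ : Eucl n) :
    ‖partialFourier χ η ζ * g (latticeVec k + -(2 * Real.pi * ε) • η)‖ ≤
      (C * A * ((n + 1) * 8 * weight k) ^ M) * ((1 + ‖η‖) ^ (n + 1))⁻¹ := by
  have h0 : (0 : ℝ) < 1 + ‖η‖ := by positivity
  have h1 : 1 + ‖latticeVec k + -(2 * Real.pi * ε) • η‖ ≤ ((n + 1) * 8 * weight k) * (1 + ‖η‖) := by
    have h2 := norm_add_le (latticeVec k) (-(2 * Real.pi * ε) • η)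
    have hpi := Real.pi_pos
    have hpi4 := Real.pi_le_four
    have h3 : ‖-(2 * Real.pi * ε) • η‖ ≤ 8 * ‖η‖ := by
      rw [norm_smul, norm_neg, Real.norm_of_nonneg (by positivity)]
      refine mul_le_mul_of_nonneg_right ?_ (norm_nonneg _)
      nlinarith
    have h4 := one_add_norm_latticeVec_le k
    calc 1 + ‖latticeVec k + -(2 * Real.pi * ε) • η‖
        ≤ (1 + ‖latticeVec k‖) * (8 * (1 + ‖η‖)) := by
          nlinarith [norm_nonneg (latticeVec k), norm_nonneg η,
            mul_nonneg (norm_nonneg (latticeVec k)) (norm_nonneg η)]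
      _ ≤ ((n + 1) * weight k) * (8 * (1 + ‖η‖)) := mul_le_mul_of_nonneg_right h4 (by positivity)
      _ = _ := by ring
  have h5 := hC η ζ
  rw [norm_mul, ← div_eq_mul_inv, le_div_iff₀ (by positivity)]
  calc _ ≤ ‖partialFourier χ η ζ‖ * (A * (((n + 1) * 8 * weight k) * (1 + ‖η‖)) ^ M) *
        (1 + ‖η‖) ^ (n + 1) := by
        refine mul_le_mul_of_nonneg_right (mul_le_mul_of_nonneg_left ((hb _).trans ?_)
          (norm_nonneg _)) (by positivity)
        exact mul_le_mul_of_nonneg_left (pow_le_pow_left₀ (by positivity) h1 M) hA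
    _ = ((1 + ‖η‖) ^ (M + (n + 1)) * ‖partialFourier χ η ζ‖) *
        (A * ((n + 1) * 8 * weight k) ^ M) := by rw [mul_pow, pow_add]; ring
    _ ≤ C * (A * ((n + 1) * 8 * weight k) ^ M) := by
        refine mul_le_mul_of_nonneg_right h5 (mul_nonneg hA (pow_nonneg ?_ _))
        exact mul_nonneg (by positivity) (weight_pos k).le
    _ = _ := by ring

/-- The constant depends on neither `g`, `k` nor `ε`, so this bound can dominate a sum over the
frequencies of `ρ` and `u`. -/
theorem exists_norm_oscTerm_le (h1 : ContDiff ℝ ∞ χ) (h2 : HasCompactSupport χ) (M : ℕ) :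
    ∃ C, 0 ≤ C ∧ ∀ {A : ℝ} (_ : 0 ≤ A) {g : Eucl n → ℂ} (_ : Continuous g)
      (_ : ∀ ξ, ‖g ξ‖ ≤ A * (1 + ‖ξ‖) ^ M) (k : Fin n → ℤ) {ε : ℝ} (_ : 0 < ε) (_ : ε ≤ 1),
      ‖oscTerm χ g k ε‖ ≤ C * (A * weight k ^ M) := by
  obtain ⟨C, hC0, hC⟩ := exists_norm_partialFourier_le h1 h2 (M + (n + 1))
  have hI : 0 ≤ ∫ η : Eucl n, ((1 + ‖η‖) ^ (n + 1))⁻¹ := integral_nonneg fun η => by positivity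
  refine ⟨C * ((n + 1) * 8) ^ M * ∫ η : Eucl n, ((1 + ‖η‖) ^ (n + 1))⁻¹, by positivity,
    fun {A} hA {g} hg hb k {ε} hε hε1 => ?_⟩
  rw [oscTerm_eq h1 h2 hg k hε]
  refine (norm_integral_le_of_norm_le ((integrable_one_add_norm_pow n).const_mul _)
    (Eventually.of_forall fun η => norm_partialFourier_mul_le hA hC hb k hε hε1 η _)).trans ?_
  rw [integral_const_mul, mul_pow _ (weight k)]
  exact le_of_eq (by ring)

theorem tendsto_oscTerm (h1 : ContDiff ℝ ∞ χ) (h2 : HasCompactSupport χ) (h3 : χ 0 = 1) {M : ℕ}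
    {A : ℝ} (hA : 0 ≤ A) {g : Eucl n → ℂ} (hg : Continuous g)
    (hb : ∀ ξ, ‖g ξ‖ ≤ A * (1 + ‖ξ‖) ^ M) (k : Fin n → ℤ) :
    Tendsto (oscTerm χ g k) (𝓝[>] 0) (𝓝 (g (latticeVec k))) := by
  obtain ⟨C, hC0, hC⟩ := exists_norm_partialFourier_le h1 h2 (M + (n + 1))
  have hlim : ∫ η, partialFourier χ η 0 * g (latticeVec k) = g (latticeVec k) := by
    rw [integral_mul_const, integral_partialFourier h1 h2, h3, one_mul]
  have hev : ∀ᶠ ε : ℝ in 𝓝[>] 0, 0 < ε ∧ ε ≤ 1 := by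
    filter_upwards [Ioc_mem_nhdsGT (zero_lt_one' ℝ)] with ε hε using hε
  have hT : Tendsto (fun ε : ℝ => ∫ η, partialFourier χ η (ε • (latticeVec k +
      -(2 * Real.pi * ε) • η)) * g (latticeVec k + -(2 * Real.pi * ε) • η)) (𝓝[>] 0)
      (𝓝 (∫ η, partialFourier χ η 0 * g (latticeVec k))) := by
    refine tendsto_integral_filter_of_dominated_convergence _ (Eventually.of_forall fun ε => ?_)
      (hev.mono fun ε hε => Eventually.of_forall fun η =>
        norm_partialFourier_mul_le hA hC hb k hε.1 hε.2 η _)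
      ((integrable_one_add_norm_pow n).const_mul _) (Eventually.of_forall fun η => ?_)
    · refine Continuous.aestronglyMeasurable (Continuous.mul ?_ (by fun_prop))
      exact continuous_partialFourier_comp h1 h2 continuous_id (by fun_prop)
    · have hc : Continuous fun ε : ℝ => partialFourier χ η (ε • (latticeVec k +
          -(2 * Real.pi * ε) • η)) * g (latticeVec k + -(2 * Real.pi * ε) • η) := by
        refine Continuous.mul ?_ (by fun_prop)
        exact continuous_partialFourier_comp h1 h2 continuous_const (by fun_prop)
      have := (hc.tendsto 0).mono_left (nhdsWithin_le_nhds (s := Set.Ioi 0))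
      simpa using this
  rw [hlim] at hT
  refine hT.congr' (hev.mono fun ε hε => ?_)
  rw [oscTerm_eq h1 h2 hg k hε.1]

end CutOff

/-! ### The oscillating integral exists: `P_ρ` on Fourier series. -/

section Quantization

variable {θ : Matrix (Fin n) (Fin n) ℝ} {m : ℝ}

open SmoothTorus

theorem partialPow_zero (f : Eucl n → SmoothTorus θ) : partialPow 0 f = f := by
  have h : word (0 : Fin n → ℕ) = [] := by simp [word]
  rw [partialPow, h]; rfl

theorem norm_deltaPow_symbol_le (ρ : SymbolSpace θ m) (α : Fin n → ℕ) (ξ : Eucl n) :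
    SmoothTorus.seminorms θ α (SymbolSpace.toFun ρ ξ) ≤
      SymbolSpace.seminorms θ m (α, 0) ρ * (1 + ‖ξ‖) ^ m := by
  have h0 : (0 : ℝ) < 1 + ‖ξ‖ := by positivity
  have h : weighted m α 0 (SymbolSpace.toFun ρ) ξ ≤ SymbolSpace.seminorms θ m (α, 0) ρ :=
    le_ciSup (ρ.bddAbove_weighted α 0) ξ
  rw [weighted, partialPow_zero] at h
  simp only [Pi.zero_apply, Nat.cast_zero, Finset.sum_const_zero, add_zero] at h
  rw [Real.rpow_neg h0.le, inv_mul_le_iff₀ (Real.rpow_pos_of_pos h0 m)] at h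
  rw [mul_comm]
  exact h

/-- A continuous seminorm that controls the decay of order `N` of the Fourier coefficients of a
symbol. -/
def symbolBound (N : ℕ) (ρ : SymbolSpace θ m) : ℝ :=
  2 ^ N * (SymbolSpace.seminorms θ m (0, 0) ρ +
    ∑ j, SymbolSpace.seminorms θ m (Pi.single j N, 0) ρ)

theorem symbolBound_nonneg (N : ℕ) (ρ : SymbolSpace θ m) : 0 ≤ symbolBound N ρ :=
  mul_nonneg (by positivity) (add_nonneg (apply_nonneg _ _)
    (Finset.sum_nonneg fun j _ => apply_nonneg _ _))

theorem decayBound_symbol_le (N : ℕ) (ρ : SymbolSpace θ m) (ξ : Eucl n) :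
    decayBound N (SymbolSpace.toFun ρ ξ) ≤ symbolBound N ρ * (1 + ‖ξ‖) ^ m := by
  rw [decayBound, symbolBound, mul_assoc, add_mul, Finset.sum_mul]
  refine mul_le_mul_of_nonneg_left (add_le_add (norm_deltaPow_symbol_le ρ 0 ξ) ?_) (by positivity)
  exact Finset.sum_le_sum fun j _ => norm_deltaPow_symbol_le ρ _ ξ

/-- The Fourier coefficient `ρ_l(ξ)` of a symbol. -/
def symbolCoeff (ρ : SymbolSpace θ m) (l : Fin n → ℤ) (ξ : Eucl n) : ℂ :=
  fourierCoeff θ l (SymbolSpace.toFun ρ ξ)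

theorem continuous_symbolCoeff (ρ : SymbolSpace θ m) (l : Fin n → ℤ) :
    Continuous (symbolCoeff ρ l) :=
  (fourierCoeff θ l).continuous.comp (ρ.isSmooth []).1

theorem weight_mul_norm_symbolCoeff_le (N : ℕ) (ρ : SymbolSpace θ m) (l : Fin n → ℤ) (ξ : Eucl n) :
    weight l ^ N * ‖symbolCoeff ρ l ξ‖ ≤ symbolBound N ρ * (1 + ‖ξ‖) ^ m :=
  (weight_pow_mul_norm_fourierCoeff_le N l _).trans (decayBound_symbol_le N ρ ξ)

/-- The decay is split in two: `N` powers will offset the polynomial weight at `l + k`, and `2n`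
powers give summability in `l`. The order `m` is rounded up to a natural exponent, which is enough
for existence. -/
theorem norm_symbolCoeff_le (N : ℕ) (ρ : SymbolSpace θ m) (l : Fin n → ℤ) (ξ : Eucl n) :
    ‖symbolCoeff ρ l ξ‖ ≤
      symbolBound (N + 2 * n) ρ * ((weight l ^ N)⁻¹ * (weight l ^ (2 * n))⁻¹) *
        (1 + ‖ξ‖) ^ ⌈|m|⌉₊ := by
  have h := weight_mul_norm_symbolCoeff_le (N + 2 * n) ρ l ξ
  have hw : ∀ N, 0 < weight l ^ N := fun N => pow_pos (weight_pos l) N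
  have h1 : (1 + ‖ξ‖) ^ m ≤ (1 + ‖ξ‖) ^ ⌈|m|⌉₊ := by
    rw [← Real.rpow_natCast]
    exact Real.rpow_le_rpow_of_exponent_le (le_add_of_nonneg_right (norm_nonneg _))
      ((le_abs_self m).trans (Nat.le_ceil _))
  rw [← mul_inv, ← pow_add, mul_right_comm, ← div_eq_mul_inv, le_div_iff₀ (hw _), mul_comm]
  exact h.trans (mul_le_mul_of_nonneg_left h1 (symbolBound_nonneg _ _))

theorem weight_add_pow_le (N : ℕ) (k l : Fin n → ℤ) :
    weight (k + l) ^ N ≤ weight k ^ N * weight l ^ N := by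
  rw [← mul_pow]; exact pow_le_pow_left₀ (weight_pos _).le (weight_add_le _ _) _

theorem summable_oscBound (u : SmoothTorus θ) (N : ℕ) :
    Summable fun p : (Fin n → ℤ) × (Fin n → ℤ) =>
      (weight p.1 ^ (2 * n))⁻¹ * (weight p.2 ^ N * ‖fourierCoeff θ p.2 u‖) :=
  (summable_weight n).mul_of_nonneg (rapidDecay_fourierCoeff u N)
    (fun l => inv_nonneg.2 (pow_nonneg (weight_pos l).le _))
    fun _ => mul_nonneg (pow_nonneg (weight_pos _).le _) (norm_nonneg _)

theorem rapidDecay_psiDO (ρ : SymbolSpace θ m) (u : SmoothTorus θ) :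
    RapidDecay (fun p : (Fin n → ℤ) × (Fin n → ℤ) =>
      symbolCoeff ρ p.1 (latticeVec p.2) * fourierCoeff θ p.2 u * cocycle θ p.1 p.2)
      fun p => p.1 + p.2 := by
  intro N
  set M := ⌈|m|⌉₊
  refine ((summable_oscBound u (N + M)).mul_left (symbolBound (N + 2 * n) ρ * (n + 1) ^ M)).of_nonneg_of_le
    (fun p => mul_nonneg (pow_nonneg (weight_pos _).le _) (norm_nonneg _)) fun ⟨l, k⟩ => ?_
  dsimp only
  rw [norm_mul, norm_mul, norm_cocycle, mul_one]
  have hl := pow_pos (weight_pos l) N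
  have hk := pow_pos (weight_pos k) N
  have h1 := norm_symbolCoeff_le N ρ l (latticeVec k)
  have h2 : (1 + ‖latticeVec k‖) ^ M ≤ ((n + 1) * weight k) ^ M :=
    pow_le_pow_left₀ (by positivity) (one_add_norm_latticeVec_le k) M
  have hb := symbolBound_nonneg (N + 2 * n) ρ
  have hi : 0 ≤ (weight l ^ N)⁻¹ * (weight l ^ (2 * n))⁻¹ :=
    mul_nonneg (inv_nonneg.2 hl.le) (inv_nonneg.2 (pow_nonneg (weight_pos l).le _))
  calc weight (l + k) ^ N * (‖symbolCoeff ρ l (latticeVec k)‖ * ‖fourierCoeff θ k u‖)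
      ≤ (weight l ^ N * weight k ^ N) * ((symbolBound (N + 2 * n) ρ *
        ((weight l ^ N)⁻¹ * (weight l ^ (2 * n))⁻¹) * ((n + 1) * weight k) ^ M) *
          ‖fourierCoeff θ k u‖) := by
        refine mul_le_mul (weight_add_pow_le N l k) (mul_le_mul_of_nonneg_right (h1.trans
          (mul_le_mul_of_nonneg_left h2 (mul_nonneg hb hi))) (norm_nonneg _)) (by positivity)
          (by positivity)
    _ = _ := by
        rw [mul_pow, pow_add]
        field_simp

/-- The operator with symbol `ρ` maps `∑ u_k U^k` to `∑ u_k ρ(k) U^k`. -/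
theorem hasOscIntegral_sum (hθ : θ.transpose = -θ) (ρ : SymbolSpace θ m) (u : SmoothTorus θ) :
    HasOscIntegral (amplitude (SymbolSpace.toFun ρ) u) (rapidDecay_psiDO ρ u).sum := by
  intro φ χ h1 h2 h3
  set M := ⌈|m|⌉₊
  obtain ⟨C, N, hC0, hC⟩ := exists_norm_dual_monomial_le hθ φ
  obtain ⟨D, hD0, hD⟩ := exists_norm_oscTerm_le h1 h2 M
  -- `d (l, k)` collects what depends on neither `s` nor `ξ` in the `(l, k)` term of `φ (ρ(ξ)
  -- α_{-s}(u))`; `A l` bounds `ρ_l` up to the factor `(1 + |ξ|)^M`.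
  let d : (Fin n → ℤ) × (Fin n → ℤ) → ℂ := fun p =>
    fourierCoeff θ p.2 u * cocycle θ p.1 p.2 * φ (monomial θ (p.1 + p.2))
  let A : (Fin n → ℤ) → ℝ := fun l =>
    symbolBound (N + 2 * n) ρ * ((weight l ^ N)⁻¹ * (weight l ^ (2 * n))⁻¹)
  have hA0 : ∀ l, 0 ≤ A l := fun l => mul_nonneg (symbolBound_nonneg _ _)
    (mul_nonneg (inv_nonneg.2 (pow_nonneg (weight_pos l).le _))
      (inv_nonneg.2 (pow_nonneg (weight_pos l).le _)))
  have hA : ∀ l ξ, ‖symbolCoeff ρ l ξ‖ ≤ A l * (1 + ‖ξ‖) ^ M := norm_symbolCoeff_le N ρ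
  have hcont := continuous_symbolCoeff ρ
  have hd : ∀ l k, A l * weight k ^ M * ‖d (l, k)‖ ≤ symbolBound (N + 2 * n) ρ * C *
      ((weight l ^ (2 * n))⁻¹ * (weight k ^ (N + M) * ‖fourierCoeff θ k u‖)) := by
    intro l k
    have hl := pow_pos (weight_pos l) N
    have hk := pow_pos (weight_pos k) N
    have hkM := pow_pos (weight_pos k) M
    simp only [d]
    rw [norm_mul, norm_mul, norm_cocycle, mul_one]
    calc _ ≤ A l * weight k ^ M * (‖fourierCoeff θ k u‖ * (C * (weight l ^ N * weight k ^ N))) := by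
          refine mul_le_mul_of_nonneg_left (mul_le_mul_of_nonneg_left ((hC _).trans ?_)
            (norm_nonneg _)) (mul_nonneg (hA0 l) hkM.le)
          exact mul_le_mul_of_nonneg_left (weight_add_pow_le N l k) hC0
      _ = _ := by
          simp only [A]
          rw [pow_add]
          field_simp
  have hsum : Summable fun p : (Fin n → ℤ) × (Fin n → ℤ) => A p.1 * weight p.2 ^ M * ‖d p‖ :=
    ((summable_oscBound u (N + M)).mul_left _).of_nonneg_of_le
      (fun p => mul_nonneg (mul_nonneg (hA0 _) (pow_nonneg (weight_pos _).le _)) (norm_nonneg _))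
      fun p => hd p.1 p.2
  have hamp : ∀ s ξ, HasSum (fun p : (Fin n → ℤ) × (Fin n → ℤ) =>
      phase (-s) p.2 * symbolCoeff ρ p.1 ξ * d p) (φ (amplitude (SymbolSpace.toFun ρ) u s ξ)) := by
    intro s ξ
    have := (hasSum_mul hθ (SymbolSpace.toFun ρ ξ) (u.act (-s))).mapL φ
    convert! this using 1
    ext1 p
    rw [map_smul, fourierCoeff_act, smul_eq_mul, symbolCoeff]
    simp only [d]
    ring
  have hlim : φ (rapidDecay_psiDO ρ u).sum = ∑' p, symbolCoeff ρ p.1 (latticeVec p.2) * d p := by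
    have := ((rapidDecay_psiDO ρ u).hasSum hθ).mapL φ
    rw [← this.tsum_eq]
    refine tsum_congr fun p => ?_
    rw [map_smul, smul_eq_mul]
    simp only [d]
    ring
  -- For fixed `ε` the cutoff has compact support, so absolute summability allows the integral to
  -- pass through the double series.
  have hint : ∀ ε : ℝ, 0 < ε → (((2 * Real.pi) ^ n : ℝ) : ℂ)⁻¹ * ∫ p : Eucl n × Eucl n,
      Complex.exp (Complex.I * (inner ℝ p.1 p.2 : ℝ)) *
        (χ (ε • p) * φ (amplitude (SymbolSpace.toFun ρ) u p.1 p.2)) =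
      ∑' p : (Fin n → ℤ) × (Fin n → ℤ), oscTerm χ (symbolCoeff ρ p.1) p.2 ε * d p := by
    intro ε hε
    let F : (Fin n → ℤ) × (Fin n → ℤ) → Eucl n × Eucl n → ℂ := fun q p =>
      Complex.exp (Complex.I * (inner ℝ p.1 p.2 : ℝ)) *
        (χ (ε • p) * (phase (-p.1) q.2 * symbolCoeff ρ q.1 p.2)) * d q
    have hF : ∀ q, Integrable (F q) := fun q =>
      (integrable_oscTerm h1 h2 (hcont q.1) q.2 hε).mul_const _
    have hB : Integrable fun p : Eucl n × Eucl n => ‖χ (ε • p)‖ * (1 + ‖p.2‖) ^ M := by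
      have hc := h1.continuous
      refine Continuous.integrable_of_hasCompactSupport (by fun_prop) ?_
      exact (hasCompactSupport_comp_smul h2 hε).norm.mul_right
    have hFn : Summable fun q => ∫ p, ‖F q p‖ := by
      refine (hsum.mul_right (∫ p : Eucl n × Eucl n, ‖χ (ε • p)‖ * (1 + ‖p.2‖) ^ M)).of_nonneg_of_le
        (fun q => integral_nonneg fun p => norm_nonneg _) fun q => ?_
      rw [← integral_const_mul]
      refine integral_mono (hF q).norm (hB.const_mul _) fun p => ?_
      simp only [F]
      rw [norm_mul, norm_mul, norm_mul, norm_mul, norm_phase, mul_comm Complex.I,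
        Complex.norm_exp_ofReal_mul_I, one_mul, one_mul]
      calc _ ≤ ‖χ (ε • p)‖ * (A q.1 * (1 + ‖p.2‖) ^ M) * ‖d q‖ :=
            mul_le_mul_of_nonneg_right (mul_le_mul_of_nonneg_left (hA _ _) (norm_nonneg _))
              (norm_nonneg _)
        _ = (A q.1 * ‖d q‖ * 1 ) * (‖χ (ε • p)‖ * (1 + ‖p.2‖) ^ M) := by ring
        -- The factor `weight k ^ M ≥ 1` is inserted so that the majorant `hsum` also serves here.
        _ ≤ _ := by
            refine mul_le_mul_of_nonneg_right ?_ (by positivity)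
            rw [mul_right_comm]
            refine mul_le_mul_of_nonneg_right (mul_le_mul_of_nonneg_left ?_ (hA0 _)) (norm_nonneg _)
            exact one_le_pow₀ (one_le_weight _)
    have h4 := (hasSum_integral_of_summable_integral_norm hF hFn).tsum_eq
    have h5 : ∀ p : Eucl n × Eucl n, ∑' q, F q p = Complex.exp (Complex.I * (inner ℝ p.1 p.2 : ℝ)) *
        (χ (ε • p) * φ (amplitude (SymbolSpace.toFun ρ) u p.1 p.2)) := by
      intro p
      have := (((hamp p.1 p.2).mul_left (χ (ε • p))).mul_left
        (Complex.exp (Complex.I * (inner ℝ p.1 p.2 : ℝ)))).tsum_eq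
      rw [← this]
      refine tsum_congr fun q => ?_
      simp only [F]; ring
    simp_rw [h5] at h4
    rw [← h4, ← tsum_mul_left]
    refine tsum_congr fun q => ?_
    rw [oscTerm, mul_assoc, ← integral_mul_const]
  rw [hlim]
  have hev : ∀ᶠ ε : ℝ in 𝓝[>] 0, 0 < ε ∧ ε ≤ 1 := by
    filter_upwards [Ioc_mem_nhdsGT (zero_lt_one' ℝ)] with ε hε using hε
  have hT : Tendsto (fun ε : ℝ => ∑' p : (Fin n → ℤ) × (Fin n → ℤ),
      oscTerm χ (symbolCoeff ρ p.1) p.2 ε * d p) (𝓝[>] 0)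
      (𝓝 (∑' p, symbolCoeff ρ p.1 (latticeVec p.2) * d p)) := by
    -- Dominated convergence for the sum: each term tends to its value at `ξ = k`, and the majorant
    -- is uniform in `0 < ε ≤ 1`.
    refine tendsto_tsum_of_dominated_convergence (hsum.mul_left D) (fun p => ?_)
      (hev.mono fun ε hε p => ?_)
    · exact (tendsto_oscTerm h1 h2 h3 (hA0 p.1) (hcont p.1) (hA p.1) p.2).mul_const _
    · rw [norm_mul, ← mul_assoc]
      exact mul_le_mul_of_nonneg_right (hD (hA0 p.1) (hcont p.1) (hA p.1) p.2 hε.1 hε.2)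
        (norm_nonneg _)
  exact hT.congr' (hev.mono fun ε hε => (hint ε hε.1).symm)

theorem hasOscIntegral_psiDO (hθ : θ.transpose = -θ) (ρ : SymbolSpace θ m) (u : SmoothTorus θ) :
    HasOscIntegral (amplitude (SymbolSpace.toFun ρ) u) (psiDO (SymbolSpace.toFun ρ) u) := by
  have h : ∃ b, HasOscIntegral (amplitude (SymbolSpace.toFun ρ) u) b := ⟨_, hasOscIntegral_sum hθ ρ u⟩
  rw [psiDO, oscIntegral, dif_pos h]
  exact h.choose_spec

/-- The Fourier coefficients are continuous functionals that separate points, so a single cutoff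
suffices. A bump function provides one. -/
theorem HasOscIntegral.unique (hθ : θ.transpose = -θ) {a : Eucl n → Eucl n → SmoothTorus θ}
    {b c : SmoothTorus θ} (hb : HasOscIntegral a b) (hc : HasOscIntegral a c) : b = c := by
  refine SmoothTorus.ext_fourierCoeff hθ fun k => ?_
  let f : ContDiffBump (0 : Eucl n × Eucl n) := ⟨1, 2, one_pos, one_lt_two⟩
  let χ : Eucl n × Eucl n → ℂ := fun p => (f p : ℂ)
  have h1 : ContDiff ℝ ∞ χ := Complex.ofRealCLM.contDiff.comp f.contDiff
  have h2 : HasCompactSupport χ := f.hasCompactSupport.comp_left (g := fun x : ℝ => (x : ℂ)) (by simp)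
  have h3 : χ 0 = 1 := by
    simp only [χ]
    rw [f.one_of_mem_closedBall (Metric.mem_closedBall_self zero_le_one)]; simp
  exact tendsto_nhds_unique (hb _ χ h1 h2 h3) (hc _ χ h1 h2 h3)

theorem psiDO_eq_sum (hθ : θ.transpose = -θ) (ρ : SymbolSpace θ m) (u : SmoothTorus θ) :
    psiDO (SymbolSpace.toFun ρ) u = (rapidDecay_psiDO ρ u).sum :=
  (hasOscIntegral_psiDO hθ ρ u).unique hθ (hasOscIntegral_sum hθ ρ u)

/-- Only the pairs with `l + k = j` contribute; they are parametrized by `l`. -/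
theorem hasSum_fourierCoeff_psiDO (hθ : θ.transpose = -θ) (ρ : SymbolSpace θ m) (u : SmoothTorus θ)
    (j : Fin n → ℤ) :
    HasSum (fun l => cocycle θ l (j - l) * symbolCoeff ρ l (latticeVec (j - l)) *
      fourierCoeff θ (j - l) u) (fourierCoeff θ j (psiDO (SymbolSpace.toFun ρ) u)) := by
  have h := (rapidDecay_psiDO ρ u).hasSum_fourierCoeff (θ := θ) j
  rw [← psiDO_eq_sum hθ] at h
  have hi : Function.Injective fun l : Fin n → ℤ => (l, j - l) := fun l l' h => (Prod.ext_iff.1 h).1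
  rw [← hi.hasSum_iff] at h
  · convert! h using 1
    ext1 l
    simp [mul_comm, mul_left_comm]
  · rintro ⟨l, k⟩ hlk
    rw [if_neg, mul_zero]
    rintro rfl
    exact hlk ⟨l, by simp⟩

end Quantization

/-! ### Weighted shifts on `ℓ²(ℤⁿ)`. -/

/-- `ℓ²(ℤⁿ)`. -/
abbrev SeqL2 (n : ℕ) := lp (fun _ : Fin n → ℤ => ℂ) 2

theorem sum_weightedShift_le {a : (Fin n → ℤ) → ℂ} {C : ℝ} (hC : 0 ≤ C) (ha : ∀ j, ‖a j‖ ≤ C)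
    (l : Fin n → ℤ) (x : SeqL2 n) (s : Finset (Fin n → ℤ)) :
    ∑ j ∈ s, ‖a j * x (j - l)‖ ^ (2 : ℝ≥0∞).toReal ≤ (C * ‖x‖) ^ (2 : ℝ≥0∞).toReal := by
  have h := lp.sum_rpow_le_norm_rpow (p := 2) (by simp) x (s.map (Equiv.subRight l).toEmbedding)
  rw [Finset.sum_map] at h
  rw [Real.mul_rpow hC (norm_nonneg _)]
  refine le_trans ?_ (mul_le_mul_of_nonneg_left h (Real.rpow_nonneg hC _))
  rw [Finset.mul_sum]
  refine Finset.sum_le_sum fun j _ => ?_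
  rw [norm_mul, Real.mul_rpow (norm_nonneg _) (norm_nonneg _)]
  refine mul_le_mul_of_nonneg_right ?_ (Real.rpow_nonneg (norm_nonneg _) _)
  exact Real.rpow_le_rpow (norm_nonneg _) (ha j) (by simp)

/-- The weighted shift `(x_j) ↦ (a_j x_{j-l})` for a bounded sequence `a`. -/
def weightedShift (a : (Fin n → ℤ) → ℂ) (l : Fin n → ℤ) {C : ℝ} (hC : 0 ≤ C)
    (ha : ∀ j, ‖a j‖ ≤ C) : SeqL2 n →L[ℂ] SeqL2 n :=
  LinearMap.mkContinuous
    { toFun := fun x => ⟨fun j => a j * x (j - l), memℓp_gen' (sum_weightedShift_le hC ha l x)⟩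
      map_add' := fun x y => by ext j; exact mul_add _ _ _
      map_smul' := fun c x => by ext j; exact mul_left_comm _ _ _ } C
    fun x => lp.norm_le_of_forall_sum_le (by simp) (mul_nonneg hC (norm_nonneg _))
      (sum_weightedShift_le hC ha l x)

theorem weightedShift_apply (a : (Fin n → ℤ) → ℂ) (l : Fin n → ℤ) {C : ℝ} (hC : 0 ≤ C)
    (ha : ∀ j, ‖a j‖ ≤ C) (x : SeqL2 n) (j : Fin n → ℤ) :
    weightedShift a l hC ha x j = a j * x (j - l) := rfl

theorem norm_weightedShift_le (a : (Fin n → ℤ) → ℂ) (l : Fin n → ℤ) {C : ℝ} (hC : 0 ≤ C)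
    (ha : ∀ j, ‖a j‖ ≤ C) : ‖weightedShift a l hC ha‖ ≤ C := LinearMap.mkContinuous_norm_le _ hC _

/-- A diagonal operator whose entries tend to zero is compact. -/
theorem isCompactOperator_weightedShift_zero (a : (Fin n → ℤ) → ℂ) {C : ℝ} (hC : 0 ≤ C)
    (ha : ∀ j, ‖a j‖ ≤ C) (h0 : Tendsto a cofinite (𝓝 0)) :
    IsCompactOperator (weightedShift a 0 hC ha) := by
  classical
  let S : Finset (Fin n → ℤ) → SeqL2 n →L[ℂ] SeqL2 n := fun F =>
    ∑ k ∈ F, (ContinuousLinearMap.toSpanSingleton ℂ (lp.single 2 k (a k) : SeqL2 n)).comp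
      (lp.evalCLM ℂ (fun _ : Fin n → ℤ => ℂ) 2 k)
  have hS : ∀ F, IsCompactOperator (S F) := fun F => by
    change S F ∈ compactOperator (RingHom.id ℂ) (SeqL2 n) (SeqL2 n)
    refine Submodule.sum_mem _ fun k _ => ?_
    exact (isCompactOperator_of_locallyCompactSpace_dom
      (lp.evalCLM ℂ (fun _ : Fin n → ℤ => ℂ) 2 k)).clm_comp
        (ContinuousLinearMap.toSpanSingleton ℂ (lp.single 2 k (a k) : SeqL2 n))
  have hSa : ∀ F (x : SeqL2 n) j, S F x j = if j ∈ F then a j * x j else 0 := by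
    intro F x j
    have h1 : S F x = ∑ k ∈ F, x k • (lp.single 2 k (a k) : SeqL2 n) := by
      simp only [S, sum_apply]; rfl
    rw [h1, lp.coeFn_sum, Finset.sum_apply]
    simp only [lp.coeFn_smul, Pi.smul_apply, lp.coeFn_single, smul_eq_mul, Pi.single_apply]
    simp [mul_comm]
  refine isCompactOperator_of_tendsto (F := S) (l := atTop) ?_ (Eventually.of_forall hS)
  rw [Metric.tendsto_atTop]
  intro ε hε
  -- Once the finite-rank truncation contains these indices, the difference is diagonal with entries
  -- at most `ε / 2`; halving yields the strict inequality at the end.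
  have hfin : {k | ¬ ‖a k‖ < ε / 2}.Finite := by
    have := h0.norm.eventually (gt_mem_nhds (by rw [norm_zero]; positivity : ‖(0 : ℂ)‖ < ε / 2))
    exact eventually_cofinite.1 this
  refine ⟨hfin.toFinset, fun F hF => ?_⟩
  have hb : ∀ j, ‖if j ∈ F then 0 else -a j‖ ≤ ε / 2 := by
    intro j
    split_ifs with hj
    · rw [norm_zero]; positivity
    · rw [norm_neg]
      by_contra hcon
      exact hj (hF (hfin.mem_toFinset.2 fun hlt => hcon hlt.le))
  have he : S F - weightedShift a 0 hC ha = weightedShift _ 0 (by positivity) hb := by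
    ext x j
    change S F x j - a j * x (j - 0) = (if j ∈ F then 0 else -a j) * x (j - 0)
    rw [hSa, sub_zero]
    split_ifs <;> ring
  rw [dist_eq_norm, he]
  exact (norm_weightedShift_le _ _ _ hb).trans_lt (by linarith)

/-! ### Estimates for `(1 + |k|²)^{s/2}`. -/

section Bracket

/-- `1 + |k|²`. -/
def jap (k : Fin n → ℤ) : ℝ := 1 + ∑ j, (k j : ℝ) ^ 2

theorem bracket_eq (s : ℝ) (k : Fin n → ℤ) : bracket s k = jap k ^ (s / 2) := rfl

theorem jap_eq (k : Fin n → ℤ) : jap k = 1 + ‖latticeVec k‖ ^ 2 := by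
  rw [EuclideanSpace.real_norm_sq_eq]; rfl

theorem one_le_jap (k : Fin n → ℤ) : 1 ≤ jap k :=
  le_add_of_nonneg_right (Finset.sum_nonneg fun _ _ => sq_nonneg _)

theorem jap_pos (k : Fin n → ℤ) : 0 < jap k := one_pos.trans_le (one_le_jap k)

theorem jap_neg (k : Fin n → ℤ) : jap (-k) = jap k := by simp [jap]

theorem jap_add_le (k l : Fin n → ℤ) : jap (k + l) ≤ 2 * jap k * jap l := by
  rw [jap_eq, jap_eq, jap_eq, latticeVec_add]
  have h := norm_add_le (latticeVec k) (latticeVec l)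
  have h1 : ‖latticeVec k + latticeVec l‖ ^ 2 ≤ (‖latticeVec k‖ + ‖latticeVec l‖) ^ 2 :=
    pow_le_pow_left₀ (norm_nonneg _) h 2
  nlinarith [sq_nonneg (‖latticeVec k‖ - ‖latticeVec l‖),
    mul_nonneg (sq_nonneg ‖latticeVec k‖) (sq_nonneg ‖latticeVec l‖)]

theorem jap_le_weight (k : Fin n → ℤ) : jap k ≤ ((n + 1) * weight k) ^ 2 := by
  have h := one_add_norm_latticeVec_le k
  have h1 : (1 + ‖latticeVec k‖) ^ 2 ≤ ((n + 1) * weight k) ^ 2 :=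
    pow_le_pow_left₀ (by positivity) h 2
  rw [jap_eq]
  nlinarith [norm_nonneg (latticeVec k)]

theorem bracket_pos (s : ℝ) (k : Fin n → ℤ) : 0 < bracket s k := Real.rpow_pos_of_pos (jap_pos k) _

theorem bracket_ne_zero (s : ℝ) (k : Fin n → ℤ) : (bracket s k : ℂ) ≠ 0 := by
  exact_mod_cast (bracket_pos s k).ne'

theorem bracket_add (s t : ℝ) (k : Fin n → ℤ) : bracket (s + t) k = bracket s k * bracket t k := by
  rw [bracket_eq, bracket_eq, bracket_eq, add_div, Real.rpow_add (jap_pos k)]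

theorem bracket_zero (k : Fin n → ℤ) : bracket 0 k = 1 := by
  rw [bracket_eq, zero_div, Real.rpow_zero]

theorem bracket_neg (s : ℝ) (k : Fin n → ℤ) : bracket (-s) k = (bracket s k)⁻¹ := by
  rw [bracket_eq, bracket_eq, neg_div, Real.rpow_neg (jap_pos k).le]

theorem bracket_le_weight (s : ℝ) (k : Fin n → ℤ) :
    bracket s k ≤ ((n + 1) * weight k) ^ (2 * ⌈|s|⌉₊) := by
  rw [bracket_eq, pow_mul, ← Real.rpow_natCast]
  have h : s / 2 ≤ (⌈|s|⌉₊ : ℝ) := by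
    have := Nat.le_ceil |s|
    have := le_abs_self s
    have := abs_nonneg s
    linarith
  exact (Real.rpow_le_rpow_of_exponent_le (one_le_jap k) h).trans
    (Real.rpow_le_rpow (jap_pos k).le (jap_le_weight k) (by positivity))

/-- Comparability in both directions covers both signs of the exponent, since changing the sign of
`e` exchanges `x` and `y`. -/
theorem rpow_mul_rpow_neg_le {x y c : ℝ} (hx : 0 < x) (hy : 0 < y) (h1 : x ≤ c * y)
    (h2 : y ≤ c * x) (e : ℝ) : x ^ e * y ^ (-e) ≤ c ^ |e| := by
  have key : ∀ {x y : ℝ} (_ : 0 < x) (_ : 0 < y) (_ : x ≤ c * y) {e : ℝ} (_ : 0 ≤ e),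
      x ^ e * y ^ (-e) ≤ c ^ |e| := by
    intro x y hx hy h e he
    rw [Real.rpow_neg hy.le, ← div_eq_mul_inv, ← Real.div_rpow hx.le hy.le, abs_of_nonneg he]
    exact Real.rpow_le_rpow (div_pos hx hy).le ((div_le_iff₀ hy).2 h) he
  rcases le_total 0 e with he | he
  · exact key hx hy h1 he
  · have := key hy hx h2 (neg_nonneg.2 he)
    rwa [neg_neg, abs_neg, mul_comm] at this

/-- Peetre's inequality. -/
theorem bracket_mul_bracket_neg_le (s : ℝ) (l j : Fin n → ℤ) :
    bracket s j * bracket (-s) (j - l) ≤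
      (2 * (n + 1) ^ 2) ^ ⌈|s|⌉₊ * weight l ^ (2 * ⌈|s|⌉₊) := by
  have hl := one_le_jap l
  have h1 : jap j ≤ (2 * jap l) * jap (j - l) := by
    have := jap_add_le l (j - l)
    rwa [add_sub_cancel] at this
  have h2 : jap (j - l) ≤ (2 * jap l) * jap j := by
    have := jap_add_le (-l) j
    rwa [jap_neg, neg_add_eq_sub] at this
  rw [bracket_eq, bracket_eq, neg_div]
  refine (rpow_mul_rpow_neg_le (jap_pos _) (jap_pos _) h1 h2 (s / 2)).trans ?_
  have h : |s / 2| ≤ (⌈|s|⌉₊ : ℝ) := by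
    rw [abs_div, abs_two]
    have := Nat.le_ceil |s|
    have := abs_nonneg s
    linarith
  refine (Real.rpow_le_rpow_of_exponent_le (by linarith) h).trans ?_
  rw [Real.rpow_natCast, pow_mul (weight l), ← mul_pow]
  refine pow_le_pow_left₀ (by positivity) ?_ _
  have := jap_le_weight l
  rw [mul_pow] at this
  linarith

theorem bracket_neg_mul_rpow_le (m : ℝ) (k : Fin n → ℤ) :
    bracket (-m) k * (1 + ‖latticeVec k‖) ^ m ≤ 2 ^ |m / 2| := by
  have h0 : 0 < (1 + ‖latticeVec k‖) ^ 2 := by positivity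
  have h1 : (1 + ‖latticeVec k‖) ^ 2 ≤ 2 * jap k := by
    rw [jap_eq]; nlinarith [sq_nonneg (1 - ‖latticeVec k‖)]
  have h2 : jap k ≤ 2 * (1 + ‖latticeVec k‖) ^ 2 := by
    rw [jap_eq]; nlinarith [norm_nonneg (latticeVec k)]
  have := rpow_mul_rpow_neg_le h0 (jap_pos k) h1 h2 (m / 2)
  rw [bracket_eq, mul_comm, neg_div]
  convert! this using 2
  rw [← Real.rpow_natCast, ← Real.rpow_mul (by positivity)]
  congr 1
  push_cast; ring

theorem tendsto_bracket_cofinite {m : ℝ} (hm : m < 0) :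
    Tendsto (fun k : Fin n → ℤ => (bracket m k : ℂ)) cofinite (𝓝 0) := by
  have h1 : Tendsto (fun k : Fin n → ℤ => ‖k‖) cofinite atTop := by
    rw [← Filter.cocompact_eq_cofinite]; exact tendsto_norm_cocompact_atTop
  have h2 : ∀ k : Fin n → ℤ, ‖k‖ ≤ jap k := fun k => by
    refine (pi_norm_le_iff_of_nonneg (jap_pos k).le).2 fun j => ?_
    have : (k j : ℝ) ^ 2 ≤ ∑ j, (k j : ℝ) ^ 2 :=
      Finset.single_le_sum (f := fun j => (k j : ℝ) ^ 2) (fun j _ => sq_nonneg _) (Finset.mem_univ j)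
    rw [Int.norm_eq_abs, jap]
    nlinarith [sq_abs (k j : ℝ), sq_nonneg (|(k j : ℝ)| - 1)]
  have h3 := (tendsto_rpow_neg_atTop (y := -(m / 2)) (by linarith)).comp
    (tendsto_atTop_mono h2 h1)
  rw [neg_neg] at h3
  exact_mod_cast (Complex.continuous_ofReal.tendsto 0).comp h3

end Bracket

/-! ### The matrix of `Λ^s P_ρ Λ^{-s-m}`, summed along its diagonals. -/

section Matrix

variable {θ : Matrix (Fin n) (Fin n) ℝ} {m : ℝ}

/-- The entries of `Λ^s P_ρ Λ^{-s-m}` along the `l`-th diagonal. -/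
def diagEntry (s : ℝ) (ρ : SymbolSpace θ m) (l j : Fin n → ℤ) : ℂ :=
  bracket s j * bracket (-(s + m)) (j - l) *
    (cocycle θ l (j - l) * symbolCoeff ρ l (latticeVec (j - l)))

variable (n) in
/-- The constant in the estimate of `diagEntry`. -/
def diagConst (s m : ℝ) : ℝ := (2 * (n + 1) ^ 2) ^ ⌈|s|⌉₊ * 2 ^ |m / 2|

theorem diagConst_nonneg (s m : ℝ) : 0 ≤ diagConst n s m := by unfold diagConst; positivity

theorem diagBound_nonneg (s : ℝ) (ρ : SymbolSpace θ m) (l : Fin n → ℤ) :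
    0 ≤ diagConst n s m * symbolBound (2 * ⌈|s|⌉₊ + 2 * n) ρ * (weight l ^ (2 * n))⁻¹ :=
  mul_nonneg (mul_nonneg (diagConst_nonneg s m) (symbolBound_nonneg _ _))
    (inv_nonneg.2 (pow_nonneg (weight_pos l).le _))

/-- With `k = j - l`, the factor `bracket (-m) k` cancels the growth `(1 + |k|)^m` of the symbol.
Peetre's inequality compares the weights at `j` and `k` at the cost of `weight l ^ (2⌈|s|⌉)`. Decay
of order `2⌈|s|⌉ + 2n` in `l` pays this and leaves a summable factor. -/
theorem norm_diagEntry_le (s : ℝ) (ρ : SymbolSpace θ m) (l j : Fin n → ℤ) :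
    ‖diagEntry s ρ l j‖ ≤
      diagConst n s m * symbolBound (2 * ⌈|s|⌉₊ + 2 * n) ρ * (weight l ^ (2 * n))⁻¹ := by
  set N := ⌈|s|⌉₊
  set k := j - l with hk
  have hb1 := bracket_pos s j
  have hb2 := bracket_pos (-s) k
  have hb3 := bracket_pos (-m) k
  have hw : 0 < weight l ^ (2 * n) := pow_pos (weight_pos l) _
  have hw' : 0 < weight l ^ (2 * N) := pow_pos (weight_pos l) _
  have h1 : ‖diagEntry s ρ l j‖ =
      (bracket s j * bracket (-s) k) * (bracket (-m) k * ‖symbolCoeff ρ l (latticeVec k)‖) := by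
    rw [diagEntry, ← hk, neg_add, bracket_add, norm_mul, norm_mul, norm_mul, norm_cocycle,
      Complex.norm_real, Complex.norm_real, Real.norm_of_nonneg hb1.le,
      Real.norm_of_nonneg (mul_pos hb2 hb3).le]
    ring
  rw [h1, ← div_eq_mul_inv, le_div_iff₀ hw]
  have h2 := bracket_mul_bracket_neg_le s l j
  have h3 := bracket_neg_mul_rpow_le m k
  have h4 := weight_mul_norm_symbolCoeff_le (2 * N + 2 * n) ρ l (latticeVec k)
  have hS := symbolBound_nonneg (2 * N + 2 * n) ρ
  calc _ ≤ ((2 * (n + 1) ^ 2) ^ N * weight l ^ (2 * N)) *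
        (bracket (-m) k * ‖symbolCoeff ρ l (latticeVec k)‖) * weight l ^ (2 * n) := by
        refine mul_le_mul_of_nonneg_right (mul_le_mul_of_nonneg_right h2 ?_) hw.le
        exact mul_nonneg hb3.le (norm_nonneg _)
    _ = (2 * (n + 1) ^ 2) ^ N * bracket (-m) k *
        (weight l ^ (2 * N + 2 * n) * ‖symbolCoeff ρ l (latticeVec k)‖) := by rw [pow_add]; ring
    _ ≤ (2 * (n + 1) ^ 2) ^ N * bracket (-m) k *
        (symbolBound (2 * N + 2 * n) ρ * (1 + ‖latticeVec k‖) ^ m) :=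
        mul_le_mul_of_nonneg_left h4 (by positivity)
    _ = (2 * (n + 1) ^ 2) ^ N * symbolBound (2 * N + 2 * n) ρ *
        (bracket (-m) k * (1 + ‖latticeVec k‖) ^ m) := by ring
    _ ≤ (2 * (n + 1) ^ 2) ^ N * symbolBound (2 * N + 2 * n) ρ * 2 ^ |m / 2| :=
        mul_le_mul_of_nonneg_left h3 (by positivity)
    _ = _ := by rw [diagConst]; ring

/-- The `l`-th diagonal of `Λ^s P_ρ Λ^{-s-m}`. -/
def diagOp (s : ℝ) (ρ : SymbolSpace θ m) (l : Fin n → ℤ) : SeqL2 n →L[ℂ] SeqL2 n :=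
  weightedShift (diagEntry s ρ l) l (diagBound_nonneg s ρ l) (norm_diagEntry_le s ρ l)

theorem norm_diagOp_le (s : ℝ) (ρ : SymbolSpace θ m) (l : Fin n → ℤ) :
    ‖diagOp s ρ l‖ ≤
      diagConst n s m * symbolBound (2 * ⌈|s|⌉₊ + 2 * n) ρ * (weight l ^ (2 * n))⁻¹ :=
  norm_weightedShift_le _ _ _ _

theorem summable_diagOp (s : ℝ) (ρ : SymbolSpace θ m) : Summable (diagOp s ρ) :=
  Summable.of_norm_bounded ((summable_weight n).mul_left _) (norm_diagOp_le s ρ)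

theorem symbolCoeff_add (ρ σ : SymbolSpace θ m) (l : Fin n → ℤ) (ξ : Eucl n) :
    symbolCoeff (ρ + σ) l ξ = symbolCoeff ρ l ξ + symbolCoeff σ l ξ := by
  rw [symbolCoeff, map_add, Pi.add_apply, map_add]; rfl

theorem symbolCoeff_smul (c : ℂ) (ρ : SymbolSpace θ m) (l : Fin n → ℤ) (ξ : Eucl n) :
    symbolCoeff (c • ρ) l ξ = c * symbolCoeff ρ l ξ := by
  rw [symbolCoeff, map_smul, Pi.smul_apply, map_smul]; rfl

/-- The operator `Λ^s P_ρ Λ^{-s-m}` on `ℓ²(ℤⁿ)`. -/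
def matrixOp (s : ℝ) : SymbolSpace θ m →ₗ[ℂ] SeqL2 n →L[ℂ] SeqL2 n where
  toFun ρ := ∑' l, diagOp s ρ l
  map_add' ρ σ := by
    rw [← (summable_diagOp s ρ).tsum_add (summable_diagOp s σ)]
    refine tsum_congr fun l => ?_
    ext x j
    change diagEntry s (ρ + σ) l j * x (j - l) =
      diagEntry s ρ l j * x (j - l) + diagEntry s σ l j * x (j - l)
    rw [diagEntry, diagEntry, diagEntry, symbolCoeff_add]; ring
  map_smul' c ρ := by
    rw [RingHom.id_apply, ← (summable_diagOp s ρ).tsum_const_smul]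
    refine tsum_congr fun l => ?_
    ext x j
    change diagEntry s (c • ρ) l j * x (j - l) = c * (diagEntry s ρ l j * x (j - l))
    rw [diagEntry, diagEntry, symbolCoeff_smul]; ring

theorem hasSum_matrixOp_apply (s : ℝ) (ρ : SymbolSpace θ m) (x : SeqL2 n) (j : Fin n → ℤ) :
    HasSum (fun l => diagEntry s ρ l j * x (j - l)) (matrixOp s ρ x j) := by
  have h := ((summable_diagOp s ρ).hasSum.mapL
    (ContinuousLinearMap.apply ℂ (SeqL2 n) x)).mapL (lp.evalCLM ℂ (fun _ : Fin n → ℤ => ℂ) 2 j)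
  exact h

theorem norm_matrixOp_le (s : ℝ) (ρ : SymbolSpace θ m) :
    ‖matrixOp s ρ‖ ≤ diagConst n s m * symbolBound (2 * ⌈|s|⌉₊ + 2 * n) ρ *
      ∑' l : Fin n → ℤ, (weight l ^ (2 * n))⁻¹ := by
  rw [← tsum_mul_left]
  exact tsum_of_norm_bounded ((summable_weight n).mul_left _).hasSum (norm_diagOp_le s ρ)

end Matrix

/-! ### Sobolev spaces as copies of `ℓ²(ℤⁿ)`, and the extensions of `P_ρ`. -/

section Sobolev

variable {θ : Matrix (Fin n) (Fin n) ℝ}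

open SmoothTorus

theorem SeqL2.ext {x y : SeqL2 n} (h : ∀ k, x k = y k) : x = y := lp.ext (funext h)

theorem orthonormal_monomial : Orthonormal ℂ (HTheta.monomial θ) := by
  rw [orthonormal_iff_ite]
  intro k l
  rw [HTheta.monomial, HTheta.monomial, UniformSpace.Completion.inner_coe, PolyTorus.inner_def]
  change tau ((Upow θ l : Op n) * star (Upow θ k : Op n)) = _
  rw [tau_Upow_mul_star]
  simp only [eq_comm]

variable (θ) in
/-- The Hilbert basis `(U^k)` of `ℋ_θ`. -/
def monomialBasis : HilbertBasis (Fin n → ℤ) ℂ (HTheta θ) :=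
  HilbertBasis.mkOfOrthogonalEqBot (v := HTheta.monomial θ) orthonormal_monomial (by
    rw [Submodule.eq_bot_iff]
    intro h hh
    refine HTheta.ext_coeff fun k => ?_
    rw [inner_zero_right]
    exact Submodule.inner_right_of_mem_orthogonal
      (Submodule.subset_span (Set.mem_range_self k)) hh)

theorem monomialBasis_repr (h : HTheta θ) (k : Fin n → ℤ) :
    (monomialBasis θ).repr h k = ⟪HTheta.monomial θ k, h⟫_ℂ := by
  rw [HilbertBasis.repr_apply_apply, monomialBasis, HilbertBasis.coe_mkOfOrthogonalEqBot]

/-- Linearity reduces continuity to the origin, so `q` need only be continuous there and vanish at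
`0`; no seminorm axioms are used. -/
theorem continuous_of_norm_le_seminorm {E F : Type*} [AddCommGroup E] [Module ℂ E]
    [TopologicalSpace E] [IsTopologicalAddGroup E] [SeminormedAddCommGroup F] [NormedSpace ℂ F]
    (f : E →ₗ[ℂ] F) {q : E → ℝ} (hq : Continuous q) (h0 : q 0 = 0) (h : ∀ x, ‖f x‖ ≤ q x) :
    Continuous f := by
  refine continuous_of_continuousAt_zero f ?_
  have h1 := hq.tendsto 0
  rw [h0] at h1
  rw [ContinuousAt, map_zero]
  exact squeeze_zero_norm h h1

theorem continuous_decayBound (N : ℕ) : Continuous (decayBound (θ := θ) N) := by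
  have h := (SmoothTorus.withSeminorms θ).continuous_seminorm
  exact continuous_const.mul ((h 0).add (continuous_finsetSum _ fun j _ => h _))

theorem decayBound_zero (N : ℕ) : decayBound N (0 : SmoothTorus θ) = 0 := by
  simp [decayBound]

theorem summable_fourierCoeff_mul {e : (Fin n → ℤ) → ℂ} {C : ℝ} {N : ℕ}
    (he : ∀ k, ‖e k‖ ≤ C * weight k ^ N) (v : SmoothTorus θ) :
    Summable fun k => fourierCoeff θ k v * e k := by
  refine Summable.of_norm_bounded ((rapidDecay_fourierCoeff v N).mul_left C) fun k => ?_
  rw [norm_mul, mul_comm]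
  calc _ ≤ C * weight k ^ N * ‖fourierCoeff θ k v‖ :=
        mul_le_mul_of_nonneg_right (he k) (norm_nonneg _)
    _ = _ := by rw [mul_assoc]; rfl

variable (θ) in
/-- The linear functional on `𝒜_θ` that takes prescribed values of polynomial growth at the `U^k`. -/
def linearOfGrowth {e : (Fin n → ℤ) → ℂ} {C : ℝ} {N : ℕ} (he : ∀ k, ‖e k‖ ≤ C * weight k ^ N) :
    SmoothTorus θ →ₗ[ℂ] ℂ where
  toFun v := ∑' k, fourierCoeff θ k v * e k
  map_add' v w := by
    rw [← (summable_fourierCoeff_mul he v).tsum_add (summable_fourierCoeff_mul he w)]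
    exact tsum_congr fun k => by rw [map_add, add_mul]
  map_smul' c v := by
    rw [RingHom.id_apply, ← (summable_fourierCoeff_mul he v).tsum_const_smul]
    exact tsum_congr fun k => by rw [map_smul, smul_mul_assoc]

variable (θ) in
/-- The functional `linearOfGrowth` is continuous. -/
def dualOfGrowth {e : (Fin n → ℤ) → ℂ} {C : ℝ} {N : ℕ} (he : ∀ k, ‖e k‖ ≤ C * weight k ^ N) :
    Dual θ where
  toLinearMap := linearOfGrowth θ he
  cont := by
    refine continuous_of_norm_le_seminorm (linearOfGrowth θ he)
      (q := fun v => C * (decayBound (N + 2 * n) v * ∑' k : Fin n → ℤ, (weight k ^ (2 * n))⁻¹))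
      (continuous_const.mul ((continuous_decayBound _).mul continuous_const))
      (by simp [decayBound_zero]) fun v => ?_
    have hC : 0 ≤ C := by
      have := (norm_nonneg _).trans (he 0)
      exact nonneg_of_mul_nonneg_left this (pow_pos (weight_pos _) _)
    rw [← tsum_mul_left, ← tsum_mul_left]
    refine tsum_of_norm_bounded (((summable_weight n).mul_left _).mul_left _).hasSum fun k => ?_
    have hw := pow_pos (weight_pos k) N
    have hw' := pow_pos (weight_pos k) (2 * n)
    have h1 := weight_pow_mul_norm_fourierCoeff_le (N + 2 * n) k v
    rw [norm_mul, ← mul_assoc, ← div_eq_mul_inv, le_div_iff₀ hw']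
    calc _ ≤ ‖fourierCoeff θ k v‖ * (C * weight k ^ N) * weight k ^ (2 * n) :=
          mul_le_mul_of_nonneg_right (mul_le_mul_of_nonneg_left (he k) (norm_nonneg _)) hw'.le
      _ = C * (weight k ^ (N + 2 * n) * ‖fourierCoeff θ k v‖) := by rw [pow_add]; ring
      _ ≤ _ := mul_le_mul_of_nonneg_left h1 hC

theorem dualOfGrowth_monomial {e : (Fin n → ℤ) → ℂ} {C : ℝ} {N : ℕ}
    (he : ∀ k, ‖e k‖ ≤ C * weight k ^ N) (k : Fin n → ℤ) :
    dualOfGrowth θ he (monomial θ k) = e k := by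
  change ∑' l, fourierCoeff θ l (monomial θ k) * e l = e k
  rw [tsum_eq_single k]
  · rw [fourierCoeff_monomial, if_pos rfl, one_mul]
  · intro l hl
    rw [fourierCoeff_monomial, if_neg hl.symm, zero_mul]

theorem exists_dual_coeff_eq {d : (Fin n → ℤ) → ℂ} {C : ℝ} {N : ℕ}
    (hd : ∀ k, ‖d k‖ ≤ C * weight k ^ N) : ∃ φ : Dual θ, ∀ k, φ.coeff k = d k := by
  -- Coefficients in `𝒜_θ'` are values at `(U^k)⋆`, a unimodular multiple of `U^{-k}`. The
  -- prescribed values at the monomials are therefore reflected and corrected by the cocycle.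
  have he : ∀ k, ‖cocycle θ (-k) k * d (-k)‖ ≤ C * weight k ^ N := fun k => by
    rw [norm_mul, norm_cocycle, one_mul, ← weight_neg k]; exact hd (-k)
  refine ⟨dualOfGrowth θ he, fun k => ?_⟩
  rw [Dual.coeff, star_monomial, map_smul, dualOfGrowth_monomial, neg_neg, smul_eq_mul,
    inv_mul_cancel_left₀ (cocycle_ne_zero θ _ _)]

theorem SobolevSpace.inner_Lambda {s : ℝ} (x : SobolevSpace θ s) (k : Fin n → ℤ) :
    ⟪HTheta.monomial θ k, SobolevSpace.Lambda θ s x⟫_ℂ =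
      bracket s k * (SobolevSpace.toDual x).coeff k :=
  (SobolevSpace.exists_Lambda x).choose_spec k

/-- The isometry of `ℋ_θ^{(s)}` onto `ℓ²(ℤⁿ)` given by the Fourier coefficients of `Λ^s u`. -/
def sobolevIsometry (hθ : θ.transpose = -θ) (s : ℝ) : SobolevSpace θ s ≃ₗᵢ[ℂ] SeqL2 n where
  toLinearEquiv := LinearEquiv.ofBijective
    ((monomialBasis θ).repr.toLinearEquiv.toLinearMap ∘ₗ SobolevSpace.Lambda θ s) (by
      constructor
      · intro x y hxy
        have h1 : SobolevSpace.Lambda θ s x = SobolevSpace.Lambda θ s y :=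
          (monomialBasis θ).repr.injective hxy
        refine Subtype.val_injective (Dual.ext_coeff hθ fun k => ?_)
        have h2 := SobolevSpace.inner_Lambda x k
        rw [h1, SobolevSpace.inner_Lambda] at h2
        exact (mul_left_cancel₀ (bracket_ne_zero s k) h2).symm
      · intro y
        -- Surjectivity: undoing `Λ^s` on an `ℓ²` sequence costs at most polynomial growth, so the
        -- result is the coefficient sequence of an element of `𝒜_θ'`.
        have hd : ∀ k, ‖(bracket (-s) k : ℂ) * y k‖ ≤
            (‖y‖ * (n + 1) ^ (2 * ⌈|-s|⌉₊)) * weight k ^ (2 * ⌈|-s|⌉₊) := fun k => by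
          rw [norm_mul, Complex.norm_real, Real.norm_of_nonneg (bracket_pos _ k).le, mul_comm,
            mul_assoc, ← mul_pow]
          exact mul_le_mul (lp.norm_apply_le_norm two_ne_zero y k) (bracket_le_weight _ k)
            (bracket_pos _ k).le (norm_nonneg _)
        obtain ⟨φ, hφ⟩ := exists_dual_coeff_eq (θ := θ) hd
        have hφ' : ∀ k, (bracket s k : ℂ) * φ.coeff k = y k := fun k => by
          rw [hφ, bracket_neg, Complex.ofReal_inv, mul_inv_cancel_left₀ (bracket_ne_zero s k)]
        let x : SobolevSpace θ s := ⟨φ, (monomialBasis θ).repr.symm y, fun k => by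
          rw [hφ', ← monomialBasis_repr, LinearIsometryEquiv.apply_symm_apply]⟩
        refine ⟨x, SeqL2.ext fun k => ?_⟩
        change (monomialBasis θ).repr (SobolevSpace.Lambda θ s x) k = y k
        rw [monomialBasis_repr, SobolevSpace.inner_Lambda]
        exact hφ' k)
  norm_map' x := (monomialBasis θ).repr.norm_map _

theorem sobolevIsometry_apply (hθ : θ.transpose = -θ) {s : ℝ} (x : SobolevSpace θ s)
    (k : Fin n → ℤ) :
    sobolevIsometry hθ s x k = bracket s k * (SobolevSpace.toDual x).coeff k := by
  change (monomialBasis θ).repr (SobolevSpace.Lambda θ s x) k = _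
  rw [monomialBasis_repr, SobolevSpace.inner_Lambda]

/-- Rapid decay gives summability, and `ℓ¹ ⊆ ℓ²`. -/
theorem memℓp_fourierCoeff (t : ℝ) (u : SmoothTorus θ) :
    Memℓp (fun k => (bracket t k : ℂ) * fourierCoeff θ k u) 2 := by
  refine Memℓp.of_exponent_ge (q := 1) (memℓp_gen ?_) one_le_two
  have h := (rapidDecay_fourierCoeff u (2 * ⌈|t|⌉₊)).mul_left (((n : ℝ) + 1) ^ (2 * ⌈|t|⌉₊))
  refine h.of_nonneg_of_le (fun k => by positivity) fun k => ?_
  rw [ENNReal.toReal_one, Real.rpow_one, norm_mul, Complex.norm_real,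
    Real.norm_of_nonneg (bracket_pos _ k).le, ← mul_assoc, id, ← mul_pow]
  exact mul_le_mul_of_nonneg_right (bracket_le_weight t k) (norm_nonneg _)

/-- The Fourier coefficients of `Λ^t u` for `u ∈ 𝒜_θ`. -/
def smoothSeq (t : ℝ) (u : SmoothTorus θ) : SeqL2 n := ⟨_, memℓp_fourierCoeff t u⟩

theorem smoothSeq_apply (t : ℝ) (u : SmoothTorus θ) (k : Fin n → ℤ) :
    smoothSeq t u k = bracket t k * fourierCoeff θ k u := rfl

theorem sobolevIsometry_eq_smoothSeq (hθ : θ.transpose = -θ) {t : ℝ} {u : SmoothTorus θ}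
    {x : SobolevSpace θ t} :
    sobolevIsometry hθ t x = smoothSeq t u ↔ SobolevSpace.toDual x = SmoothTorus.toDual u := by
  constructor
  · intro h
    refine Dual.ext_coeff hθ fun k => ?_
    have h1 := congrArg (fun y : SeqL2 n => y k) h
    dsimp only at h1
    rw [sobolevIsometry_apply, smoothSeq_apply] at h1
    exact mul_left_cancel₀ (bracket_ne_zero t k) h1
  · intro h
    refine SeqL2.ext fun k => ?_
    rw [sobolevIsometry_apply, smoothSeq_apply, h, coeff_toDual]

theorem smoothSeq_monomial [DecidableEq (Fin n → ℤ)] (t : ℝ) (k : Fin n → ℤ) :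
    smoothSeq t (monomial θ k) = (bracket t k : ℂ) • (lp.single 2 k (1 : ℂ) : SeqL2 n) := by
  refine SeqL2.ext fun l => ?_
  rw [smoothSeq_apply, fourierCoeff_monomial, lp.coeFn_smul, Pi.smul_apply, lp.coeFn_single,
    Pi.single_apply, smul_eq_mul]
  by_cases h : l = k
  · subst h; simp
  · rw [if_neg h, if_neg (Ne.symm h), mul_zero, mul_zero]

/-- A bounded operator on `ℓ²` is determined by the image of the smooth sequences. -/
theorem SeqL2.clm_ext {F : Type*} [NormedAddCommGroup F] [NormedSpace ℂ F] (t : ℝ)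
    {S T : SeqL2 n →L[ℂ] F}
    (h : ∀ u : SmoothTorus θ, S (smoothSeq t u) = T (smoothSeq t u)) : S = T := by
  classical
  have h1 : ∀ k, S (lp.single 2 k (1 : ℂ)) = T (lp.single 2 k (1 : ℂ)) := fun k => by
    have := h (monomial θ k)
    rw [smoothSeq_monomial, map_smul, map_smul] at this
    exact smul_right_injective F (bracket_ne_zero t k) this
  ext x
  have hx := lp.hasSum_single (p := 2) (by simp) x
  refine (hx.mapL S).unique ?_
  convert! hx.mapL T using 1
  ext1 k
  have h2 : (lp.single 2 k (x k) : SeqL2 n) = x k • (lp.single 2 k (1 : ℂ) : SeqL2 n) := by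
    rw [← lp.single_smul, smul_eq_mul, mul_one]
  rw [h2, map_smul, map_smul, h1]

variable {m : ℝ}

/-- The weight of order `s + m` in the input cancels the inverse weight in `diagEntry`, leaving the
Fourier series of `P_ρ u` weighted by `bracket s`. -/
theorem matrixOp_smoothSeq (hθ : θ.transpose = -θ) (s : ℝ) (ρ : SymbolSpace θ m)
    (u : SmoothTorus θ) :
    matrixOp s ρ (smoothSeq (s + m) u) = smoothSeq s (psiDO (SymbolSpace.toFun ρ) u) := by
  refine SeqL2.ext fun j => ?_
  refine (hasSum_matrixOp_apply s ρ _ j).unique ?_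
  rw [smoothSeq_apply]
  convert! (hasSum_fourierCoeff_psiDO hθ ρ u j).mul_left (bracket s j : ℂ) using 1
  ext1 l
  rw [smoothSeq_apply, diagEntry, bracket_neg, Complex.ofReal_inv]
  have := bracket_ne_zero (s + m) (j - l)
  field_simp

/-- The extension of `P_ρ` to Sobolev spaces. -/
def sobolevOp (hθ : θ.transpose = -θ) (s : ℝ) :
    SymbolSpace θ m →ₗ[ℂ] SobolevSpace θ (s + m) →L[ℂ] SobolevSpace θ s where
  toFun ρ := ((sobolevIsometry hθ s).symm.toContinuousLinearEquiv.toContinuousLinearMap.comp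
    (matrixOp s ρ)).comp (sobolevIsometry hθ (s + m)).toContinuousLinearEquiv.toContinuousLinearMap
  map_add' ρ σ := by rw [map_add, ContinuousLinearMap.comp_add, ContinuousLinearMap.add_comp]
  map_smul' c ρ := by
    rw [map_smul, ContinuousLinearMap.comp_smul, ContinuousLinearMap.smul_comp, RingHom.id_apply]

theorem sobolevOp_apply (hθ : θ.transpose = -θ) (s : ℝ) (ρ : SymbolSpace θ m)
    (x : SobolevSpace θ (s + m)) :
    sobolevOp hθ s ρ x =
      (sobolevIsometry hθ s).symm (matrixOp s ρ (sobolevIsometry hθ (s + m) x)) := rfl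

theorem norm_sobolevOp_le (hθ : θ.transpose = -θ) (s : ℝ) (ρ : SymbolSpace θ m) :
    ‖sobolevOp hθ s ρ‖ ≤ ‖matrixOp s ρ‖ := by
  refine ContinuousLinearMap.opNorm_le_bound _ (norm_nonneg _) fun x => ?_
  rw [sobolevOp_apply, LinearIsometryEquiv.norm_map]
  refine (ContinuousLinearMap.le_opNorm _ _).trans_eq ?_
  rw [LinearIsometryEquiv.norm_map]

theorem continuous_symbolBound (N : ℕ) : Continuous (symbolBound (θ := θ) (m := m) N) := by
  have h := (SymbolSpace.withSeminorms θ m).continuous_seminorm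
  exact continuous_const.mul ((h _).add (continuous_finsetSum _ fun j _ => h _))

theorem continuous_sobolevOp (hθ : θ.transpose = -θ) (s : ℝ) :
    Continuous (sobolevOp (m := m) hθ s) := by
  have := (SymbolSpace.withSeminorms θ m).topologicalAddGroup
  refine continuous_of_norm_le_seminorm _
    (q := fun ρ => diagConst n s m * symbolBound (2 * ⌈|s|⌉₊ + 2 * n) ρ *
      ∑' l : Fin n → ℤ, (weight l ^ (2 * n))⁻¹)
    ((continuous_const.mul (continuous_symbolBound _)).mul continuous_const) ?_
    fun ρ => (norm_sobolevOp_le hθ s ρ).trans (norm_matrixOp_le s ρ)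
  simp [symbolBound]

theorem extendsOnSobolev_sobolevOp (hθ : θ.transpose = -θ) (s : ℝ) (ρ : SymbolSpace θ m) :
    ExtendsOnSobolev ρ (sobolevOp hθ s ρ) := by
  intro u
  refine ⟨(sobolevIsometry hθ (s + m)).symm (smoothSeq (s + m) u), ?_, ?_⟩
  · rw [← sobolevIsometry_eq_smoothSeq hθ, LinearIsometryEquiv.apply_symm_apply]
  · rw [← sobolevIsometry_eq_smoothSeq hθ, sobolevOp_apply, LinearIsometryEquiv.apply_symm_apply,
      LinearIsometryEquiv.apply_symm_apply, matrixOp_smoothSeq hθ]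

/-- Transported to `ℓ²`, the element representing `u` must be `smoothSeq t u`; the two operators
thus agree on the weighted Fourier sequences of `𝒜_θ`, and `SeqL2.clm_ext` applies. -/
theorem ExtendsOnSobolev.unique (hθ : θ.transpose = -θ) {s t : ℝ} {ρ : SymbolSpace θ m}
    {S T : SobolevSpace θ t →L[ℂ] SobolevSpace θ s} (hS : ExtendsOnSobolev ρ S)
    (hT : ExtendsOnSobolev ρ T) : S = T := by
  let c : (SobolevSpace θ t →L[ℂ] SobolevSpace θ s) → SeqL2 n →L[ℂ] SeqL2 n := fun R =>
    ((sobolevIsometry hθ s).toContinuousLinearEquiv.toContinuousLinearMap.comp R).comp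
      (sobolevIsometry hθ t).symm.toContinuousLinearEquiv.toContinuousLinearMap
  have hc : ∀ {R : SobolevSpace θ t →L[ℂ] SobolevSpace θ s}, ExtendsOnSobolev ρ R →
      ∀ u : SmoothTorus θ, c R (smoothSeq t u) = smoothSeq s (psiDO (SymbolSpace.toFun ρ) u) := by
    intro R hR u
    obtain ⟨x, hx, hRx⟩ := hR u
    rw [← sobolevIsometry_eq_smoothSeq hθ] at hx hRx
    change sobolevIsometry hθ s (R ((sobolevIsometry hθ t).symm (smoothSeq t u))) = _
    rw [← hx, LinearIsometryEquiv.symm_apply_apply, hRx]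
  have h : c S = c T := SeqL2.clm_ext t fun u => (hc hS u).trans (hc hT u).symm
  ext1 x
  refine (sobolevIsometry hθ s).injective ?_
  have h1 := congrArg (fun R : SeqL2 n →L[ℂ] SeqL2 n => R (sobolevIsometry hθ t x)) h
  change sobolevIsometry hθ s (S ((sobolevIsometry hθ t).symm (sobolevIsometry hθ t x))) =
    sobolevIsometry hθ s (T ((sobolevIsometry hθ t).symm (sobolevIsometry hθ t x))) at h1
  rwa [LinearIsometryEquiv.symm_apply_apply] at h1

theorem isImage_iff {h : HTheta θ} {u : SmoothTorus θ} :
    IsImage h u ↔ (monomialBasis θ).repr h = smoothSeq 0 u := by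
  constructor
  · intro H
    refine SeqL2.ext fun k => ?_
    rw [monomialBasis_repr, H k, smoothSeq_apply, bracket_zero, Complex.ofReal_one, one_mul]; rfl
  · intro H k
    rw [← monomialBasis_repr, H, smoothSeq_apply, bracket_zero, Complex.ofReal_one, one_mul]; rfl

/-- The diagonal operator `Λ^m` on `ℓ²` for `m < 0`. -/
def bracketOp (n : ℕ) {m : ℝ} (hm : m < 0) : SeqL2 n →L[ℂ] SeqL2 n :=
  weightedShift (fun k => (bracket m k : ℂ)) 0 zero_le_one fun k => by
    rw [Complex.norm_real, Real.norm_of_nonneg (bracket_pos m k).le, bracket_eq]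
    exact Real.rpow_le_one_of_one_le_of_nonpos (one_le_jap k) (by linarith)

/-- The extension of `P_ρ` to `ℋ_θ` for a symbol of negative order. -/
def hilbertOp (hm : m < 0) (ρ : SymbolSpace θ m) : HTheta θ →L[ℂ] HTheta θ :=
  ((monomialBasis θ).repr.symm.toContinuousLinearEquiv.toContinuousLinearMap.comp
    ((matrixOp 0 ρ).comp (bracketOp n hm))).comp
      (monomialBasis θ).repr.toContinuousLinearEquiv.toContinuousLinearMap

theorem hilbertOp_apply (hm : m < 0) (ρ : SymbolSpace θ m) (h : HTheta θ) :
    hilbertOp hm ρ h = (monomialBasis θ).repr.symm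
      (matrixOp 0 ρ (bracketOp n hm ((monomialBasis θ).repr h))) := rfl

/-- Compactness comes from the factor `Λ^m`; composition with bounded operators preserves it. -/
theorem isCompactOperator_hilbertOp (hm : m < 0) (ρ : SymbolSpace θ m) :
    IsCompactOperator (hilbertOp hm ρ) := by
  have h : IsCompactOperator (bracketOp n hm) :=
    isCompactOperator_weightedShift_zero _ _ _ (tendsto_bracket_cofinite hm)
  exact ((h.clm_comp (matrixOp 0 ρ)).clm_comp
    (monomialBasis θ).repr.symm.toContinuousLinearEquiv.toContinuousLinearMap).comp_clm
      (monomialBasis θ).repr.toContinuousLinearEquiv.toContinuousLinearMap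

theorem bracketOp_smoothSeq (hm : m < 0) (u : SmoothTorus θ) :
    bracketOp n hm (smoothSeq 0 u) = smoothSeq (0 + m) u := by
  refine SeqL2.ext fun k => ?_
  rw [bracketOp, weightedShift_apply, smoothSeq_apply, smoothSeq_apply, sub_zero, bracket_zero,
    Complex.ofReal_one, one_mul, zero_add]

theorem extendsOnHTheta_hilbertOp (hθ : θ.transpose = -θ) (hm : m < 0) (ρ : SymbolSpace θ m) :
    ExtendsOnHTheta ρ (hilbertOp hm ρ) := by
  intro u
  refine ⟨(monomialBasis θ).repr.symm (smoothSeq 0 u), ?_, ?_⟩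
  · rw [isImage_iff, LinearIsometryEquiv.apply_symm_apply]
  · rw [isImage_iff, hilbertOp_apply, LinearIsometryEquiv.apply_symm_apply,
      LinearIsometryEquiv.apply_symm_apply, bracketOp_smoothSeq, matrixOp_smoothSeq hθ]

theorem ExtendsOnHTheta.unique {ρ : SymbolSpace θ m} {S T : HTheta θ →L[ℂ] HTheta θ}
    (hS : ExtendsOnHTheta ρ S) (hT : ExtendsOnHTheta ρ T) : S = T := by
  let c : (HTheta θ →L[ℂ] HTheta θ) → SeqL2 n →L[ℂ] HTheta θ := fun R =>
    R.comp (monomialBasis θ).repr.symm.toContinuousLinearEquiv.toContinuousLinearMap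
  have h : c S = c T := SeqL2.clm_ext 0 fun u => by
    obtain ⟨x, hx, hSx⟩ := hS u
    obtain ⟨y, hy, hTy⟩ := hT u
    rw [isImage_iff] at hx hSx hy hTy
    change S ((monomialBasis θ).repr.symm (smoothSeq 0 u)) =
      T ((monomialBasis θ).repr.symm (smoothSeq 0 u))
    refine (monomialBasis θ).repr.injective ?_
    conv_lhs => rw [← hx, LinearIsometryEquiv.symm_apply_apply, hSx]
    conv_rhs => rw [← hy, LinearIsometryEquiv.symm_apply_apply, hTy]
  ext1 x
  have h1 := congrArg (fun R : SeqL2 n →L[ℂ] HTheta θ => R ((monomialBasis θ).repr x)) h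
  change S ((monomialBasis θ).repr.symm ((monomialBasis θ).repr x)) =
    T ((monomialBasis θ).repr.symm ((monomialBasis θ).repr x)) at h1
  rwa [LinearIsometryEquiv.symm_apply_apply] at h1

end Sobolev

end NCTorus
end

/-! ### The main theorem. -/

open NCTorus
theorem mainTheorem5 {n : ℕ} (hn : 2 ≤ n) (θ : Matrix (Fin n) (Fin n) ℝ)
    (hθ : θ.transpose = -θ) (m : ℝ) :
    (∀ (ρ : SymbolSpace θ m) (u : SmoothTorus θ),
      HasOscIntegral (amplitude ρ.toFun u) (psiDO ρ.toFun u)) ∧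
    (∀ s : ℝ,
      (∀ ρ : SymbolSpace θ m, ∃! T : SobolevSpace θ (s + m) →L[ℂ] SobolevSpace θ s,
        ExtendsOnSobolev ρ T) ∧
      ∃ Φ : SymbolSpace θ m →L[ℂ] (SobolevSpace θ (s + m) →L[ℂ] SobolevSpace θ s),
        ∀ ρ : SymbolSpace θ m, ExtendsOnSobolev ρ (Φ ρ)) ∧
    (m < 0 → ∀ ρ : SymbolSpace θ m,
      (∃! T : HTheta θ →L[ℂ] HTheta θ, ExtendsOnHTheta ρ T) ∧
      ∀ T : HTheta θ →L[ℂ] HTheta θ, ExtendsOnHTheta ρ T → IsCompactOperator T) := by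
  refine ⟨fun ρ u => hasOscIntegral_psiDO hθ ρ u, fun s => ⟨fun ρ => ?_, ?_⟩, fun hm ρ => ⟨?_, ?_⟩⟩
  · exact ⟨sobolevOp hθ s ρ, extendsOnSobolev_sobolevOp hθ s ρ,
      fun T hT => hT.unique hθ (extendsOnSobolev_sobolevOp hθ s ρ)⟩
  · exact ⟨⟨sobolevOp hθ s, continuous_sobolevOp hθ s⟩, extendsOnSobolev_sobolevOp hθ s⟩
  · exact ⟨hilbertOp hm ρ, extendsOnHTheta_hilbertOp hθ hm ρ,
      fun T hT => hT.unique (extendsOnHTheta_hilbertOp hθ hm ρ)⟩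
  · intro T hT
    rw [hT.unique (extendsOnHTheta_hilbertOp hθ hm ρ)]
    exact isCompactOperator_hilbertOp hm ρ
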